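/- Let $\Bbbk=\mathbb R$ or $\mathbb C$. A complete bornological vector space is a $\Bbbk$-vector space with a bornology that is stable under finite sums and homotheties and in which every bounded set lies in a bounded completant disc (an absolutely convex set whose linear span is a Banach space for its gauge); $V\otimes W$ denotes the complete tensor product, universal for bounded bilinear maps into complete spaces. Let $A$ be a complete bornological algebra (associative, possibly nonunital, with bounded multiplication). Put $A^+=A$ if $A$ is unital and $A^+=A\oplus\Bbbk$, the unitalization, otherwise. An $A$-module is a complete bornological unital right $A^+$-module, $\mathcal L_A(M,N)$ is the space of bounded $A$-linear maps with the equibounded bornology, and $M\otimes_A N$ is the quotient of $M\otimes N$ by the closure of the span of the tensors $ma\otimes n-m\otimes an$. Suppose that $A$ is *quasi-unital*: (i) for each bounded $S\subset A$ there are a sequence $(\mu_n)$ in $A$ and a bounded completant disc $T\supset S$ such that $\mu_nx\to x$ and $x\mu_n\to x$ uniformly for $x\in S$ in the Banach space $A_T$ spanned by $T$, and (ii) the multiplication maps $A^+\otimes A\to A$ and $A\otimes A^+\to A$ have bounded sections that are maps of left, respectively right, $A^+$-modules. Suppose also that $A$ is *multiplicatively convex*: each bounded set is absorbed by a bounded disc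 that is closed under multiplication. Call a module $P$ *projective* if $\mathcal L_A(P,-)$ takes the short exact sequences of $A$-modules that have a bounded $\Bbbk$-linear splitting to exact sequences with a bounded $\Bbbk$-linear splitting, and *finitely generated* if for some $n$ there is a bounded module map $(A^+)^n\to P$ with a bounded $\Bbbk$-linear section. All complexes are bounded in grading degree. A complex $M^\bullet$ of $A$-modules is *h-finite* if the multiplication map $M^\bullet\otimes_AA\to M^\bullet$ is a homotopy equivalence and $M^\bullet$ is homotopy equivalent to a bounded complex of finitely generated projective $A$-modules (maps and homotopies being bounded and $A$-linear). A map $f\in\mathcal L_A(M,N)$ is *$A$-nuclear* if it lies in the image of $N\otimes_A\mathcal L_A(M,A)\to\mathcal L_A(M,N)$, $(n\otimes\phi)(m)=n\,\phi(m)$; a map of complexes is $A$-nuclear if its graded components are. **Corollary.** A bounded complex $M^\bullet$ of $A$-modules is h-finite if and only if $\mathrm{id}_{M^\bullet}$ is homotopic to an $A$-nuclear map. -/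

import Mathlib

noncomputable section

namespace Borno

open Set Bornology
open scoped Pointwise

universe u

set_option linter.unusedSectionVars false

/-! ### Complete bornological vector spaces -/

section Discs

variable (𝕜 : Type) [RCLike 𝕜] {V : Type*} [AddCommGroup V] [Module 𝕜 V]

/-- A disc: a nonempty, circled and convex (that is, absolutely convex) subset. -/
structure IsDisc (D : Set V) : Prop where
  nonempty : D.Nonempty
  combo : ∀ x ∈ D, ∀ y ∈ D, ∀ a b : 𝕜, ‖a‖ + ‖b‖ ≤ 1 → a • x + b • y ∈ D

/-- `x n → l` for the gauge semi-norm of the disc `D`. -/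
def ConvIn (D : Set V) (x : ℕ → V) (l : V) : Prop :=
  ∀ ε : ℝ, 0 < ε → ∃ N, ∀ n ≥ N, x n - l ∈ (ε : 𝕜) • D

/-- A completant disc: its gauge is a norm on the linear span of `D`, and that span is complete.
(A sequence as in `complete` is, up to a translation and finitely many terms, an arbitrary Cauchy
sequence of the span of `D`.) -/
structure IsCompletant (D : Set V) : Prop extends IsDisc 𝕜 D where
  norming : ∀ x : V, (∀ ε : ℝ, 0 < ε → x ∈ (ε : 𝕜) • D) → x = 0
  complete : ∀ x : ℕ → V,
    (∀ ε : ℝ, 0 < ε → ∃ N, ∀ m ≥ N, ∀ n ≥ N, x m - x n ∈ (ε : 𝕜) • D) → ∃ l, ConvIn 𝕜 D x l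

/-- A complete bornological vector space: a vector space with a bornology that is stable under
sums and homotheties and in which every bounded set lies in a bounded completant disc. -/
class CompleteBVS (V : Type*) [AddCommGroup V] [Module 𝕜 V] [Bornology V] : Prop where
  add : ∀ S T : Set V, IsBounded S → IsBounded T → IsBounded (S + T)
  smul : ∀ (c : 𝕜) (S : Set V), IsBounded S → IsBounded (c • S)
  complete : ∀ S : Set V, IsBounded S → ∃ D, S ⊆ D ∧ IsBounded D ∧ IsCompletant 𝕜 D

variable {𝕜}

lemma IsDisc.zero_mem {D : Set V} (h : IsDisc 𝕜 D) : (0 : V) ∈ D := by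
  obtain ⟨x, hx⟩ := h.nonempty
  simpa using h.combo x hx x hx 0 0 (by simp)

lemma IsDisc.smul_mem {D : Set V} (h : IsDisc 𝕜 D) {x : V} (hx : x ∈ D) {a : 𝕜} (ha : ‖a‖ ≤ 1) :
    a • x ∈ D := by
  simpa using h.combo x hx x hx a 0 (by simpa using ha)

lemma mem_smul_iff {D : Set V} {r : ℝ} (hr : 0 < r) {x : V} :
    x ∈ (r : 𝕜) • D ↔ ((r : 𝕜)⁻¹) • x ∈ D :=
  Set.mem_smul_set_iff_inv_smul_mem₀ (by simpa using hr.ne') _ _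

lemma IsDisc.smul_mono {D : Set V} (h : IsDisc 𝕜 D) {r s : ℝ} (hr : 0 < r) (hrs : r ≤ s) {x : V}
    (hx : x ∈ (r : 𝕜) • D) : x ∈ (s : 𝕜) • D := by
  obtain ⟨y, hy, rfl⟩ := hx
  have hs : 0 < s := hr.trans_le hrs
  rw [mem_smul_iff hs]
  simp only [smul_smul]
  refine h.smul_mem hy ?_
  rw [norm_mul, norm_inv, RCLike.norm_ofReal, RCLike.norm_ofReal, abs_of_pos hr, abs_of_pos hs,
    inv_mul_le_iff₀ hs]
  simpa using hrs

lemma IsDisc.combo_smul {D : Set V} (h : IsDisc 𝕜 D) {r s : ℝ} (hr : 0 < r) (hs : 0 < s)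
    {x y : V} (hx : x ∈ (r : 𝕜) • D) (hy : y ∈ (s : 𝕜) • D) {a b : 𝕜} {t : ℝ} (ht : 0 < t)
    (hab : ‖a‖ * r + ‖b‖ * s ≤ t) : a • x + b • y ∈ (t : 𝕜) • D := by
  obtain ⟨x, hx, rfl⟩ := hx
  obtain ⟨y, hy, rfl⟩ := hy
  rw [mem_smul_iff ht]
  simp only [smul_smul, smul_add]
  refine h.combo x hx y hy _ _ ?_
  simp only [norm_mul, norm_inv, RCLike.norm_ofReal, abs_of_pos hr, abs_of_pos hs, abs_of_pos ht]
  rw [← mul_add, inv_mul_le_iff₀ ht]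
  simpa using hab

lemma IsDisc.add_smul {D : Set V} (h : IsDisc 𝕜 D) {r s : ℝ} (hr : 0 < r) (hs : 0 < s)
    {x y : V} (hx : x ∈ (r : 𝕜) • D) (hy : y ∈ (s : 𝕜) • D) : x + y ∈ ((r + s : ℝ) : 𝕜) • D := by
  simpa using h.combo_smul hr hs hx hy (a := 1) (b := 1) (add_pos hr hs) (by simp)

lemma IsDisc.sub_smul {D : Set V} (h : IsDisc 𝕜 D) {r s : ℝ} (hr : 0 < r) (hs : 0 < s)
    {x y : V} (hx : x ∈ (r : 𝕜) • D) (hy : y ∈ (s : 𝕜) • D) : x - y ∈ ((r + s : ℝ) : 𝕜) • D := by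
  simpa [sub_eq_add_neg] using
    h.combo_smul hr hs hx hy (a := 1) (b := -1) (add_pos hr hs) (by simp)

lemma IsDisc.neg_smul {D : Set V} (h : IsDisc 𝕜 D) {r : ℝ} (hr : 0 < r)
    {x : V} (hx : x ∈ (r : 𝕜) • D) : -x ∈ (r : 𝕜) • D := by
  simpa using h.combo_smul hr hr hx hx (a := -1) (b := 0) hr (by simp)

lemma IsDisc.sum_mem {ι : Type*} {D : Set V} (h : IsDisc 𝕜 D) (F : Finset ι) (c : ι → 𝕜)
    (x : ι → V) (hx : ∀ i ∈ F, c i ≠ 0 → x i ∈ D) {r : ℝ} (hr : 0 < r) (hc : ∑ i ∈ F, ‖c i‖ ≤ r) :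
    ∑ i ∈ F, c i • x i ∈ (r : 𝕜) • D := by
  classical
  induction F using Finset.induction_on generalizing r with
  | empty => simpa using Set.zero_mem_smul_set h.zero_mem
  | insert i F hi ih =>
    rw [Finset.sum_insert hi] at hc ⊢
    by_cases h0 : c i = 0
    · simp only [h0, norm_zero, zero_add, zero_smul] at hc ⊢
      exact ih (fun j hj => hx j (Finset.mem_insert_of_mem hj)) hr hc
    have hxi := hx i (Finset.mem_insert_self _ _) h0
    have hpos : 0 < ‖c i‖ := norm_pos_iff.2 h0
    rcases (Finset.sum_nonneg (fun j (_ : j ∈ F) => norm_nonneg (c j))).eq_or_lt with h1 | h1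
    · have : ∑ j ∈ F, c j • x j = 0 := Finset.sum_eq_zero fun j hj => by
        have := (Finset.sum_eq_zero_iff_of_nonneg (fun j _ => norm_nonneg (c j))).1 h1.symm j hj
        rw [norm_eq_zero.1 this, zero_smul]
      rw [this, add_zero, mem_smul_iff hr, smul_smul]
      refine h.smul_mem hxi ?_
      rw [norm_mul, norm_inv, RCLike.norm_ofReal, abs_of_pos hr, inv_mul_le_iff₀ hr]
      linarith
    · have h2 := ih (fun j hj => hx j (Finset.mem_insert_of_mem hj)) h1 le_rfl
      have h3 : x i ∈ ((1 : ℝ) : 𝕜) • D := by simpa using hxi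
      simpa using h.combo_smul one_pos h1 h3 h2 (a := c i) (b := 1) hr (by simpa using hc)

end Discs

section Complete

variable {𝕜 : Type} [RCLike 𝕜] {V : Type*} [AddCommGroup V] [Module 𝕜 V] [Bornology V]
  [CompleteBVS 𝕜 V]

lemma exists_disc₂ {S T : Set V} (hS : IsBounded S) (hT : IsBounded T) :
    ∃ D, S ⊆ D ∧ T ⊆ D ∧ IsBounded D ∧ IsCompletant 𝕜 D := by
  obtain ⟨D, h, h1, h2⟩ := CompleteBVS.complete (𝕜 := 𝕜) (S ∪ T) (hS.union hT)
  exact ⟨D, subset_union_left.trans h, subset_union_right.trans h, h1, h2⟩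

variable (𝕜) in
/-- A vector that is arbitrarily small with respect to a bounded set is zero. -/
lemma eq_zero_of_small {S : Set V} (hS : IsBounded S) {x : V}
    (h : ∀ ε : ℝ, 0 < ε → x ∈ (ε : 𝕜) • S) : x = 0 := by
  obtain ⟨D, h1, -, h3⟩ := CompleteBVS.complete (𝕜 := 𝕜) S hS
  exact h3.norming x fun ε hε => Set.smul_set_mono h1 (h ε hε)

end Complete

/-- A bounded map. -/
def IsBdd {V W : Type*} [Bornology V] [Bornology W] (f : V → W) : Prop :=
  ∀ S, IsBounded S → IsBounded (f '' S)

/-- A map of two variables that is bounded on products of bounded sets. -/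
def IsBdd₂ {V W X : Type*} [Bornology V] [Bornology W] [Bornology X] (b : V → W → X) : Prop :=
  ∀ S T, IsBounded S → IsBounded T → IsBounded (image2 b S T)

lemma IsBdd.comp {V W X : Type*} [Bornology V] [Bornology W] [Bornology X] {g : W → X} {f : V → W}
    (hg : IsBdd g) (hf : IsBdd f) : IsBdd fun x => g (f x) := fun S hS => by
  have := hg _ (hf S hS)
  rwa [image_image] at this

/-! ### Subspaces and quotients -/

section Quotient

variable {𝕜 : Type} [RCLike 𝕜] {V : Type u} [AddCommGroup V] [Module 𝕜 V] [Bornology V]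

/-- A subspace is closed if it contains the limits of its sequences that converge with respect to
some bounded disc. -/
def IsBClosed (p : Submodule 𝕜 V) : Prop :=
  ∀ D : Set V, IsBounded D → IsDisc 𝕜 D → ∀ x : ℕ → V, (∀ n, x n ∈ p) → ∀ l, ConvIn 𝕜 D x l → l ∈ p

/-- The closure of a subspace: the smallest closed subspace that contains it. -/
def bclosure (p : Submodule 𝕜 V) : Submodule 𝕜 V := sInf {q | p ≤ q ∧ IsBClosed q}

lemma le_bclosure (p : Submodule 𝕜 V) : p ≤ bclosure p := le_sInf fun _ hq => hq.1

lemma bclosure_le {p q : Submodule 𝕜 V} (h : p ≤ q) (hq : IsBClosed q) : bclosure p ≤ q :=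
  sInf_le ⟨h, hq⟩

lemma isBClosed_bclosure (p : Submodule 𝕜 V) : IsBClosed (bclosure p) := by
  intro D hD hd x hx l hl
  rw [bclosure, Submodule.mem_sInf]
  intro q hq
  exact hq.2 D hD hd x (fun n => bclosure_le hq.1 hq.2 (hx n)) l hl

/-- The quotient of `V` by the closure of the subspace `p`. -/
def BQuot (p : Submodule 𝕜 V) : Type u := V ⧸ bclosure p

instance (p : Submodule 𝕜 V) : AddCommGroup (BQuot p) :=
  inferInstanceAs (AddCommGroup (V ⧸ bclosure p))

instance (p : Submodule 𝕜 V) : Module 𝕜 (BQuot p) :=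
  inferInstanceAs (Module 𝕜 (V ⧸ bclosure p))

/-- The quotient map. -/
def BQuot.mk (p : Submodule 𝕜 V) : V →ₗ[𝕜] BQuot p := (bclosure p).mkQ

lemma BQuot.mk_surjective (p : Submodule 𝕜 V) : Function.Surjective (BQuot.mk p) :=
  (bclosure p).mkQ_surjective

lemma BQuot.mk_eq_zero {p : Submodule 𝕜 V} {x : V} : BQuot.mk p x = 0 ↔ x ∈ bclosure p :=
  Submodule.Quotient.mk_eq_zero _

/-- The quotient bornology: the bounded sets are those covered by the image of a bounded set. -/
instance (p : Submodule 𝕜 V) : Bornology (BQuot p) :=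
  Bornology.ofBounded {U | ∃ S : Set V, IsBounded S ∧ U ⊆ BQuot.mk p '' S}
    ⟨∅, isBounded_empty, empty_subset _⟩
    (fun _ ⟨S, hS, h⟩ _ ht => ⟨S, hS, ht.trans h⟩)
    (fun _ ⟨S, hS, h⟩ _ ⟨T, hT, h'⟩ => ⟨S ∪ T, hS.union hT, by
      rw [image_union]; exact union_subset_union h h'⟩)
    (fun x => by
      obtain ⟨y, rfl⟩ := BQuot.mk_surjective p x
      exact ⟨{y}, isBounded_singleton, by simp⟩)

lemma BQuot.isBounded_iff {p : Submodule 𝕜 V} {U : Set (BQuot p)} :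
    IsBounded U ↔ ∃ S : Set V, IsBounded S ∧ U ⊆ BQuot.mk p '' S :=
  Bornology.isBounded_ofBounded_iff _

lemma BQuot.isBdd_mk (p : Submodule 𝕜 V) : IsBdd (BQuot.mk p) := fun S hS =>
  BQuot.isBounded_iff.2 ⟨S, hS, subset_rfl⟩

lemma isCompletant_image (p : Submodule 𝕜 V) {D : Set V} (hb : IsBounded D)
    (hD : IsCompletant 𝕜 D) : IsCompletant 𝕜 (BQuot.mk p '' D) := by
  have hsm : ∀ {ε : ℝ} {y : BQuot p}, y ∈ (ε : 𝕜) • (BQuot.mk p '' D) →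
      ∃ x ∈ (ε : 𝕜) • D, BQuot.mk p x = y := by
    rintro ε y ⟨_, ⟨x, hx, rfl⟩, rfl⟩
    exact ⟨(ε : 𝕜) • x, smul_mem_smul_set hx, by simp⟩
  have hsm' : ∀ {ε : ℝ} {x : V}, x ∈ (ε : 𝕜) • D →
      BQuot.mk p x ∈ (ε : 𝕜) • (BQuot.mk p '' D) := by
    rintro ε _ ⟨x, hx, rfl⟩
    exact ⟨BQuot.mk p x, ⟨x, hx, rfl⟩, by simp⟩
  have hdisc : IsDisc 𝕜 (BQuot.mk p '' D) := by
    refine ⟨hD.nonempty.image _, ?_⟩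
    rintro _ ⟨x, hx, rfl⟩ _ ⟨y, hy, rfl⟩ a b hab
    exact ⟨a • x + b • y, hD.combo x hx y hy a b hab, by simp⟩
  refine { hdisc with norming := ?_, complete := ?_ }
  · intro y hy
    obtain ⟨x, rfl⟩ := BQuot.mk_surjective p y
    rw [BQuot.mk_eq_zero]
    have hpos : ∀ n : ℕ, (0 : ℝ) < 1 / ((n : ℝ) + 1) := fun n => Nat.one_div_pos_of_nat
    choose d hd hdx using fun n : ℕ => hsm (hy _ (hpos n))
    refine isBClosed_bclosure p D hb hD.toIsDisc (fun n => x - d n) (fun n => ?_) x ?_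
    · rw [← BQuot.mk_eq_zero, map_sub, hdx, sub_self]
    · intro ε hε
      obtain ⟨N, hN⟩ := exists_nat_one_div_lt hε
      refine ⟨N, fun n hn => ?_⟩
      have h1 : 1 / ((n : ℝ) + 1) ≤ ε :=
        (Nat.one_div_le_one_div hn).trans hN.le
      have := hD.toIsDisc.neg_smul hε (hD.toIsDisc.smul_mono (hpos n) h1 (hd n))
      simpa using this
  · intro x hx
    have hpos : ∀ n : ℕ, (0 : ℝ) < (1 / 2) ^ n := fun n => by positivity
    choose N hN using fun n : ℕ => hx _ (hpos n)
    let s : ℕ → ℕ := fun n => ∑ k ∈ Finset.range (n + 1), N k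
    have hsN : ∀ n, N n ≤ s n := fun n =>
      Finset.single_le_sum (f := N) (fun _ _ => Nat.zero_le _) (Finset.self_mem_range_succ n)
    have hs : ∀ n, s n ≤ s (n + 1) := fun n => by
      simp only [s]; rw [Finset.sum_range_succ _ (n + 1)]; exact Nat.le_add_right _ _
    choose d hd hdx using fun n : ℕ =>
      hsm (hN n (s (n + 1)) ((hsN n).trans (hs n)) (s n) (hsN n))
    obtain ⟨y0, hy0⟩ := BQuot.mk_surjective p (x (s 0))
    let y : ℕ → V := fun n => y0 + ∑ k ∈ Finset.range n, d k
    have hy : ∀ n, BQuot.mk p (y n) = x (s n) := by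
      intro n
      induction n with
      | zero => simpa [y] using hy0
      | succ n ih =>
        have : y (n + 1) = y n + d n := by simp [y, Finset.sum_range_succ, add_assoc]
        rw [this, map_add, ih, hdx]; abel
    have hdiff : ∀ k n, y (n + k) - y n ∈ (((2 : ℝ) * (1 / 2) ^ n : ℝ) : 𝕜) • D := by
      intro k
      induction k with
      | zero => intro n; simpa using Set.zero_mem_smul_set hD.toIsDisc.zero_mem
      | succ k ih =>
        intro n
        have h1 := ih (n + 1)
        have h2 : y (n + 1) - y n = d n := by simp [y, Finset.sum_range_succ]
        have h3 := hD.toIsDisc.add_smul (by positivity) (hpos n) h1 (hd n)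
        have e1 : y (n + 1 + k) - y (n + 1) + d n = y (n + (k + 1)) - y n := by
          rw [← h2, show n + (k + 1) = n + 1 + k by ring]; abel
        have e2 : (2 : ℝ) * (1 / 2) ^ (n + 1) + (1 / 2) ^ n = 2 * (1 / 2) ^ n := by ring
        rwa [e1, e2] at h3
    have hlim : ∀ ε : ℝ, 0 < ε → ∃ n : ℕ, (2 : ℝ) * (1 / 2) ^ n ≤ ε := by
      intro ε hε
      obtain ⟨n, hn⟩ := exists_pow_lt_of_lt_one (half_pos hε) (by norm_num : (1 / 2 : ℝ) < 1)
      exact ⟨n, by linarith⟩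
    obtain ⟨l, hl⟩ := hD.complete y (by
      intro ε hε
      obtain ⟨n, hn⟩ := hlim _ (half_pos hε)
      refine ⟨n, fun a ha b hb => ?_⟩
      obtain ⟨a, rfl⟩ := Nat.exists_eq_add_of_le ha
      obtain ⟨b, rfl⟩ := Nat.exists_eq_add_of_le hb
      have h1 := hD.toIsDisc.smul_mono (by positivity) hn (hdiff a n)
      have h2 := hD.toIsDisc.smul_mono (by positivity) hn (hdiff b n)
      have := hD.toIsDisc.sub_smul (half_pos hε) (half_pos hε) h1 h2
      simpa using this)
    refine ⟨BQuot.mk p l, fun ε hε => ?_⟩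
    obtain ⟨a, ha⟩ := hl _ (half_pos hε)
    obtain ⟨b, hb'⟩ := hlim _ (half_pos hε)
    set n := max a b with hn
    have hlt : (1 / 2 : ℝ) ^ n ≤ ε / 2 := by
      have : (1 / 2 : ℝ) ^ n ≤ (1 / 2) ^ b :=
        pow_le_pow_of_le_one (by norm_num) (by norm_num) (le_max_right a b)
      have h0 := hpos b
      linarith
    refine ⟨s n, fun m hm => ?_⟩
    have h1 := hdisc.smul_mono (hpos n) hlt (hN n m ((hsN n).trans hm) (s n) (hsN n))
    have h2 := hsm' (ha n (le_max_left a b))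
    have h3 := hdisc.add_smul (half_pos hε) (half_pos hε) h1 h2
    rw [map_sub, hy, add_halves] at h3
    simpa using h3

instance [CompleteBVS 𝕜 V] (p : Submodule 𝕜 V) : CompleteBVS 𝕜 (BQuot p) where
  add U U' hU hU' := by
    obtain ⟨S, hS, h⟩ := BQuot.isBounded_iff.1 hU
    obtain ⟨T, hT, h'⟩ := BQuot.isBounded_iff.1 hU'
    refine BQuot.isBounded_iff.2 ⟨S + T, CompleteBVS.add (𝕜 := 𝕜) _ _ hS hT, ?_⟩
    rw [image_add]
    exact add_subset_add h h'
  smul c U hU := by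
    obtain ⟨S, hS, h⟩ := BQuot.isBounded_iff.1 hU
    refine BQuot.isBounded_iff.2 ⟨c • S, CompleteBVS.smul _ _ hS, ?_⟩
    rw [image_smul_set]
    exact smul_set_mono h
  complete U hU := by
    obtain ⟨S, hS, h⟩ := BQuot.isBounded_iff.1 hU
    obtain ⟨D, h1, h2, h3⟩ := CompleteBVS.complete (𝕜 := 𝕜) S hS
    exact ⟨BQuot.mk p '' D, h.trans (image_mono h1), BQuot.isBdd_mk p D h2,
      isCompletant_image p h2 h3⟩

end Quotient

section Lift

variable {𝕜 : Type} [RCLike 𝕜] {V : Type u} [AddCommGroup V] [Module 𝕜 V] [Bornology V]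
  {X : Type*} [AddCommGroup X] [Module 𝕜 X] [Bornology X] [CompleteBVS 𝕜 X]

lemma isBClosed_ker (f : V →ₗ[𝕜] X) (hf : IsBdd f) : IsBClosed (LinearMap.ker f) := by
  intro D hD hd x hx l hl
  rw [LinearMap.mem_ker]
  refine eq_zero_of_small 𝕜 (hf D hD) fun ε hε => ?_
  obtain ⟨N, hN⟩ := hl ε hε
  obtain ⟨y, hy, he⟩ := hd.neg_smul hε (hN N le_rfl)
  have h2 : x N ∈ LinearMap.ker f := hx N
  refine ⟨f y, ⟨y, hy, rfl⟩, ?_⟩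
  simp only at he ⊢
  rw [← map_smul, he, map_neg, map_sub, LinearMap.mem_ker.1 h2, zero_sub, neg_neg]

/-- A bounded linear map into a complete space that vanishes on `p` descends to the quotient. -/
def BQuot.lift (p : Submodule 𝕜 V) (f : V →ₗ[𝕜] X) (hf : IsBdd f) (h : p ≤ LinearMap.ker f) :
    BQuot p →ₗ[𝕜] X :=
  (bclosure p).liftQ f (bclosure_le h (isBClosed_ker f hf))

lemma BQuot.lift_mk (p : Submodule 𝕜 V) (f : V →ₗ[𝕜] X) (hf : IsBdd f)
    (h : p ≤ LinearMap.ker f) (x : V) : BQuot.lift p f hf h (BQuot.mk p x) = f x :=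
  Submodule.liftQ_apply _ _ _

lemma BQuot.isBdd_lift (p : Submodule 𝕜 V) (f : V →ₗ[𝕜] X) (hf : IsBdd f)
    (h : p ≤ LinearMap.ker f) : IsBdd (BQuot.lift p f hf h) := by
  intro U hU
  obtain ⟨S, hS, hU⟩ := BQuot.isBounded_iff.1 hU
  refine (hf S hS).subset ?_
  rintro _ ⟨y, hy, rfl⟩
  obtain ⟨x, hx, rfl⟩ := hU hy
  exact ⟨x, hx, (BQuot.lift_mk p f hf h x).symm⟩

end Lift

/-! ### Absolutely summable families -/

section Ell1

variable (𝕜 : Type) [RCLike 𝕜] (ι : Type u) [Bornology ι]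

/-- Absolutely summable families of scalars with bounded support: the space of formal sums
`∑ ξ i • δ i`, that is the inductive limit of the Banach spaces `ℓ¹(S)` for `S ⊆ ι` bounded. -/
def ell1 : Submodule 𝕜 (ι → 𝕜) where
  carrier := {ξ | Summable (fun i => ‖ξ i‖) ∧ IsBounded (Function.support ξ)}
  add_mem' {ξ η} h h' :=
    ⟨(h.1.add h'.1).of_nonneg_of_le (fun _ => norm_nonneg _) (fun _ => norm_add_le _ _),
      (h.2.union h'.2).subset (Function.support_add _ _)⟩
  zero_mem' := ⟨by simp, by simp⟩
  smul_mem' c ξ h :=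
    ⟨by simpa [norm_mul] using h.1.mul_left ‖c‖, h.2.subset (Function.support_const_smul_subset c ξ)⟩

/-- See `ell1`. -/
abbrev Ell1 : Type u := ell1 𝕜 ι

variable {𝕜 ι}

/-- The ball of radius `C` of `ℓ¹(S)`. -/
def ellBall (S : Set ι) (C : ℝ) : Set (Ell1 𝕜 ι) :=
  {ξ | Function.support ξ.1 ⊆ S ∧ ∑' i, ‖ξ.1 i‖ ≤ C}

lemma ellBall_mono {S T : Set ι} (h : S ⊆ T) {C C' : ℝ} (hC : C ≤ C') :
    ellBall (𝕜 := 𝕜) S C ⊆ ellBall T C' := fun _ hξ => ⟨hξ.1.trans h, hξ.2.trans hC⟩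

/-- The bounded sets are the subsets of balls of `ℓ¹(S)`, for `S` bounded. -/
instance : Bornology (Ell1 𝕜 ι) :=
  Bornology.ofBounded {U | ∃ S : Set ι, IsBounded S ∧ ∃ C : ℝ, U ⊆ ellBall S C}
    ⟨∅, isBounded_empty, 0, empty_subset _⟩
    (fun _ ⟨S, hS, C, h⟩ _ ht => ⟨S, hS, C, ht.trans h⟩)
    (fun _ ⟨S, hS, C, h⟩ _ ⟨T, hT, C', h'⟩ => ⟨S ∪ T, hS.union hT, max C C', union_subset
      (h.trans (ellBall_mono subset_union_left (le_max_left _ _)))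
      (h'.trans (ellBall_mono subset_union_right (le_max_right _ _)))⟩)
    (fun ξ => ⟨_, ξ.2.2, ∑' i, ‖ξ.1 i‖, by rintro _ rfl; exact ⟨subset_rfl, le_rfl⟩⟩)

lemma Ell1.isBounded_iff {U : Set (Ell1 𝕜 ι)} :
    IsBounded U ↔ ∃ S : Set ι, IsBounded S ∧ ∃ C : ℝ, U ⊆ ellBall S C :=
  Bornology.isBounded_ofBounded_iff _

lemma isBounded_ellBall {S : Set ι} (hS : IsBounded S) (C : ℝ) :
    IsBounded (ellBall (𝕜 := 𝕜) S C) := Ell1.isBounded_iff.2 ⟨S, hS, C, subset_rfl⟩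

lemma ellBall_combo {S : Set ι} {C C' : ℝ} {x y : Ell1 𝕜 ι} (hx : x ∈ ellBall S C)
    (hy : y ∈ ellBall S C') (a b : 𝕜) : a • x + b • y ∈ ellBall S (‖a‖ * C + ‖b‖ * C') := by
  refine ⟨fun i hi => ?_, ?_⟩
  · by_contra h
    have h1 : x.1 i = 0 := by by_contra h'; exact h (hx.1 h')
    have h2 : y.1 i = 0 := by by_contra h'; exact h (hy.1 h')
    exact hi (by simp [h1, h2])
  · have h1 := x.2.1.mul_left ‖a‖
    have h2 := y.2.1.mul_left ‖b‖
    calc ∑' i, ‖(a • x + b • y).1 i‖ ≤ ∑' i, (‖a‖ * ‖x.1 i‖ + ‖b‖ * ‖y.1 i‖) := by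
          refine (a • x + b • y).2.1.tsum_le_tsum (fun i => ?_) (h1.add h2)
          simpa [norm_mul] using norm_add_le (a * x.1 i) (b * y.1 i)
      _ = ‖a‖ * ∑' i, ‖x.1 i‖ + ‖b‖ * ∑' i, ‖y.1 i‖ := by
          rw [h1.tsum_add h2, tsum_mul_left, tsum_mul_left]
      _ ≤ _ := by gcongr <;> [exact hx.2; exact hy.2]

lemma mem_smul_ellBall {S : Set ι} {C ε : ℝ} (hε : 0 < ε) {x : Ell1 𝕜 ι} :
    x ∈ (ε : 𝕜) • ellBall S C ↔ x ∈ ellBall S (ε * C) := by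
  have hn : ‖(ε : 𝕜)‖ = ε := by rw [RCLike.norm_ofReal, abs_of_pos hε]
  refine (mem_smul_iff (V := Ell1 𝕜 ι) hε).trans ⟨?_, ?_⟩
  · intro h
    have := ellBall_combo h h (ε : 𝕜) 0
    simpa [smul_smul, hε.ne', hn, abs_of_pos hε] using this
  · intro h
    have := ellBall_combo h h (ε : 𝕜)⁻¹ 0
    simpa [hn, abs_of_pos hε, hε.ne', ← mul_assoc] using this

lemma isCompletant_ellBall {S : Set ι} (hS : IsBounded S) {C : ℝ} (hC : 0 < C) :
    IsCompletant 𝕜 (ellBall (𝕜 := 𝕜) S C) where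
  nonempty := ⟨0, by simp [ellBall, hC.le]⟩
  combo x hx y hy a b hab := by
    refine ellBall_mono subset_rfl ?_ (ellBall_combo hx hy a b)
    rw [← add_mul]; nlinarith
  norming x hx := by
    have h0 : ∑' i, ‖x.1 i‖ ≤ 0 := by
      refine le_of_forall_pos_le_add fun ε hε => ?_
      have := ((mem_smul_ellBall (div_pos hε hC)).1 (hx _ (div_pos hε hC))).2
      rwa [div_mul_cancel₀ _ hC.ne', ← zero_add ε] at this
    ext i
    have := (x.2.1.le_tsum i fun _ _ => norm_nonneg _).trans h0
    simpa using this
  complete x hx := by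
    have hx' : ∀ ε : ℝ, 0 < ε → ∃ N, ∀ m ≥ N, ∀ n ≥ N, x m - x n ∈ ellBall S ε := by
      intro ε hε
      obtain ⟨N, hN⟩ := hx _ (div_pos hε hC)
      refine ⟨N, fun m hm n hn => ?_⟩
      have := (mem_smul_ellBall (div_pos hε hC)).1 (hN m hm n hn)
      rwa [div_mul_cancel₀ _ hC.ne'] at this
    have hcau : ∀ i, CauchySeq fun n => (x n).1 i := by
      intro i
      refine Metric.cauchySeq_iff.2 fun ε hε => ?_
      obtain ⟨N, hN⟩ := hx' _ (half_pos hε)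
      refine ⟨N, fun m hm n hn => ?_⟩
      have h1 := (hN m hm n hn).2
      have h2 := (x m - x n).2.1.le_tsum i fun _ _ => norm_nonneg _
      rw [dist_eq_norm]
      exact lt_of_le_of_lt (h2.trans h1) (half_lt_self hε)
    choose l hl using fun i => cauchySeq_tendsto_of_complete (hcau i)
    have hF : ∀ ε : ℝ, 0 < ε → ∃ N, ∀ n ≥ N, (∀ F : Finset ι, ∑ i ∈ F, ‖(x n).1 i - l i‖ ≤ ε) ∧
        Function.support (fun i => (x n).1 i - l i) ⊆ S := by
      intro ε hε
      obtain ⟨N, hN⟩ := hx' ε hε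
      refine ⟨N, fun n hn => ⟨fun F => ?_, fun i hi => ?_⟩⟩
      · have ht : Filter.Tendsto (fun m => ∑ i ∈ F, ‖(x n).1 i - (x m).1 i‖) Filter.atTop
            (nhds (∑ i ∈ F, ‖(x n).1 i - l i‖)) :=
          tendsto_finsetSum _ fun i _ => (tendsto_const_nhds.sub (hl i)).norm
        refine le_of_tendsto ht (Filter.eventually_atTop.2 ⟨N, fun m hm => ?_⟩)
        exact ((x n - x m).2.1.sum_le_tsum F fun _ _ => norm_nonneg _).trans (hN n hn m hm).2
      · by_contra h
        refine hi ?_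
        have : ∀ m ≥ N, (x n).1 i = (x m).1 i := fun m hm => by
          by_contra h'
          exact h ((hN n hn m hm).1 (sub_ne_zero.2 h'))
        rw [sub_eq_zero]
        exact tendsto_nhds_unique (tendsto_const_nhds.congr'
          (Filter.eventually_atTop.2 ⟨N, this⟩)) (hl i)
    obtain ⟨N, hN⟩ := hF 1 one_pos
    have hN := hN N le_rfl
    have hmem : (fun i => (x N).1 i - l i) ∈ ell1 𝕜 ι :=
      ⟨summable_of_sum_le (fun _ => norm_nonneg _) hN.1, hS.subset hN.2⟩
    refine ⟨x N - ⟨_, hmem⟩, fun ε hε => ?_⟩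
    obtain ⟨M, hM⟩ := hF _ (mul_pos hε hC)
    refine ⟨M, fun n hn => (mem_smul_ellBall hε).2 ?_⟩
    have e : ∀ i, (x n - (x N - ⟨_, hmem⟩ : Ell1 𝕜 ι)).1 i = (x n).1 i - l i := fun i => by
      simp
    refine ⟨fun i hi => (hM n hn).2 ?_, ?_⟩
    · rw [Function.mem_support, e] at hi; exact hi
    · simp only [e]
      exact Real.tsum_le_of_sum_le (fun _ => norm_nonneg _) (hM n hn).1

instance : CompleteBVS 𝕜 (Ell1 𝕜 ι) where
  add U U' hU hU' := by
    obtain ⟨S, hS, C, h⟩ := Ell1.isBounded_iff.1 hU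
    obtain ⟨T, hT, C', h'⟩ := Ell1.isBounded_iff.1 hU'
    refine Ell1.isBounded_iff.2 ⟨S ∪ T, hS.union hT, C + C', ?_⟩
    rintro _ ⟨x, hx, y, hy, rfl⟩
    simpa using ellBall_combo (ellBall_mono subset_union_left le_rfl (h hx))
      (ellBall_mono subset_union_right le_rfl (h' hy)) (1 : 𝕜) 1
  smul c U hU := by
    obtain ⟨S, hS, C, h⟩ := Ell1.isBounded_iff.1 hU
    refine Ell1.isBounded_iff.2 ⟨S, hS, ‖c‖ * C, ?_⟩
    rintro _ ⟨x, hx, rfl⟩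
    simpa using ellBall_combo (h hx) (h hx) c 0
  complete U hU := by
    obtain ⟨S, hS, C, h⟩ := Ell1.isBounded_iff.1 hU
    exact ⟨ellBall S (max C 1), h.trans (ellBall_mono subset_rfl (le_max_left _ _)),
      isBounded_ellBall hS _, isCompletant_ellBall hS (by positivity)⟩

open Classical in
/-- The formal sum `δ i`. -/
def delta (i : ι) : Ell1 𝕜 ι :=
  ⟨Pi.single i 1, by
    refine ⟨summable_of_hasFiniteSupport ((finite_singleton i).subset fun j hj => ?_), ?_⟩
    · by_contra h
      exact hj (by simp [Pi.single_eq_of_ne (show j ≠ i from h)])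
    · exact (isBounded_singleton (x := i)).subset Pi.support_single_subset⟩

lemma delta_mem {S : Set ι} {i : ι} (hi : i ∈ S) : delta (𝕜 := 𝕜) i ∈ ellBall S 1 := by
  classical
  refine ⟨Pi.support_single_subset.trans (singleton_subset_iff.2 hi), ?_⟩
  rw [tsum_eq_single i]
  · simp [delta]
  · intro j hj
    simp [delta, Pi.single_eq_of_ne hj]

/-- A formal sum is the sum of its terms. -/
lemma exists_sum_delta (ξ : Ell1 𝕜 ι) {ε : ℝ} (hε : 0 < ε) :
    ∃ F₀ : Finset ι, ∀ F, F₀ ⊆ F →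
      ξ - ∑ i ∈ F, ξ.1 i • delta i ∈ ellBall (Function.support ξ.1) ε := by
  classical
  have e : ∀ (F : Finset ι) (j : ι), (ξ - ∑ i ∈ F, ξ.1 i • delta i).1 j =
      if j ∈ F then 0 else ξ.1 j := by
    intro F j
    have : (∑ i ∈ F, ξ.1 i • (delta i : Ell1 𝕜 ι)).1 j = if j ∈ F then ξ.1 j else 0 := by
      rw [Submodule.coe_sum, Finset.sum_apply]
      simp only [Submodule.coe_smul, Pi.smul_apply, delta, Pi.single_apply, smul_eq_mul, mul_ite,
        mul_one, mul_zero]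
      simp
    rw [Submodule.coe_sub, Pi.sub_apply, this]
    split_ifs <;> simp
  obtain ⟨F₀, hF₀⟩ := summable_iff_vanishing_norm.1 ξ.2.1 ε hε
  refine ⟨F₀, fun F hF => ⟨fun j hj => ?_, ?_⟩⟩
  · rw [Function.mem_support, e] at hj
    intro h
    exact hj (by simp [h])
  · refine Real.tsum_le_of_sum_le (fun _ => norm_nonneg _) fun G => ?_
    simp only [e]
    have h1 : ∑ i ∈ G, ‖if i ∈ F then 0 else ξ.1 i‖ = ∑ i ∈ G \ F, ‖ξ.1 i‖ := by
      rw [Finset.sdiff_eq_filter, Finset.sum_filter]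
      refine Finset.sum_congr rfl fun i _ => ?_
      by_cases h : i ∈ F <;> simp [h]
    rw [h1]
    have h2 := hF₀ (G \ F) (Finset.disjoint_of_subset_right hF Finset.sdiff_disjoint)
    rw [Real.norm_of_nonneg (Finset.sum_nonneg fun _ _ => norm_nonneg _)] at h2
    exact h2.le

variable {X : Type*} [AddCommGroup X] [Module 𝕜 X] [Bornology X] [CompleteBVS 𝕜 X]

/-- The finite partial sums of `∑ ξ i • b i` converge to `l` with respect to the disc `D`. -/
def SumsTo (D : Set X) (b : ι → X) (ξ : Ell1 𝕜 ι) (l : X) : Prop :=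
  ∀ ε : ℝ, 0 < ε → ∃ F₀ : Finset ι, ∀ F, F₀ ⊆ F → ∑ i ∈ F, ξ.1 i • b i - l ∈ (ε : 𝕜) • D

lemma SumsTo.mono {D D' : Set X} (h : D ⊆ D') {b : ι → X} {ξ : Ell1 𝕜 ι} {l : X}
    (hl : SumsTo D b ξ l) : SumsTo D' b ξ l := fun ε hε =>
  let ⟨F₀, hF₀⟩ := hl ε hε
  ⟨F₀, fun F hF => smul_set_mono h (hF₀ F hF)⟩

lemma SumsTo.unique {D D' : Set X} (hD : IsBounded D) (hD' : IsBounded D') {b : ι → X}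
    {ξ : Ell1 𝕜 ι} {l l' : X} (hl : SumsTo D b ξ l) (hl' : SumsTo D' b ξ l') : l = l' := by
  classical
  obtain ⟨E, h1, h2, h3, h4⟩ := exists_disc₂ (𝕜 := 𝕜) hD hD'
  rw [← sub_eq_zero]
  refine h4.norming _ fun ε hε => ?_
  obtain ⟨F, hF⟩ := hl.mono h1 _ (half_pos hε)
  obtain ⟨F', hF'⟩ := hl'.mono h2 _ (half_pos hε)
  have := h4.toIsDisc.sub_smul (half_pos hε) (half_pos hε)
    (hF' (F ∪ F') Finset.subset_union_right) (hF (F ∪ F') Finset.subset_union_left)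
  simpa using this

lemma exists_sumsTo {D : Set X} (hD : IsCompletant 𝕜 D) (b : ι → X) (ξ : Ell1 𝕜 ι)
    (h : ∀ i ∈ Function.support ξ.1, b i ∈ D) : ∃ l, SumsTo D b ξ l := by
  classical
  choose! G hG using fun (ε : ℝ) (hε : 0 < ε) => summable_iff_vanishing_norm.1 ξ.2.1 ε hε
  have key : ∀ ε : ℝ, 0 < ε → ∀ F, G ε ⊆ F → ∑ i ∈ F, ξ.1 i • b i - ∑ i ∈ G ε, ξ.1 i • b i ∈
      (ε : 𝕜) • D := by
    intro ε hε F hF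
    rw [← Finset.sum_sdiff hF, add_sub_cancel_right]
    refine hD.toIsDisc.sum_mem _ _ _ (fun i _ hi => h i hi) hε ?_
    have := hG ε hε (F \ G ε) Finset.sdiff_disjoint
    rw [Real.norm_of_nonneg (Finset.sum_nonneg fun _ _ => norm_nonneg _)] at this
    exact this.le
  let g : ℕ → Finset ι := fun n => (Finset.range (n + 1)).biUnion fun k => G (1 / ((k : ℝ) + 1))
  have hg : ∀ k n : ℕ, k ≤ n → G (1 / ((k : ℝ) + 1)) ⊆ g n := fun k n hkn =>
    Finset.subset_biUnion_of_mem (fun k : ℕ => G (1 / ((k : ℝ) + 1)))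
      (Finset.mem_range.2 (Nat.lt_succ_of_le hkn))
  have key2 : ∀ ε : ℝ, 0 < ε → ∃ N, ∀ F F', g N ⊆ F → g N ⊆ F' →
      ∑ i ∈ F, ξ.1 i • b i - ∑ i ∈ F', ξ.1 i • b i ∈ (ε : 𝕜) • D := by
    intro ε hε
    obtain ⟨N, hN⟩ := exists_nat_one_div_lt (half_pos hε)
    refine ⟨N, fun F F' hF hF' => ?_⟩
    have hp : (0 : ℝ) < 1 / ((N : ℝ) + 1) := Nat.one_div_pos_of_nat
    have h1 := hD.toIsDisc.smul_mono hp hN.le (key _ hp F ((hg N N le_rfl).trans hF))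
    have h2 := hD.toIsDisc.smul_mono hp hN.le (key _ hp F' ((hg N N le_rfl).trans hF'))
    simpa using hD.toIsDisc.sub_smul (half_pos hε) (half_pos hε) h1 h2
  have gmono : ∀ m n, m ≤ n → g m ⊆ g n := fun m n hmn =>
    Finset.biUnion_subset_biUnion_of_subset_left _ (Finset.range_mono (Nat.succ_le_succ hmn))
  obtain ⟨l, hl⟩ := hD.complete (fun n => ∑ i ∈ g n, ξ.1 i • b i) (by
    intro ε hε
    obtain ⟨N, hN⟩ := key2 ε hε
    exact ⟨N, fun m hm n hn => hN _ _ (gmono N m hm) (gmono N n hn)⟩)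
  refine ⟨l, fun ε hε => ?_⟩
  obtain ⟨N, hN⟩ := key2 _ (half_pos hε)
  obtain ⟨M, hM⟩ := hl _ (half_pos hε)
  refine ⟨g N, fun F hF => ?_⟩
  have h1 := hN F (g (max M N)) hF (gmono _ _ (le_max_right _ _))
  have h2 := hM (max M N) (le_max_left _ _)
  simpa using hD.toIsDisc.add_smul (half_pos hε) (half_pos hε) h1 h2

lemma SumsTo.mem {D : Set X} (hD : IsDisc 𝕜 D) {b : ι → X} {ξ : Ell1 𝕜 ι} {l : X}
    (hl : SumsTo D b ξ l) {S : Set ι} {C : ℝ} (hC : 0 < C) (hξ : ξ ∈ ellBall S C)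
    (h : ∀ i ∈ S, b i ∈ D) : l ∈ ((C + C : ℝ) : 𝕜) • D := by
  obtain ⟨F, hF⟩ := hl C hC
  have h1 := hF F subset_rfl
  have h2 := hD.sum_mem F ξ.1 b (fun i _ hi => h i (hξ.1 hi)) hC
    ((ξ.2.1.sum_le_tsum F fun _ _ => norm_nonneg _).trans hξ.2)
  simpa using hD.sub_smul hC hC h2 h1

lemma exists_sum (b : ι → X) (hb : IsBdd b) (ξ : Ell1 𝕜 ι) :
    ∃ l, ∃ D, IsBounded D ∧ IsDisc 𝕜 D ∧ SumsTo D b ξ l := by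
  obtain ⟨D, h1, h2, h3⟩ := CompleteBVS.complete (𝕜 := 𝕜) _ (hb _ ξ.2.2)
  obtain ⟨l, hl⟩ := exists_sumsTo h3 b ξ fun i hi => h1 ⟨i, hi, rfl⟩
  exact ⟨l, D, h2, h3.toIsDisc, hl⟩

/-- The bounded linear map `ξ ↦ ∑ ξ i • b i` that extends the bounded map `b` to formal sums. -/
def Ell1.lift (b : ι → X) (hb : IsBdd b) : Ell1 𝕜 ι →ₗ[𝕜] X where
  toFun ξ := (exists_sum b hb ξ).choose
  map_add' ξ η := by
    classical
    obtain ⟨D, hD, hd, h⟩ := (exists_sum b hb ξ).choose_spec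
    obtain ⟨D', hD', hd', h'⟩ := (exists_sum b hb η).choose_spec
    obtain ⟨D₀, hD₀, hd₀, h₀⟩ := (exists_sum b hb (ξ + η)).choose_spec
    obtain ⟨E, h1, h2, h3, h4⟩ := exists_disc₂ (𝕜 := 𝕜) hD hD'
    refine h₀.unique (D' := E) hD₀ h3 fun ε hε => ?_
    obtain ⟨F, hF⟩ := h.mono h1 _ (half_pos hε)
    obtain ⟨F', hF'⟩ := h'.mono h2 _ (half_pos hε)
    refine ⟨F ∪ F', fun G hG => ?_⟩
    have := h4.toIsDisc.add_smul (half_pos hε) (half_pos hε)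
      (hF G (Finset.subset_union_left.trans hG)) (hF' G (Finset.subset_union_right.trans hG))
    rw [add_halves] at this
    convert this using 1
    simp only [Submodule.coe_add, Pi.add_apply, add_smul, Finset.sum_add_distrib]
    abel
  map_smul' c ξ := by
    obtain ⟨D, hD, hd, h⟩ := (exists_sum b hb ξ).choose_spec
    obtain ⟨D₀, hD₀, hd₀, h₀⟩ := (exists_sum b hb (c • ξ)).choose_spec
    refine h₀.unique (D' := D) hD₀ hD fun ε hε => ?_
    have hc : 0 < ‖c‖ + 1 := by positivity
    obtain ⟨F, hF⟩ := h (ε / (‖c‖ + 1)) (by positivity)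
    refine ⟨F, fun G hG => ?_⟩
    have h1 := hd.combo_smul (by positivity) (by positivity) (hF G hG) (hF G hG) (a := c) (b := 0)
      (t := ε) hε (by
        rw [norm_zero, zero_mul, add_zero, mul_div_assoc', div_le_iff₀ hc]
        nlinarith)
    convert h1 using 1
    simp [smul_sub, Finset.smul_sum, smul_smul]

lemma Ell1.lift_spec (b : ι → X) (hb : IsBdd b) (ξ : Ell1 𝕜 ι) :
    ∃ D, IsBounded D ∧ IsDisc 𝕜 D ∧ SumsTo D b ξ (Ell1.lift b hb ξ) :=
  (exists_sum b hb ξ).choose_spec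

lemma Ell1.lift_delta (b : ι → X) (hb : IsBdd b) (i : ι) : Ell1.lift (𝕜 := 𝕜) b hb (delta i) = b i := by
  classical
  obtain ⟨D, hD, hd, h⟩ := Ell1.lift_spec (𝕜 := 𝕜) b hb (delta i)
  refine h.unique (D' := D) hD hD fun ε hε => ⟨{i}, fun F hF => ?_⟩
  have : ∑ j ∈ F, (delta (𝕜 := 𝕜) i).1 j • b j = b i := by
    rw [Finset.sum_eq_single i]
    · simp [delta]
    · intro j _ hj
      simp [delta, Pi.single_eq_of_ne hj]
    · intro h; exact absurd (hF (Finset.mem_singleton_self i)) h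
  rw [this, sub_self]
  exact zero_mem_smul_set hd.zero_mem

/-- The values of the extension are controlled by the values of `b`, uniformly in `b`. -/
lemma Ell1.lift_mem {D : Set X} (hD : IsBounded D) (hd : IsCompletant 𝕜 D) (b : ι → X)
    (hb : IsBdd b) {S : Set ι} {C : ℝ} (hC : 0 < C) {ξ : Ell1 𝕜 ι} (hξ : ξ ∈ ellBall S C)
    (h : ∀ i ∈ S, b i ∈ D) : Ell1.lift b hb ξ ∈ ((C + C : ℝ) : 𝕜) • D := by
  obtain ⟨D', hD', hd', h'⟩ := Ell1.lift_spec (𝕜 := 𝕜) b hb ξ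
  obtain ⟨l, hl⟩ := exists_sumsTo hd b ξ fun i hi => h i (hξ.1 hi)
  rw [h'.unique hD' hD hl]
  exact hl.mem hd.toIsDisc hC hξ h

lemma Ell1.isBdd_lift (b : ι → X) (hb : IsBdd b) : IsBdd (Ell1.lift (𝕜 := 𝕜) b hb) := by
  intro U hU
  obtain ⟨S, hS, C, hU⟩ := Ell1.isBounded_iff.1 hU
  obtain ⟨D, h1, h2, h3⟩ := CompleteBVS.complete (𝕜 := 𝕜) _ (hb S hS)
  have hC : 0 < max C 1 := by positivity
  refine (CompleteBVS.smul (𝕜 := 𝕜) ((max C 1 + max C 1 : ℝ) : 𝕜) D h2).subset ?_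
  rintro _ ⟨ξ, hξ, rfl⟩
  exact Ell1.lift_mem h2 h3 b hb hC (ellBall_mono subset_rfl (le_max_left _ _) (hU hξ))
    fun i hi => h1 ⟨i, hi, rfl⟩

/-- Bounded linear maps on formal sums are determined by their values on the `δ i`. -/
lemma Ell1.hom_ext (f g : Ell1 𝕜 ι →ₗ[𝕜] X) (hf : IsBdd f) (hg : IsBdd g)
    (h : ∀ i, f (delta i) = g (delta i)) : f = g := by
  ext ξ
  obtain ⟨D, h1, h2, h3, h4⟩ := exists_disc₂ (𝕜 := 𝕜) (hf _ (isBounded_ellBall ξ.2.2 1))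
    (hg _ (isBounded_ellBall ξ.2.2 1))
  rw [← sub_eq_zero]
  refine h4.norming _ fun ε hε => ?_
  obtain ⟨F, hF⟩ := exists_sum_delta ξ (half_pos hε)
  have hF := hF F subset_rfl
  rw [← mul_one (ε / 2), ← mem_smul_ellBall (half_pos hε)] at hF
  obtain ⟨η, hη, he⟩ := hF
  have e : f ξ - g ξ = ((ε / 2 : ℝ) : 𝕜) • f η - ((ε / 2 : ℝ) : 𝕜) • g η := by
    rw [← map_smul, ← map_smul]
    simp only at he
    rw [he]
    simp [map_sub, map_sum, h]
  rw [e]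
  simpa using h4.toIsDisc.sub_smul (half_pos hε) (half_pos hε)
    (smul_mem_smul_set (h1 ⟨η, hη, rfl⟩)) (smul_mem_smul_set (h2 ⟨η, hη, rfl⟩))

end Ell1

/-! ### Complete tensor products -/

section Tensor

variable (𝕜 : Type) [RCLike 𝕜]
  (V : Type u) [AddCommGroup V] [Module 𝕜 V] [Bornology V]
  (W : Type u) [AddCommGroup W] [Module 𝕜 W] [Bornology W]

/-- The relations of bilinearity between the formal sums of pairs. -/
def bilinRel : Submodule 𝕜 (Ell1 𝕜 (V × W)) :=
  Submodule.span 𝕜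
    ({x | ∃ v v' w, x = delta (v + v', w) - delta (v, w) - delta (v', w)} ∪
     {x | ∃ v w w', x = delta (v, w + w') - delta (v, w) - delta (v, w')} ∪
     {x | ∃ (c : 𝕜) (v : V) (w : W), x = delta (c • v, w) - c • delta (v, w)} ∪
     {x | ∃ (c : 𝕜) (v : V) (w : W), x = delta (v, c • w) - c • delta (v, w)})

/-- The complete tensor product of `V` and `W`: the formal sums `∑ λ_k • (v_k, w_k)`, with `λ` in
`ℓ¹` and with bounded `v` and `w`, modulo the closure of the relations of bilinearity. It is the
complete space that is universal for bounded bilinear maps on `V × W`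
(see `CTensor.lift`, `CTensor.hom_ext`). -/
def CTensor : Type u := BQuot (bilinRel 𝕜 V W)

instance : AddCommGroup (CTensor 𝕜 V W) := inferInstanceAs (AddCommGroup (BQuot _))

instance : Module 𝕜 (CTensor 𝕜 V W) := inferInstanceAs (Module 𝕜 (BQuot _))

instance : Bornology (CTensor 𝕜 V W) := inferInstanceAs (Bornology (BQuot _))

instance : CompleteBVS 𝕜 (CTensor 𝕜 V W) := inferInstanceAs (CompleteBVS 𝕜 (BQuot _))

/-- The class of a formal sum. -/
def CTensor.mk : Ell1 𝕜 (V × W) →ₗ[𝕜] CTensor 𝕜 V W := BQuot.mk (bilinRel 𝕜 V W)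

variable {𝕜 V W}

lemma CTensor.mk_eq_zero_of_mem {x : Ell1 𝕜 (V × W)} (hx : x ∈ bilinRel 𝕜 V W) :
    CTensor.mk 𝕜 V W x = 0 := BQuot.mk_eq_zero.2 (le_bclosure _ hx)

lemma CTensor.mk_surjective : Function.Surjective (CTensor.mk 𝕜 V W) := BQuot.mk_surjective _

lemma CTensor.isBounded_iff {U : Set (CTensor 𝕜 V W)} :
    IsBounded U ↔ ∃ S : Set (Ell1 𝕜 (V × W)), IsBounded S ∧ U ⊆ CTensor.mk 𝕜 V W '' S :=
  BQuot.isBounded_iff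

lemma CTensor.isBdd_mk : IsBdd (CTensor.mk 𝕜 V W) := BQuot.isBdd_mk _

/-- The pure tensors. -/
def CTensor.tmul : V →ₗ[𝕜] W →ₗ[𝕜] CTensor 𝕜 V W :=
  LinearMap.mk₂ 𝕜 (fun v w => CTensor.mk 𝕜 V W (delta (v, w)))
    (fun v v' w => by
      rw [← sub_eq_zero, ← map_add, ← map_sub, ← sub_sub]
      exact CTensor.mk_eq_zero_of_mem (Submodule.subset_span (Or.inl (Or.inl (Or.inl ⟨v, v', w, rfl⟩)))))
    (fun c v w => by
      rw [← sub_eq_zero, ← map_smul, ← map_sub]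
      exact CTensor.mk_eq_zero_of_mem (Submodule.subset_span (Or.inl (Or.inr ⟨c, v, w, rfl⟩))))
    (fun v w w' => by
      rw [← sub_eq_zero, ← map_add, ← map_sub, ← sub_sub]
      exact CTensor.mk_eq_zero_of_mem (Submodule.subset_span (Or.inl (Or.inl (Or.inr ⟨v, w, w', rfl⟩)))))
    (fun c v w => by
      rw [← sub_eq_zero, ← map_smul, ← map_sub]
      exact CTensor.mk_eq_zero_of_mem (Submodule.subset_span (Or.inr ⟨c, v, w, rfl⟩)))

lemma CTensor.isBdd_tmul : IsBdd₂ fun (v : V) (w : W) => CTensor.tmul (𝕜 := 𝕜) v w := by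
  intro S T hS hT
  refine CTensor.isBounded_iff.2 ⟨_, isBounded_ellBall (hS.prod hT) 1, ?_⟩
  rintro _ ⟨v, hv, w, hw, rfl⟩
  exact ⟨_, delta_mem ⟨hv, hw⟩, rfl⟩

variable {X : Type*} [AddCommGroup X] [Module 𝕜 X] [Bornology X]

lemma isBdd_pair {b : V →ₗ[𝕜] W →ₗ[𝕜] X} (hb : IsBdd₂ fun v w => b v w) :
    IsBdd fun p : V × W => b p.1 p.2 := by
  intro S hS
  refine (hb _ _ hS.image_fst hS.image_snd).subset ?_
  rintro _ ⟨p, hp, rfl⟩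
  exact ⟨p.1, ⟨p, hp, rfl⟩, p.2, ⟨p, hp, rfl⟩, rfl⟩

variable [CompleteBVS 𝕜 X]

/-- The bounded linear map on `V ⊗ W` that corresponds to a bounded bilinear map. -/
def CTensor.lift (b : V →ₗ[𝕜] W →ₗ[𝕜] X) (hb : IsBdd₂ fun v w => b v w) : CTensor 𝕜 V W →ₗ[𝕜] X :=
  BQuot.lift (bilinRel 𝕜 V W) (Ell1.lift (fun p : V × W => b p.1 p.2) (isBdd_pair hb)) (Ell1.isBdd_lift _ _) (by
    rw [bilinRel, Submodule.span_le]
    rintro x (((⟨v, v', w, rfl⟩ | ⟨v, w, w', rfl⟩) | ⟨c, v, w, rfl⟩) | ⟨c, v, w, rfl⟩) <;>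
    simp [Ell1.lift_delta])

@[simp]
lemma CTensor.lift_tmul (b : V →ₗ[𝕜] W →ₗ[𝕜] X) (hb : IsBdd₂ fun v w => b v w) (v : V) (w : W) :
    CTensor.lift b hb (CTensor.tmul v w) = b v w :=
  (BQuot.lift_mk _ _ _ _ _).trans (Ell1.lift_delta _ _ _)

lemma CTensor.isBdd_lift (b : V →ₗ[𝕜] W →ₗ[𝕜] X) (hb : IsBdd₂ fun v w => b v w) :
    IsBdd (CTensor.lift b hb) := BQuot.isBdd_lift _ _ _ _

lemma CTensor.hom_ext (f g : CTensor 𝕜 V W →ₗ[𝕜] X) (hf : IsBdd f) (hg : IsBdd g)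
    (h : ∀ v w, f (CTensor.tmul v w) = g (CTensor.tmul v w)) : f = g := by
  have := Ell1.hom_ext (f ∘ₗ CTensor.mk 𝕜 V W) (g ∘ₗ CTensor.mk 𝕜 V W) (hf.comp CTensor.isBdd_mk)
    (hg.comp CTensor.isBdd_mk) fun p => h p.1 p.2
  ext t
  obtain ⟨ξ, rfl⟩ := CTensor.mk_surjective t
  exact LinearMap.congr_fun this ξ

end Tensor

section Balanced

variable {𝕜 : Type} [RCLike 𝕜]
  {V : Type u} [AddCommGroup V] [Module 𝕜 V] [Bornology V]
  {W : Type u} [AddCommGroup W] [Module 𝕜 W] [Bornology W]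
  {A : Type u} (r : V → A → V) (l : A → W → W)

/-- The span of the tensors `v a ⊗ w - v ⊗ a w`. -/
def balRel : Submodule 𝕜 (CTensor 𝕜 V W) :=
  Submodule.span 𝕜 {x | ∃ v a w, x = CTensor.tmul (r v a) w - CTensor.tmul v (l a w)}

variable (𝕜) in
/-- The balanced tensor product of a right module `V` (with action `r`) and a left module `W`
(with action `l`): the complete tensor product modulo the closure of the span of the tensors
`v a ⊗ w - v ⊗ a w`. -/
def BTensor : Type u := BQuot (balRel (𝕜 := 𝕜) r l)

instance : AddCommGroup (BTensor 𝕜 r l) := inferInstanceAs (AddCommGroup (BQuot _))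

instance : Module 𝕜 (BTensor 𝕜 r l) := inferInstanceAs (Module 𝕜 (BQuot _))

instance : Bornology (BTensor 𝕜 r l) := inferInstanceAs (Bornology (BQuot _))

instance : CompleteBVS 𝕜 (BTensor 𝕜 r l) := inferInstanceAs (CompleteBVS 𝕜 (BQuot _))

/-- The class of an element of the complete tensor product. -/
def BTensor.mk : CTensor 𝕜 V W →ₗ[𝕜] BTensor 𝕜 r l := BQuot.mk (balRel r l)

lemma BTensor.mk_surjective : Function.Surjective (BTensor.mk (𝕜 := 𝕜) r l) :=
  BQuot.mk_surjective _

lemma BTensor.isBounded_iff {U : Set (BTensor 𝕜 r l)} :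
    IsBounded U ↔ ∃ S : Set (CTensor 𝕜 V W), IsBounded S ∧ U ⊆ BTensor.mk r l '' S :=
  BQuot.isBounded_iff

lemma BTensor.isBdd_mk : IsBdd (BTensor.mk (𝕜 := 𝕜) r l) := BQuot.isBdd_mk _

variable {r l}

/-- The pure tensors. -/
def BTensor.tmul : V →ₗ[𝕜] W →ₗ[𝕜] BTensor 𝕜 r l :=
  CTensor.tmul.compr₂ (BTensor.mk r l)

lemma BTensor.isBdd_tmul : IsBdd₂ fun v w => BTensor.tmul (𝕜 := 𝕜) (r := r) (l := l) v w := by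
  intro S T hS hT
  have := BTensor.isBdd_mk (𝕜 := 𝕜) r l _ (CTensor.isBdd_tmul S T hS hT)
  rwa [image_image2] at this

lemma BTensor.tmul_balanced (v : V) (a : A) (w : W) :
    BTensor.tmul (𝕜 := 𝕜) (r := r) (l := l) (r v a) w = BTensor.tmul v (l a w) := by
  rw [← sub_eq_zero]
  simp only [BTensor.tmul, LinearMap.compr₂_apply]
  rw [← map_sub]
  exact BQuot.mk_eq_zero.2 (le_bclosure _ (Submodule.subset_span ⟨v, a, w, rfl⟩))

variable {X : Type*} [AddCommGroup X] [Module 𝕜 X] [Bornology X] [CompleteBVS 𝕜 X]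

/-- The bounded linear map that corresponds to a bounded balanced bilinear map. -/
def BTensor.lift (b : V →ₗ[𝕜] W →ₗ[𝕜] X) (hb : IsBdd₂ fun v w => b v w)
    (hbal : ∀ v a w, b (r v a) w = b v (l a w)) : BTensor 𝕜 r l →ₗ[𝕜] X :=
  BQuot.lift (balRel r l) (CTensor.lift b hb) (CTensor.isBdd_lift b hb) (by
    rw [balRel, Submodule.span_le]
    rintro x ⟨v, a, w, rfl⟩
    simp [hbal])

@[simp]
lemma BTensor.lift_tmul (b : V →ₗ[𝕜] W →ₗ[𝕜] X) (hb : IsBdd₂ fun v w => b v w)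
    (hbal : ∀ v a w, b (r v a) w = b v (l a w)) (v : V) (w : W) :
    BTensor.lift b hb hbal (BTensor.tmul v w) = b v w :=
  (BQuot.lift_mk _ _ _ _ _).trans (CTensor.lift_tmul b hb v w)

lemma BTensor.isBdd_lift (b : V →ₗ[𝕜] W →ₗ[𝕜] X) (hb : IsBdd₂ fun v w => b v w)
    (hbal : ∀ v a w, b (r v a) w = b v (l a w)) : IsBdd (BTensor.lift b hb hbal) :=
  BQuot.isBdd_lift _ _ _ _

lemma BTensor.hom_ext (f g : BTensor 𝕜 r l →ₗ[𝕜] X) (hf : IsBdd f) (hg : IsBdd g)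
    (h : ∀ v w, f (BTensor.tmul v w) = g (BTensor.tmul v w)) : f = g := by
  have := CTensor.hom_ext (f ∘ₗ BTensor.mk r l) (g ∘ₗ BTensor.mk r l)
    (hf.comp (BTensor.isBdd_mk r l)) (hg.comp (BTensor.isBdd_mk r l)) h
  ext t
  obtain ⟨ξ, rfl⟩ := BTensor.mk_surjective r l t
  exact LinearMap.congr_fun this ξ

/-- A family of bilinear maps that is bounded uniformly on products of bounded sets extends to
the tensor product as a family that is bounded uniformly on bounded sets. -/
lemma BTensor.isBdd₂_lift {I : Type*} [Bornology I] (b : I → V →ₗ[𝕜] W →ₗ[𝕜] X)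
    (hb : ∀ i, IsBdd₂ fun v w => b i v w) (hbal : ∀ i v a w, b i (r v a) w = b i v (l a w))
    (hu : ∀ J : Set I, IsBounded J → ∀ (S : Set V) (T : Set W), IsBounded S → IsBounded T →
      IsBounded {x | ∃ i ∈ J, ∃ v ∈ S, ∃ w ∈ T, x = b i v w}) :
    IsBdd₂ fun (t : BTensor 𝕜 r l) (i : I) => BTensor.lift (b i) (hb i) (hbal i) t := by
  intro U J hU hJ
  obtain ⟨U', hU', h1⟩ := BTensor.isBounded_iff r l |>.1 hU
  obtain ⟨U'', hU'', h2⟩ := CTensor.isBounded_iff.1 hU'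
  obtain ⟨S, hS, C, h3⟩ := Ell1.isBounded_iff.1 hU''
  obtain ⟨D, h4, h5, h6⟩ := CompleteBVS.complete (𝕜 := 𝕜) _ (hu J hJ _ _ hS.image_fst hS.image_snd)
  have hC : 0 < max C 1 := by positivity
  refine (CompleteBVS.smul (𝕜 := 𝕜) ((max C 1 + max C 1 : ℝ) : 𝕜) D h5).subset ?_
  rintro _ ⟨t, ht, i, hi, rfl⟩
  obtain ⟨t', ht', rfl⟩ := h1 ht
  obtain ⟨ξ, hξ, rfl⟩ := h2 ht'
  exact Ell1.lift_mem h5 h6 _ (isBdd_pair (hb i)) hC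
    (ellBall_mono subset_rfl (le_max_left _ _) (h3 hξ))
    fun p hp => h4 ⟨i, hi, p.1, ⟨p, hp, rfl⟩, p.2, ⟨p, hp, rfl⟩, rfl⟩

end Balanced

/-! ### Finite products -/

section Products

variable {𝕜 : Type} [RCLike 𝕜]

instance : CompleteBVS 𝕜 𝕜 where
  add _ _ hS hT := hS.add hT
  smul _ _ hS := hS.smul₀ _
  complete S hS := by
    obtain ⟨R, hR⟩ := hS.subset_closedBall 0
    have hR' : 0 < max R 1 := by positivity
    have hmem : ∀ ε : ℝ, 0 < ε → ∀ x : 𝕜,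
        x ∈ (ε : 𝕜) • Metric.closedBall (0 : 𝕜) (max R 1) ↔ ‖x‖ ≤ ε * max R 1 := by
      intro ε hε x
      rw [mem_smul_iff hε, mem_closedBall_zero_iff, norm_smul, norm_inv, RCLike.norm_ofReal,
        abs_of_pos hε, inv_mul_le_iff₀ hε]
    refine ⟨Metric.closedBall 0 (max R 1), hR.trans (Metric.closedBall_subset_closedBall
      (le_max_left _ _)), Metric.isBounded_closedBall, ⟨⟨0, by simp⟩, ?_⟩, ?_, ?_⟩
    · intro x hx y hy a b hab
      rw [mem_closedBall_zero_iff] at *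
      refine (norm_add_le _ _).trans ?_
      rw [norm_smul, norm_smul]
      have h1 := mul_le_mul_of_nonneg_left hx (norm_nonneg a)
      have h2 := mul_le_mul_of_nonneg_left hy (norm_nonneg b)
      nlinarith
    · intro x hx
      rw [← norm_le_zero_iff]
      refine le_of_forall_pos_le_add fun ε hε => ?_
      have := (hmem _ (div_pos hε hR') _).1 (hx _ (div_pos hε hR'))
      rwa [div_mul_cancel₀ _ hR'.ne', ← zero_add ε] at this
    · intro x hx
      have hc : CauchySeq x := by
        refine Metric.cauchySeq_iff.2 fun ε hε => ?_
        have h2 : 0 < ε / 2 / max R 1 := by positivity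
        obtain ⟨N, hN⟩ := hx _ h2
        refine ⟨N, fun m hm n hn => ?_⟩
        have := (hmem _ h2 _).1 (hN m hm n hn)
        rw [div_mul_cancel₀ _ hR'.ne'] at this
        rw [dist_eq_norm]; linarith
      obtain ⟨l, hl⟩ := cauchySeq_tendsto_of_complete hc
      refine ⟨l, fun ε hε => ?_⟩
      obtain ⟨N, hN⟩ := Metric.tendsto_atTop.1 hl _ (mul_pos hε hR')
      exact ⟨N, fun n hn => (hmem ε hε _).2 (by rw [← dist_eq_norm]; exact (hN n hn).le)⟩

instance {V W : Type*} [AddCommGroup V] [Module 𝕜 V] [Bornology V] [CompleteBVS 𝕜 V]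
    [AddCommGroup W] [Module 𝕜 W] [Bornology W] [CompleteBVS 𝕜 W] : CompleteBVS 𝕜 (V × W) where
  add S T hS hT := by
    rw [← isBounded_image_fst_and_snd] at *
    refine ⟨(CompleteBVS.add (𝕜 := 𝕜) _ _ hS.1 hT.1).subset ?_,
      (CompleteBVS.add (𝕜 := 𝕜) _ _ hS.2 hT.2).subset ?_⟩ <;>
    · rintro _ ⟨_, ⟨x, hx, y, hy, rfl⟩, rfl⟩
      exact ⟨_, ⟨x, hx, rfl⟩, _, ⟨y, hy, rfl⟩, rfl⟩
  smul c S hS := by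
    rw [← isBounded_image_fst_and_snd] at *
    refine ⟨(CompleteBVS.smul c _ hS.1).subset ?_, (CompleteBVS.smul c _ hS.2).subset ?_⟩ <;>
    · rintro _ ⟨_, ⟨x, hx, rfl⟩, rfl⟩
      exact ⟨_, ⟨x, hx, rfl⟩, rfl⟩
  complete S hS := by
    obtain ⟨h1, h2⟩ := isBounded_image_fst_and_snd.2 hS
    obtain ⟨D, d1, d2, d3⟩ := CompleteBVS.complete (𝕜 := 𝕜) _ h1
    obtain ⟨E, e1, e2, e3⟩ := CompleteBVS.complete (𝕜 := 𝕜) _ h2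
    have hmem : ∀ ε : ℝ, 0 < ε → ∀ x : V × W,
        x ∈ (ε : 𝕜) • (D ×ˢ E) ↔ x.1 ∈ (ε : 𝕜) • D ∧ x.2 ∈ (ε : 𝕜) • E := by
      intro ε hε x
      rw [mem_smul_iff hε, mem_smul_iff hε, mem_smul_iff hε]; rfl
    refine ⟨D ×ˢ E, fun x hx => ⟨d1 ⟨x, hx, rfl⟩, e1 ⟨x, hx, rfl⟩⟩, d2.prod e2,
      ⟨d3.nonempty.prod e3.nonempty, ?_⟩, ?_, ?_⟩
    · exact fun x hx y hy a b hab =>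
        ⟨d3.combo _ hx.1 _ hy.1 a b hab, e3.combo _ hx.2 _ hy.2 a b hab⟩
    · exact fun x hx => Prod.ext (d3.norming _ fun ε hε => ((hmem ε hε x).1 (hx ε hε)).1)
        (e3.norming _ fun ε hε => ((hmem ε hε x).1 (hx ε hε)).2)
    · intro x hx
      obtain ⟨l, hl⟩ := d3.complete (fun n => (x n).1) fun ε hε =>
        (hx ε hε).imp fun N hN m hm n hn => ((hmem ε hε _).1 (hN m hm n hn)).1
      obtain ⟨l', hl'⟩ := e3.complete (fun n => (x n).2) fun ε hε =>
        (hx ε hε).imp fun N hN m hm n hn => ((hmem ε hε _).1 (hN m hm n hn)).2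
      refine ⟨(l, l'), fun ε hε => ?_⟩
      obtain ⟨N, hN⟩ := hl ε hε
      obtain ⟨N', hN'⟩ := hl' ε hε
      exact ⟨max N N', fun n hn => (hmem ε hε _).2
        ⟨hN n ((le_max_left _ _).trans hn), hN' n ((le_max_right _ _).trans hn)⟩⟩

instance {V : Type*} [AddCommGroup V] [Module 𝕜 V] [Bornology V] [CompleteBVS 𝕜 V] {n : ℕ} :
    CompleteBVS 𝕜 (Fin n → V) where
  add S T hS hT := by
    rw [← forall_isBounded_image_eval_iff] at *
    refine fun i => (CompleteBVS.add (𝕜 := 𝕜) _ _ (hS i) (hT i)).subset ?_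
    rintro _ ⟨_, ⟨x, hx, y, hy, rfl⟩, rfl⟩
    exact ⟨_, ⟨x, hx, rfl⟩, _, ⟨y, hy, rfl⟩, rfl⟩
  smul c S hS := by
    rw [← forall_isBounded_image_eval_iff] at *
    refine fun i => (CompleteBVS.smul c _ (hS i)).subset ?_
    rintro _ ⟨_, ⟨x, hx, rfl⟩, rfl⟩
    exact ⟨_, ⟨x, hx, rfl⟩, rfl⟩
  complete S hS := by
    have h := forall_isBounded_image_eval_iff.2 hS
    choose D d1 d2 d3 using fun i => CompleteBVS.complete (𝕜 := 𝕜) _ (h i)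
    have hmem : ∀ ε : ℝ, 0 < ε → ∀ x : Fin n → V,
        x ∈ (ε : 𝕜) • (pi univ D) ↔ ∀ i, x i ∈ (ε : 𝕜) • D i := by
      intro ε hε x
      rw [mem_smul_iff hε]
      simp only [mem_pi, mem_univ, true_implies, mem_smul_iff hε]; rfl
    refine ⟨pi univ D, fun x hx i _ => d1 i ⟨x, hx, rfl⟩, IsBounded.pi d2,
      ⟨univ_pi_nonempty_iff.2 fun i => (d3 i).nonempty, ?_⟩, ?_, ?_⟩
    · exact fun x hx y hy a b hab i hi => (d3 i).combo _ (hx i hi) _ (hy i hi) a b hab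
    · exact fun x hx => funext fun i => (d3 i).norming _ fun ε hε => (hmem ε hε x).1 (hx ε hε) i
    · intro x hx
      choose l hl using fun i => (d3 i).complete (fun n => x n i) fun ε hε =>
        (hx ε hε).imp fun N hN m hm n hn => (hmem ε hε _).1 (hN m hm n hn) i
      refine ⟨l, fun ε hε => ?_⟩
      choose N hN using fun i => hl i ε hε
      exact ⟨∑ i, N i, fun n hn => (hmem ε hε _).2 fun i => hN i n
        ((Finset.single_le_sum (f := N) (fun _ _ => Nat.zero_le _) (Finset.mem_univ i)).trans hn)⟩

end Products

/-! ### Algebras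

A complete bornological algebra `A` over `𝕜` is a (possibly non-unital) associative algebra that is
a complete bornological vector space, with bounded multiplication (`BoundedMul A`). -/

lemma isBdd₂_smul {𝕜 : Type} [RCLike 𝕜] {V : Type*} [AddCommGroup V] [Module 𝕜 V] [Bornology V] [CompleteBVS 𝕜 V] :
    IsBdd₂ fun (c : 𝕜) (v : V) => c • v := by
  intro S T hS hT
  obtain ⟨R, hR⟩ := hS.subset_closedBall 0
  obtain ⟨D, h1, h2, h3⟩ := CompleteBVS.complete (𝕜 := 𝕜) T hT
  have hR' : 0 < max R 1 := by positivity
  refine (CompleteBVS.smul ((max R 1 : ℝ) : 𝕜) D h2).subset ?_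
  rintro _ ⟨c, hc, v, hv, rfl⟩
  have hc' : ‖c‖ ≤ max R 1 := (mem_closedBall_zero_iff.1 (hR hc)).trans (le_max_left _ _)
  have := h3.toIsDisc.combo_smul one_pos one_pos (x := v) (y := v) (by simpa using h1 hv)
    (by simpa using h1 hv) (a := c) (b := 0) hR' (by simpa using hc')
  simpa using this

lemma isBdd₂_inl {𝕜 : Type} [RCLike 𝕜] {A V W : Type*} [Bornology A] [Bornology V] [Bornology W] {b : V → W → A} (hb : IsBdd₂ b) :
    IsBdd₂ fun v w => (b v w, (0 : 𝕜)) := fun S T hS hT => by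
  refine ((hb S T hS hT).prod (isBounded_singleton (x := (0 : 𝕜)))).subset ?_
  rintro _ ⟨v, hv, w, hw, rfl⟩
  exact ⟨⟨v, hv, w, hw, rfl⟩, rfl⟩

section Algebras

variable (𝕜 : Type) [RCLike 𝕜] (A : Type u) [NonUnitalRing A] [Module 𝕜 A] [IsScalarTower 𝕜 A A]
  [SMulCommClass 𝕜 A A] [Bornology A]

/-- `A` has a two-sided unit. -/
def IsUnital : Prop := ∃ e : A, ∀ a : A, e * a = a ∧ a * e = a

/-- `A` is multiplicatively convex: each bounded set is absorbed by a bounded disc that is closed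
under multiplication. -/
def IsMultConvex : Prop :=
  ∀ S : Set A, IsBounded S → ∃ D : Set A, IsBounded D ∧ IsDisc 𝕜 D ∧ D * D ⊆ D ∧
    ∃ t : ℝ, 0 < t ∧ S ⊆ (t : 𝕜) • D

/-- `A` has an approximate identity: for each bounded set `S` there is a sequence `μ n` such that
`μ n * x` and `x * μ n` converge to `x` uniformly for `x ∈ S`, in the Banach space spanned by some
bounded completant disc `T` that contains `S`. -/
def HasApproxIdentity : Prop :=
  ∀ S : Set A, IsBounded S → ∃ (μ : ℕ → A) (T : Set A), S ⊆ T ∧ IsBounded T ∧ IsCompletant 𝕜 T ∧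
    ∀ ε : ℝ, 0 < ε → ∃ N, ∀ n ≥ N, ∀ x ∈ S,
      μ n * x - x ∈ (ε : 𝕜) • T ∧ x * μ n - x ∈ (ε : 𝕜) • T

variable {𝕜 A}

lemma isBdd₂_mul [BoundedMul A] : IsBdd₂ fun a b : A => LinearMap.mul 𝕜 A a b := fun _ _ hS hT => by
  simpa [image2_mul] using BoundedMul.isBounded_mul hS hT

variable (𝕜 A) in
/-- The multiplication `A⁺ × A → A`, `(a, c) b ↦ a b + c b`, for `A⁺ = A ⊕ 𝕜`. -/
def plusMul : A × 𝕜 →ₗ[𝕜] A →ₗ[𝕜] A :=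
  LinearMap.mk₂ 𝕜 (fun p b => p.1 * b + p.2 • b)
    (fun p q b => by simp only [Prod.fst_add, Prod.snd_add, add_mul, add_smul]; abel)
    (fun c p b => by simp [smul_mul_assoc, smul_smul])
    (fun p b b' => by simp only [mul_add, smul_add]; abel)
    (fun c p b => by simp [mul_smul_comm, smul_comm c p.2])

variable (𝕜 A) in
/-- The multiplication `A × A⁺ → A`, `b (a, c) ↦ b a + c b`, for `A⁺ = A ⊕ 𝕜`. -/
def mulPlus : A →ₗ[𝕜] A × 𝕜 →ₗ[𝕜] A :=
  LinearMap.mk₂ 𝕜 (fun b p => b * p.1 + p.2 • b)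
    (fun b b' p => by simp only [add_mul, smul_add]; abel)
    (fun c b p => by simp [smul_mul_assoc, smul_comm c p.2])
    (fun b p q => by simp only [Prod.fst_add, Prod.snd_add, mul_add, add_smul]; abel)
    (fun c b p => by simp [mul_smul_comm, smul_smul])

variable [CompleteBVS 𝕜 A]

lemma isBdd₂_plusMul [BoundedMul A] : IsBdd₂ fun (p : A × 𝕜) (b : A) => plusMul 𝕜 A p b := by
  intro S T hS hT
  refine (CompleteBVS.add (𝕜 := 𝕜) _ _ (BoundedMul.isBounded_mul hS.image_fst hT)
    (isBdd₂_smul (V := A) _ _ hS.image_snd hT)).subset ?_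
  rintro _ ⟨p, hp, b, hb, rfl⟩
  exact ⟨_, ⟨p.1, ⟨p, hp, rfl⟩, b, hb, rfl⟩, _, ⟨p.2, ⟨p, hp, rfl⟩, b, hb, rfl⟩, rfl⟩

lemma isBdd₂_mulPlus [BoundedMul A] : IsBdd₂ fun (b : A) (p : A × 𝕜) => mulPlus 𝕜 A b p := by
  intro S T hS hT
  refine (CompleteBVS.add (𝕜 := 𝕜) _ _ (BoundedMul.isBounded_mul hS hT.image_fst)
    (isBdd₂_smul (V := A) _ _ hT.image_snd hS)).subset ?_
  rintro _ ⟨b, hb, p, hp, rfl⟩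
  exact ⟨_, ⟨b, hb, p.1, ⟨p, hp, rfl⟩, rfl⟩, _, ⟨p.2, ⟨p, hp, rfl⟩, b, hb, rfl⟩, rfl⟩

/-- The action of `a : A` on `P ⊗ A` through an action of `A` on the left of `P`. -/
def actLeft {P : Type u} [AddCommGroup P] [Module 𝕜 P] [Bornology P] [CompleteBVS 𝕜 P]
    (act : A →ₗ[𝕜] P →ₗ[𝕜] P) (hact : IsBdd₂ fun a p => act a p) (a : A) :
    CTensor 𝕜 P A →ₗ[𝕜] CTensor 𝕜 P A :=
  CTensor.lift (CTensor.tmul ∘ₗ act a) (fun S T hS hT =>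
    (CTensor.isBdd_tmul _ T (hact {a} S isBounded_singleton hS) hT).subset (by
      rintro _ ⟨p, hp, b, hb, rfl⟩
      exact ⟨act a p, ⟨a, rfl, p, hp, rfl⟩, b, hb, rfl⟩))

@[simp]
lemma actLeft_tmul {P : Type u} [AddCommGroup P] [Module 𝕜 P] [Bornology P] [CompleteBVS 𝕜 P]
    (act : A →ₗ[𝕜] P →ₗ[𝕜] P) (hact : IsBdd₂ fun a p => act a p) (a : A) (p : P) (b : A) :
    actLeft act hact a (CTensor.tmul p b) = CTensor.tmul (act a p) b :=
  CTensor.lift_tmul _ _ p b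

/-- The action of `a : A` on `A ⊗ P` through an action of `A` on the right of `P`. -/
def actRight {P : Type u} [AddCommGroup P] [Module 𝕜 P] [Bornology P] [CompleteBVS 𝕜 P]
    (act : P →ₗ[𝕜] A →ₗ[𝕜] P) (hact : IsBdd₂ fun p a => act p a) (a : A) :
    CTensor 𝕜 A P →ₗ[𝕜] CTensor 𝕜 A P :=
  CTensor.lift (CTensor.tmul.compl₂ (act.flip a)) (fun S T hS hT =>
    (CTensor.isBdd_tmul S _ hS (hact T {a} hT isBounded_singleton)).subset (by
      rintro _ ⟨b, hb, p, hp, rfl⟩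
      exact ⟨b, hb, act p a, ⟨p, hp, a, rfl, rfl⟩, rfl⟩))

@[simp]
lemma actRight_tmul {P : Type u} [AddCommGroup P] [Module 𝕜 P] [Bornology P] [CompleteBVS 𝕜 P]
    (act : P →ₗ[𝕜] A →ₗ[𝕜] P) (hact : IsBdd₂ fun p a => act p a) (a b : A) (p : P) :
    actRight act hact a (CTensor.tmul b p) = CTensor.tmul b (act p a) :=
  CTensor.lift_tmul _ _ b p

variable (𝕜 A) [BoundedMul A]

/-- There is a bounded left module map `A → A⁺ ⊗ A` that is a section of the multiplication, where
`A⁺ = A` if `A` is unital and `A⁺ = A ⊕ 𝕜` if not. -/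
def HasLeftSection : Prop :=
  (IsUnital A → ∃ σ : A →ₗ[𝕜] CTensor 𝕜 A A, IsBdd σ ∧
    (∀ a x, σ (a * x) = actLeft (LinearMap.mul 𝕜 A) isBdd₂_mul a (σ x)) ∧
    ∀ x, CTensor.lift (LinearMap.mul 𝕜 A) isBdd₂_mul (σ x) = x) ∧
  (¬ IsUnital A → ∃ σ : A →ₗ[𝕜] CTensor 𝕜 (A × 𝕜) A, IsBdd σ ∧
    (∀ a x, σ (a * x) =
      actLeft ((mulPlus 𝕜 A).compr₂ (LinearMap.inl 𝕜 A 𝕜)) (isBdd₂_inl isBdd₂_mulPlus) a (σ x)) ∧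
    ∀ x, CTensor.lift (plusMul 𝕜 A) isBdd₂_plusMul (σ x) = x)

/-- There is a bounded right module map `A → A ⊗ A⁺` that is a section of the multiplication, where
`A⁺ = A` if `A` is unital and `A⁺ = A ⊕ 𝕜` if not. -/
def HasRightSection : Prop :=
  (IsUnital A → ∃ σ : A →ₗ[𝕜] CTensor 𝕜 A A, IsBdd σ ∧
    (∀ a x, σ (x * a) = actRight (LinearMap.mul 𝕜 A) isBdd₂_mul a (σ x)) ∧
    ∀ x, CTensor.lift (LinearMap.mul 𝕜 A) isBdd₂_mul (σ x) = x) ∧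
  (¬ IsUnital A → ∃ σ : A →ₗ[𝕜] CTensor 𝕜 A (A × 𝕜), IsBdd σ ∧
    (∀ a x, σ (x * a) =
      actRight ((plusMul 𝕜 A).compr₂ (LinearMap.inl 𝕜 A 𝕜)) (isBdd₂_inl isBdd₂_plusMul) a (σ x)) ∧
    ∀ x, CTensor.lift (mulPlus 𝕜 A) isBdd₂_mulPlus (σ x) = x)

/-- `A` is quasi-unital. -/
structure IsQuasiUnital : Prop where
  approxIdentity : HasApproxIdentity 𝕜 A
  leftSection : HasLeftSection 𝕜 A
  rightSection : HasRightSection 𝕜 A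

end Algebras

/-! ### Modules -/

section Modules

variable (𝕜 : Type) [RCLike 𝕜] (A : Type u) [NonUnitalRing A] [Module 𝕜 A] [IsScalarTower 𝕜 A A]
  [SMulCommClass 𝕜 A A] [Bornology A] [CompleteBVS 𝕜 A] [BoundedMul A]

/-- A complete bornological right `A`-module, that is a unital right `A⁺`-module: a complete
bornological vector space with a bounded right action of `A`; if `A` has a unit, it acts as the
identity. -/
structure BornMod : Type (u + 1) where
  /-- The underlying space. -/
  carrier : Type u
  [addCommGroup : AddCommGroup carrier]
  [module : Module 𝕜 carrier]
  [bornology : Bornology carrier]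
  [complete : CompleteBVS 𝕜 carrier]
  /-- The action `m ↦ a ↦ m a`. -/
  act : carrier →ₗ[𝕜] A →ₗ[𝕜] carrier
  isBdd₂_act : IsBdd₂ fun m a => act m a
  act_act : ∀ m a b, act (act m a) b = act m (a * b)
  act_unit : ∀ e : A, (∀ a, e * a = a ∧ a * e = a) → ∀ m, act m e = m

variable {𝕜 A}

namespace BornMod

instance : CoeSort (BornMod 𝕜 A) (Type u) := ⟨BornMod.carrier⟩

attribute [instance] BornMod.addCommGroup BornMod.module BornMod.bornology BornMod.complete

/-- The bounded `A`-linear maps (equivalently, the bounded `A⁺`-linear maps). -/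
def homSub (M N : BornMod 𝕜 A) : Submodule 𝕜 (M →ₗ[𝕜] N) where
  carrier := {f | IsBdd f ∧ ∀ m a, f (M.act m a) = N.act (f m) a}
  add_mem' {f g} hf hg := ⟨fun S hS => (CompleteBVS.add (𝕜 := 𝕜) _ _ (hf.1 S hS) (hg.1 S hS)).subset
    (by rintro _ ⟨x, hx, rfl⟩; exact ⟨_, ⟨x, hx, rfl⟩, _, ⟨x, hx, rfl⟩, rfl⟩),
    fun m a => by simp [hf.2, hg.2]⟩
  zero_mem' := ⟨fun S _ => (isBounded_singleton (x := (0 : N))).subset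
    (by rintro _ ⟨x, -, rfl⟩; rfl), by simp⟩
  smul_mem' c f hf := ⟨fun S hS => (CompleteBVS.smul c _ (hf.1 S hS)).subset
    (by rintro _ ⟨x, hx, rfl⟩; exact ⟨_, ⟨x, hx, rfl⟩, rfl⟩), fun m a => by simp [hf.2]⟩

/-- The space `𝓛_A(M, N)` of bounded `A`-linear maps. -/
abbrev LA (M N : BornMod 𝕜 A) : Type u := homSub M N

/-- The equibounded bornology: `F` is bounded if `F(U)` is bounded for each bounded `U`. -/
instance (M N : BornMod 𝕜 A) : Bornology (LA M N) :=
  Bornology.ofBounded {F | ∀ U : Set M, IsBounded U → IsBounded (image2 (fun f m => f.1 m) F U)}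
    (fun U _ => by simp)
    (fun F hF G hG U hU => (hF U hU).subset (image2_subset_right hG))
    (fun F hF G hG U hU => by rw [image2_union_left]; exact (hF U hU).union (hG U hU))
    (fun f U hU => by simpa using f.2.1 U hU)

lemma LA.isBounded_iff {M N : BornMod 𝕜 A} {F : Set (LA M N)} : IsBounded F ↔
    ∀ U : Set M, IsBounded U → IsBounded (image2 (fun f m => f.1 m) F U) :=
  Bornology.isBounded_ofBounded_iff _

/-- The category of complete bornological right `A`-modules. -/
instance : CategoryTheory.Category (BornMod 𝕜 A) where
  Hom M N := LA M N
  id M := ⟨LinearMap.id, fun S hS => by simpa using hS, fun _ _ => rfl⟩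
  comp f g := ⟨g.1 ∘ₗ f.1, g.2.1.comp f.2.1, fun m a => by simp [f.2.2, g.2.2]⟩

instance : CategoryTheory.Preadditive (BornMod 𝕜 A) where
  homGroup M N := inferInstanceAs (AddCommGroup (LA M N))
  add_comp _ _ _ f f' g := Subtype.ext (LinearMap.comp_add f.1 f'.1 g.1)
  comp_add _ _ _ f g g' := Subtype.ext (LinearMap.add_comp f.1 g'.1 g.1)

/-- The linear map that underlies a morphism of modules. -/
def toLin {M N : BornMod 𝕜 A} (f : M ⟶ N) : M →ₗ[𝕜] N := Subtype.val (p := (· ∈ homSub M N)) f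

lemma isBdd_toLin {M N : BornMod 𝕜 A} (f : M ⟶ N) : IsBdd (toLin f) :=
  (Subtype.property (p := (· ∈ homSub M N)) f).1

lemma toLin_act {M N : BornMod 𝕜 A} (f : M ⟶ N) (m : M) (a : A) :
    toLin f (M.act m a) = N.act (toLin f m) a :=
  (Subtype.property (p := (· ∈ homSub M N)) f).2 m a

lemma hom_ext {M N : BornMod 𝕜 A} {f g : M ⟶ N} (h : ∀ m, toLin f m = toLin g m) : f = g :=
  Subtype.ext (p := (· ∈ homSub M N)) (LinearMap.ext h)

/-- `A` as a right module over itself. -/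
def self (𝕜 : Type) [RCLike 𝕜] (A : Type u) [NonUnitalRing A] [Module 𝕜 A] [IsScalarTower 𝕜 A A]
    [SMulCommClass 𝕜 A A] [Bornology A] [CompleteBVS 𝕜 A] [BoundedMul A] : BornMod 𝕜 A where
  carrier := A
  act := LinearMap.mul 𝕜 A
  isBdd₂_act := isBdd₂_mul
  act_act m a b := by simp [mul_assoc]
  act_unit e he m := by simpa using (he m).2

/-- The unitalization `A ⊕ 𝕜` of a non-unital algebra as a right module over `A`. -/
def unitalization (𝕜 : Type) [RCLike 𝕜] {A : Type u} [NonUnitalRing A] [Module 𝕜 A]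
    [IsScalarTower 𝕜 A A] [SMulCommClass 𝕜 A A] [Bornology A] [CompleteBVS 𝕜 A] [BoundedMul A]
    (h : ¬ IsUnital A) : BornMod 𝕜 A where
  carrier := A × 𝕜
  act := (plusMul 𝕜 A).compr₂ (LinearMap.inl 𝕜 A 𝕜)
  isBdd₂_act := isBdd₂_inl isBdd₂_plusMul
  act_act m a b := by simp [plusMul, add_mul, mul_assoc, smul_mul_assoc]
  act_unit e he _ := (h ⟨e, he⟩).elim

open Classical in
/-- `A⁺` as a right module: `A` itself if `A` is unital, the unitalization `A ⊕ 𝕜` if not. -/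
def plus (𝕜 : Type) [RCLike 𝕜] (A : Type u) [NonUnitalRing A] [Module 𝕜 A] [IsScalarTower 𝕜 A A]
    [SMulCommClass 𝕜 A A] [Bornology A] [CompleteBVS 𝕜 A] [BoundedMul A] : BornMod 𝕜 A :=
  if h : IsUnital A then self 𝕜 A else unitalization 𝕜 h

/-- The direct sum of `n` copies of `M`. -/
def pow (M : BornMod 𝕜 A) (n : ℕ) : BornMod 𝕜 A where
  carrier := Fin n → M
  act := LinearMap.mk₂ 𝕜 (fun x a i => M.act (x i) a)
    (fun x y a => by ext i; simp) (fun c x a => by ext i; simp)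
    (fun x a b => by ext i; simp) (fun c x a => by ext i; simp)
  isBdd₂_act S T hS hT := by
    rw [← forall_isBounded_image_eval_iff] at *
    intro i
    refine (M.isBdd₂_act _ T (hS i) hT).subset ?_
    rintro _ ⟨_, ⟨x, hx, a, ha, rfl⟩, rfl⟩
    exact ⟨x i, ⟨x, hx, rfl⟩, a, ha, rfl⟩
  act_act x a b := by ext i; simp [M.act_act]
  act_unit e he x := by ext i; simp [M.act_unit e he]

/-- A sequence of bounded linear maps that is exact with a bounded linear splitting. -/
def SplitExact {U V W : Type*} [AddCommGroup U] [Module 𝕜 U] [Bornology U] [AddCommGroup V]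
    [Module 𝕜 V] [Bornology V] [AddCommGroup W] [Module 𝕜 W] [Bornology W]
    (i : U →ₗ[𝕜] V) (p : V →ₗ[𝕜] W) : Prop :=
  Function.Injective i ∧ LinearMap.range i = LinearMap.ker p ∧ Function.Surjective p ∧
    ∃ (t : V →ₗ[𝕜] U) (s : W →ₗ[𝕜] V), IsBdd t ∧ IsBdd s ∧
      (∀ u, t (i u) = u) ∧ (∀ w, p (s w) = w) ∧ ∀ v, i (t v) + s (p v) = v

/-- The map `𝓛_A(P, M) → 𝓛_A(P, N)` induced by a morphism `M ⟶ N`. -/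
def postcomp (P : BornMod 𝕜 A) {M N : BornMod 𝕜 A} (f : M ⟶ N) : LA P M →ₗ[𝕜] LA P N where
  toFun φ := ⟨toLin f ∘ₗ φ.1, (isBdd_toLin f).comp φ.2.1, fun m a => by simp [φ.2.2, toLin_act]⟩
  map_add' φ ψ := Subtype.ext (LinearMap.comp_add φ.1 ψ.1 (toLin f))
  map_smul' c φ := Subtype.ext (LinearMap.comp_smul (toLin f) c φ.1)

/-- Relatively projective modules: `𝓛_A(P, -)` preserves the split exact sequences. -/
def IsProjective (P : BornMod 𝕜 A) : Prop :=
  ∀ {L M N : BornMod 𝕜 A} (i : L ⟶ M) (p : M ⟶ N), SplitExact (toLin i) (toLin p) →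
    SplitExact (postcomp P i) (postcomp P p)

/-- Finitely generated modules, in the sense of the exact structure: `P` is a quotient of `(A⁺)ⁿ`
for some `n`, by a bounded module map with a bounded linear section. -/
def IsFG (P : BornMod 𝕜 A) : Prop :=
  ∃ (n : ℕ) (π : (plus 𝕜 A).pow n ⟶ P) (s : P →ₗ[𝕜] (plus 𝕜 A).pow n),
    IsBdd s ∧ ∀ x, toLin π (s x) = x

/-! ### Nuclear maps -/

/-- The left action of `A` on `𝓛_A(M, A)`: `(a φ)(m) = a φ(m)`. -/
def dualAct (M : BornMod 𝕜 A) (a : A) (φ : LA M (self 𝕜 A)) : LA M (self 𝕜 A) :=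
  ⟨LinearMap.mul 𝕜 A a ∘ₗ φ.1,
    fun S hS => by
      have h : @IsBounded A _ (φ.1 '' S) := φ.2.1 S hS
      refine (BoundedMul.isBounded_mul (R := A) (isBounded_singleton (x := a)) h).subset ?_
      rintro _ ⟨x, hx, rfl⟩
      exact ⟨a, rfl, φ.1 x, ⟨x, hx, rfl⟩, rfl⟩,
    fun m b => by
      have h := φ.2.2 m b
      exact (congrArg (LinearMap.mul 𝕜 A a) h).trans (mul_assoc a (show A from φ.1 m) b).symm⟩

/-- The value at `m` of the natural map `N ⊗_A 𝓛_A(M, A) → 𝓛_A(M, N)`, which sends `n ⊗ φ` to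
the map `m ↦ n φ(m)`. -/
def nuclearEval (M N : BornMod 𝕜 A) (m : M) :
    BTensor 𝕜 (fun (n : N) (a : A) => N.act n a) (dualAct M) →ₗ[𝕜] N :=
  BTensor.lift
    (LinearMap.mk₂ 𝕜 (fun (n : N) (φ : LA M (self 𝕜 A)) => N.act n (φ.1 m))
      (fun n n' φ => LinearMap.map_add₂ N.act n n' (φ.1 m))
      (fun c n φ => LinearMap.map_smul₂ N.act c n (φ.1 m))
      (fun n φ ψ => map_add (N.act n) (φ.1 m) (ψ.1 m))
      (fun c n φ => map_smul (N.act n) c (φ.1 m)))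
    (fun S T hS hT => by
      refine (N.isBdd₂_act S _ hS
        (LA.isBounded_iff.1 hT {m} isBounded_singleton)).subset ?_
      rintro _ ⟨n, hn, φ, hφ, rfl⟩
      exact ⟨n, hn, φ.1 m, ⟨φ, hφ, m, rfl, rfl⟩, rfl⟩)
    (fun n a φ => N.act_act n a (φ.1 m))

@[simp]
lemma nuclearEval_tmul (M N : BornMod 𝕜 A) (m : M) (n : N) (φ : LA M (self 𝕜 A)) :
    nuclearEval M N m (BTensor.tmul n φ) = N.act n (φ.1 m) :=
  BTensor.lift_tmul _ _ _ n φ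

/-- `A`-nuclear maps: those in the image of `N ⊗_A 𝓛_A(M, A) → 𝓛_A(M, N)`. -/
def IsNuclear {M N : BornMod 𝕜 A} (f : M ⟶ N) : Prop :=
  ∃ t : BTensor 𝕜 (fun (n : N) (a : A) => N.act n a) (dualAct M),
    ∀ m, toLin f m = nuclearEval M N m t

/-! ### Essentialization -/

/-- The underlying space of `M ⊗_A A`. -/
abbrev EssSpace (M : BornMod 𝕜 A) : Type u :=
  BTensor 𝕜 (fun (m : M) (a : A) => M.act m a) (fun a b : A => a * b)

/-- The bilinear map `(m, b) ↦ m ⊗ b a`. -/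
def essBil (M : BornMod 𝕜 A) (a : A) : M →ₗ[𝕜] A →ₗ[𝕜] EssSpace M :=
  BTensor.tmul.compl₂ ((LinearMap.mul 𝕜 A).flip a)

lemma isBdd_essBil (M : BornMod 𝕜 A) (J : Set A) (hJ : IsBounded J) (S : Set M) (T : Set A)
    (hS : IsBounded S) (hT : IsBounded T) :
    IsBounded {x | ∃ a ∈ J, ∃ m ∈ S, ∃ b ∈ T, x = essBil M a m b} := by
  refine (BTensor.isBdd_tmul S _ hS (BoundedMul.isBounded_mul hT hJ)).subset ?_
  rintro _ ⟨a, ha, m, hm, b, hb, rfl⟩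
  exact ⟨m, hm, b * a, ⟨b, hb, a, ha, rfl⟩, rfl⟩

lemma isBdd₂_essBil (M : BornMod 𝕜 A) (a : A) : IsBdd₂ fun m b => essBil M a m b :=
  fun S T hS hT => (isBdd_essBil M {a} isBounded_singleton S T hS hT).subset (by
    rintro _ ⟨m, hm, b, hb, rfl⟩
    exact ⟨a, rfl, m, hm, b, hb, rfl⟩)

lemma essBil_balanced (M : BornMod 𝕜 A) (a : A) (m : M) (c b : A) :
    essBil M a (M.act m c) b = essBil M a m (c * b) := by
  simp only [essBil, LinearMap.compl₂_apply, LinearMap.flip_apply, LinearMap.mul_apply', mul_assoc]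
  exact BTensor.tmul_balanced _ _ _

/-- The right action of `a` on `M ⊗_A A`: `(m ⊗ b) a = m ⊗ b a`. -/
def essAct (M : BornMod 𝕜 A) (a : A) : EssSpace M →ₗ[𝕜] EssSpace M :=
  BTensor.lift (essBil M a) (isBdd₂_essBil M a) (essBil_balanced M a)

lemma isBdd_essAct (M : BornMod 𝕜 A) (a : A) : IsBdd (essAct M a) := BTensor.isBdd_lift _ _ _

@[simp]
lemma essAct_tmul (M : BornMod 𝕜 A) (a : A) (m : M) (b : A) :
    essAct M a (BTensor.tmul m b) = BTensor.tmul m (b * a) := by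
  simp [essAct, essBil]

lemma isBdd_add {V X : Type*} [Bornology V] [AddCommGroup V] [Module 𝕜 V] [AddCommGroup X]
    [Module 𝕜 X] [Bornology X] [CompleteBVS 𝕜 X] {f g : V →ₗ[𝕜] X} (hf : IsBdd f) (hg : IsBdd g) :
    IsBdd (f + g) := fun S hS =>
  (CompleteBVS.add (𝕜 := 𝕜) _ _ (hf S hS) (hg S hS)).subset
    (by rintro _ ⟨x, hx, rfl⟩; exact ⟨_, ⟨x, hx, rfl⟩, _, ⟨x, hx, rfl⟩, rfl⟩)

lemma isBdd_smul {V X : Type*} [Bornology V] [AddCommGroup V] [Module 𝕜 V] [AddCommGroup X]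
    [Module 𝕜 X] [Bornology X] [CompleteBVS 𝕜 X] {f : V →ₗ[𝕜] X} (c : 𝕜) (hf : IsBdd f) :
    IsBdd (c • f) := fun S hS =>
  (CompleteBVS.smul c _ (hf S hS)).subset
    (by rintro _ ⟨x, hx, rfl⟩; exact ⟨_, ⟨x, hx, rfl⟩, rfl⟩)

/-- The essentialization `M ⊗_A A` of a module. -/
def ess (M : BornMod 𝕜 A) : BornMod 𝕜 A where
  carrier := EssSpace M
  act := LinearMap.flip
    { toFun := essAct M
      map_add' := fun a a' => BTensor.hom_ext _ _ (isBdd_essAct M _)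
        (isBdd_add (isBdd_essAct M _) (isBdd_essAct M _)) fun m b => by simp [mul_add]
      map_smul' := fun c a => BTensor.hom_ext _ _ (isBdd_essAct M _)
        (isBdd_smul _ (isBdd_essAct M _)) fun m b => by simp [mul_smul_comm] }
  isBdd₂_act := BTensor.isBdd₂_lift (essBil M) (isBdd₂_essBil M) (essBil_balanced M)
    (isBdd_essBil M)
  act_act t a b := LinearMap.congr_fun (BTensor.hom_ext (essAct M b ∘ₗ essAct M a)
    (essAct M (a * b)) ((isBdd_essAct M b).comp (isBdd_essAct M a)) (isBdd_essAct M _)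
    fun m c => by simp [mul_assoc]) t
  act_unit e he t := LinearMap.congr_fun (BTensor.hom_ext (essAct M e) LinearMap.id
    (isBdd_essAct M e) (fun S hS => by simpa using hS) fun m c => by simp [(he c).2]) t

/-- The map `f ⊗ id : M ⊗_A A → N ⊗_A A`. -/
def essMapLin {M N : BornMod 𝕜 A} (f : M ⟶ N) : EssSpace M →ₗ[𝕜] EssSpace N :=
  BTensor.lift (BTensor.tmul ∘ₗ toLin f)
    (fun S T hS hT => (BTensor.isBdd_tmul _ T (isBdd_toLin f S hS) hT).subset (by
      rintro _ ⟨m, hm, b, hb, rfl⟩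
      exact ⟨_, ⟨m, hm, rfl⟩, b, hb, rfl⟩))
    (fun m a b => by
      simp only [LinearMap.comp_apply, toLin_act]
      exact BTensor.tmul_balanced _ _ _)

lemma isBdd_essMapLin {M N : BornMod 𝕜 A} (f : M ⟶ N) : IsBdd (essMapLin f) :=
  BTensor.isBdd_lift _ _ _

@[simp]
lemma essMapLin_tmul {M N : BornMod 𝕜 A} (f : M ⟶ N) (m : M) (b : A) :
    essMapLin f (BTensor.tmul m b) = BTensor.tmul (toLin f m) b :=
  BTensor.lift_tmul _ _ _ m b

/-- The essentialization as a functor. -/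
def essFunctor (𝕜 : Type) [RCLike 𝕜] (A : Type u) [NonUnitalRing A] [Module 𝕜 A]
    [IsScalarTower 𝕜 A A] [SMulCommClass 𝕜 A A] [Bornology A] [CompleteBVS 𝕜 A] [BoundedMul A] :
    CategoryTheory.Functor (BornMod 𝕜 A) (BornMod 𝕜 A) where
  obj M := ess M
  map {M N} f := (⟨essMapLin f, isBdd_essMapLin f, fun t a => LinearMap.congr_fun
    (BTensor.hom_ext (essMapLin f ∘ₗ essAct M a) (essAct N a ∘ₗ essMapLin f)
      ((isBdd_essMapLin f).comp (isBdd_essAct M a)) ((isBdd_essAct N a).comp (isBdd_essMapLin f))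
      fun m b => by simp) t⟩ : LA (ess M) (ess N))
  map_id M := hom_ext (LinearMap.congr_fun (BTensor.hom_ext (essMapLin _) LinearMap.id
    (isBdd_essMapLin _) (fun S hS => by simpa using hS) fun m b => by simp; rfl))
  map_comp f g := hom_ext (LinearMap.congr_fun (BTensor.hom_ext (essMapLin _)
    (essMapLin g ∘ₗ essMapLin f) (isBdd_essMapLin _)
    ((isBdd_essMapLin g).comp (isBdd_essMapLin f)) fun m b => by simp; rfl))

instance : (essFunctor 𝕜 A).Additive where
  map_add {M N f g} := hom_ext (LinearMap.congr_fun (BTensor.hom_ext (essMapLin (f + g))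
    (essMapLin f + essMapLin g) (isBdd_essMapLin _)
    (isBdd_add (isBdd_essMapLin f) (isBdd_essMapLin g)) fun m b => by
      simp only [essMapLin_tmul, LinearMap.add_apply]
      rw [show toLin (f + g) m = toLin f m + toLin g m from rfl]
      simp))

/-- The multiplication map `M ⊗_A A → M`, `m ⊗ a ↦ m a`. -/
def essMulLin (M : BornMod 𝕜 A) : EssSpace M →ₗ[𝕜] M :=
  BTensor.lift M.act M.isBdd₂_act M.act_act

lemma isBdd_essMulLin (M : BornMod 𝕜 A) : IsBdd (essMulLin M) := BTensor.isBdd_lift _ _ _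

@[simp]
lemma essMulLin_tmul (M : BornMod 𝕜 A) (m : M) (a : A) :
    essMulLin M (BTensor.tmul m a) = M.act m a := by
  simp [essMulLin]

/-- The multiplication map `M ⊗_A A → M` as a morphism of modules. -/
def essMul (M : BornMod 𝕜 A) : (essFunctor 𝕜 A).obj M ⟶ M :=
  (⟨essMulLin M, isBdd_essMulLin M, fun t a => by
    have hb : IsBdd (M.act.flip a) := fun S hS => by
      refine (M.isBdd₂_act S {a} hS isBounded_singleton).subset ?_
      rintro _ ⟨m, hm, rfl⟩
      exact ⟨m, hm, a, rfl, rfl⟩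
    exact LinearMap.congr_fun (BTensor.hom_ext (essMulLin M ∘ₗ essAct M a)
      (M.act.flip a ∘ₗ essMulLin M) ((isBdd_essMulLin M).comp (isBdd_essAct M a))
      (hb.comp (isBdd_essMulLin M)) fun m b => by simp [M.act_act]) t⟩ : LA (ess M) M)

lemma essMul_naturality {M N : BornMod 𝕜 A} (f : M ⟶ N) :
    CategoryTheory.CategoryStruct.comp ((essFunctor 𝕜 A).map f) (essMul N) =
      CategoryTheory.CategoryStruct.comp (essMul M) f :=
  hom_ext (LinearMap.congr_fun (BTensor.hom_ext (essMulLin N ∘ₗ essMapLin f)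
    (toLin f ∘ₗ essMulLin M) ((isBdd_essMulLin N).comp (isBdd_essMapLin f))
    ((isBdd_toLin f).comp (isBdd_essMulLin M)) fun m b => by simp [toLin_act]))

end BornMod

/-! ### Complexes -/

/-- A complex that is bounded in grading degree. -/
def IsBoundedComplex (M : CochainComplex (BornMod 𝕜 A) ℤ) : Prop :=
  ∃ n : ℕ, ∀ i : ℤ, (n : ℤ) < |i| → Subsingleton (M.X i)

/-- The essentialization `M ⊗_A A` of a complex. -/
def essComplex (M : CochainComplex (BornMod 𝕜 A) ℤ) : CochainComplex (BornMod 𝕜 A) ℤ :=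
  ((BornMod.essFunctor 𝕜 A).mapHomologicalComplex _).obj M

/-- The multiplication map `M ⊗_A A ⟶ M` of complexes. -/
def essComplexMul (M : CochainComplex (BornMod 𝕜 A) ℤ) : essComplex M ⟶ M where
  f i := BornMod.essMul (M.X i)
  comm' i j _ := (BornMod.essMul_naturality (M.d i j)).symm

/-- Homotopy-finite complexes: the canonical map from the essentialization `M ⊗_A A` to `M` is a
homotopy equivalence, and `M` is homotopy equivalent to a bounded complex of finitely generated
projective modules. -/
structure IsHFinite (M : CochainComplex (BornMod 𝕜 A) ℤ) : Prop where
  essential : HomologicalComplex.homotopyEquivalences _ _ (essComplexMul M)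
  perfect : ∃ P : CochainComplex (BornMod 𝕜 A) ℤ, IsBoundedComplex P ∧
    (∀ i, (P.X i).IsFG ∧ (P.X i).IsProjective) ∧ Nonempty (HomotopyEquiv M P)

/-- A morphism of complexes is `A`-nuclear when its graded components are. -/
def IsNuclearMap {M N : CochainComplex (BornMod 𝕜 A) ℤ} (g : M ⟶ N) : Prop :=
  ∀ i, BornMod.IsNuclear (g.f i)

end Modules

end Borno

end

/-! Let the identity of a complex be homotopic to a nuclear map `g`. Both halves of h-finiteness
come from writing a nuclear map as an absolutely convergent sum of rank-one maps `m ↦ n φ(m)` over a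
bounded set of pairs `(n, φ)` (`IsNuclear.exists_eq`).

For the multiplication map, each rank-one map lifts to `N ⊗_A A` by `m ↦ n ⊗ φ(m)`. Nothing forces
these degreewise lifts to commute with the differentials, but `g` followed by a lift of `g` is a
chain map (`IsNuclearMap.exists_lift`). Its two composites with the multiplication map are `g ≫ g`
and the essentialization of `g ≫ g`, both homotopic to the identity.

For finiteness, split the sum for a nuclear endomorphism `g` of a module into a finite part and a
small tail. Iterating the tail produces long products of elements `φ(n)` of `A`; multiplicative
convexity keeps these under control, so a Neumann series inverts `1 - tail` (`exists_isContractive`,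
`exists_inverse_of_contractive`). Rank-one maps factor through `A⁺`, so `1 - g` is invertible modulo
maps that factor through finitely generated projective modules (`IsNuclear.exists_left_inverse`).
The rest is formal and takes place in an idempotent complete additive category
(`exists_homotopyEquiv_of_homotopic`). Working down from the top degree, the homotopy shows that the
differential into the current degree is split surjective up to a map through a finitely generated
projective `F`. After adding the contractible complex `F ⟶ F` it becomes genuinely split onto the
current object. Removing the contractible summand that this produces leaves a finitely generated
projective object in that degree.

Conversely, let `P` be a complex of finitely generated projectives equivalent to `M`. The identity
of `M` is homotopic to a composite `M ⟶ P ⟶ M ⊗_A A ⟶ M`. The part from `P` on is nuclear: in a dual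
basis it is `x ↦ ∑ k(e_j) x_j`, and if `k(e_j)` comes from tensors `n ⊗ b`, then `x ↦ b x_j` takes
values in `A` although `x_j` lies only in `A⁺` (`HasDualBasis.isNuclear_comp_essMul`). Nuclear maps
form an ideal. -/

noncomputable section

namespace Borno

open Set Bornology
open scoped Pointwise

universe u

/-! ### The Neumann series in a complete bornological space. -/

section Neumann

variable {𝕜 : Type} [RCLike 𝕜] {V : Type u} [AddCommGroup V] [Module 𝕜 V] [Bornology V]
  [CompleteBVS 𝕜 V]

lemma isBdd_id {X : Type*} [Bornology X] : IsBdd fun x : X => x := fun S hS => by simpa using hS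

variable (𝕜 V) in
/-- The evaluation of formal sums of elements of `V`. -/
def evalSum : Ell1 𝕜 V →ₗ[𝕜] V := Ell1.lift (fun v => v) isBdd_id

lemma isBdd_evalSum : IsBdd (evalSum 𝕜 V) := Ell1.isBdd_lift _ _

@[simp]
lemma evalSum_delta (v : V) : evalSum 𝕜 V (delta v) = v := Ell1.lift_delta _ _ _

lemma add_mem_ellBall {ι : Type u} [Bornology ι] {S : Set ι} {C C' : ℝ} {x y : Ell1 𝕜 ι}
    (hx : x ∈ ellBall S C) (hy : y ∈ ellBall S C') : x + y ∈ ellBall S (C + C') := by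
  simpa using ellBall_combo hx hy (1 : 𝕜) 1

lemma sub_mem_ellBall {ι : Type u} [Bornology ι] {S : Set ι} {C C' : ℝ} {x y : Ell1 𝕜 ι}
    (hx : x ∈ ellBall S C) (hy : y ∈ ellBall S C') : x - y ∈ ellBall S (C + C') := by
  have h := ellBall_combo hx hy (1 : 𝕜) (-1)
  rw [show (1 : 𝕜) • x + (-1 : 𝕜) • y = x - y by module] at h
  simpa using h

lemma smul_mem_ellBall {ι : Type u} [Bornology ι] {S : Set ι} {C : ℝ} {x : Ell1 𝕜 ι}
    (hx : x ∈ ellBall S C) (c : 𝕜) : c • x ∈ ellBall S (‖c‖ * C) := by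
  simpa using ellBall_combo hx hx c (0 : 𝕜)

/-- The factor `C + C` in place of `C` is inherited from `Ell1.lift_mem`, whose bound for limits of
partial sums is not sharp. This loss of a factor 2 is why contractions are normalized with `1 / 4`.
-/
lemma ellBall_ball {ι : Type u} [Bornology ι] {κ : Type u} [Bornology κ] {S : Set ι} {T : Set κ}
    (hT : IsBounded T) {b : ι → Ell1 𝕜 κ} (hb : IsBdd b) {C r : ℝ} (hC : 0 < C) (hr : 0 < r)
    {ξ : Ell1 𝕜 ι} (hξ : ξ ∈ ellBall S C) (h : ∀ i ∈ S, b i ∈ ellBall T r) :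
    Ell1.lift b hb ξ ∈ ellBall T ((C + C) * r) :=
  (mem_smul_ellBall (𝕜 := 𝕜) (add_pos hC hC)).1
    (Ell1.lift_mem (isBounded_ellBall hT r) (isCompletant_ellBall hT hr) b hb hC hξ h)

/-- The property of an endomorphism `f` that `f ^ n` tends to zero fast enough for the Neumann
series of `1 - f` to converge: each bounded set lies in a bounded set `G` whose elements are mapped
by `f` to sums `∑ λ_g g` with `g ∈ G` and `∑ |λ_g| ≤ 1 / 4`. -/
def IsContractive (f : V →ₗ[𝕜] V) : Prop :=
  ∀ U : Set V, IsBounded U → ∃ G : Set V, U ⊆ G ∧ IsBounded G ∧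
    ∀ g ∈ G, ∃ η ∈ ellBall (𝕜 := 𝕜) G (1 / 4), evalSum 𝕜 V η = f g

/-- An endomorphism that is contractive on the generators lifts to a contraction of the formal
sums. -/
lemma exists_lift_contraction {f : V →ₗ[𝕜] V} (hf : IsBdd f) {G : Set V} (hG : IsBounded G)
    (h : ∀ g ∈ G, ∃ η ∈ ellBall (𝕜 := 𝕜) G (1 / 4), evalSum 𝕜 V η = f g) :
    ∃ F : Ell1 𝕜 V →ₗ[𝕜] Ell1 𝕜 V, (∀ ζ, evalSum 𝕜 V (F ζ) = f (evalSum 𝕜 V ζ)) ∧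
      ∀ C, 0 < C → ∀ ζ ∈ ellBall G C, F ζ ∈ ellBall G (C / 2) := by
  classical
  choose! ψ h1 h2 using h
  -- Outside `G` no short expansion of `f g` is available; the trivial one still makes the lift
  -- cover `f` on all of `V`.
  let b : V → Ell1 𝕜 V := fun g => if g ∈ G then ψ g else delta (f g)
  have hb : IsBdd b := by
    intro S hS
    refine ((isBounded_ellBall (𝕜 := 𝕜) hG (1 / 4)).union
      (isBounded_ellBall (𝕜 := 𝕜) (hf S hS) 1)).subset ?_
    rintro _ ⟨g, hg, rfl⟩
    by_cases hgG : g ∈ G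
    · simp only [b, if_pos hgG]; exact Or.inl (h1 g hgG)
    · simp only [b, if_neg hgG]; exact Or.inr (delta_mem ⟨g, hg, rfl⟩)
  refine ⟨Ell1.lift b hb, LinearMap.congr_fun (Ell1.hom_ext (evalSum 𝕜 V ∘ₗ Ell1.lift b hb)
    (f ∘ₗ evalSum 𝕜 V) (isBdd_evalSum.comp (Ell1.isBdd_lift _ _)) (hf.comp isBdd_evalSum)
    fun g => ?_), fun C hC ζ hζ => ?_⟩
  · simp only [LinearMap.comp_apply, Ell1.lift_delta, evalSum_delta]
    by_cases hgG : g ∈ G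
    · simp only [b, if_pos hgG, h2 g hgG]
    · simp only [b, if_neg hgG, evalSum_delta]
  · have := ellBall_ball hG hb hC (by norm_num : (0 : ℝ) < 1 / 4) hζ fun g hg => by
      simp only [b, if_pos hg]; exact h1 g hg
    convert this using 2
    ring

/-- The Neumann series: for a contractive `f`, the equation `x - f x = m` has a solution which is
bounded in terms of `m`. -/
lemma exists_sub_eq {f : V →ₗ[𝕜] V} (hf : IsBdd f) {G : Set V} (hG : IsBounded G)
    (h : ∀ g ∈ G, ∃ η ∈ ellBall (𝕜 := 𝕜) G (1 / 4), evalSum 𝕜 V η = f g) {m : V} (hm : m ∈ G) :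
    ∃ ζ ∈ ellBall (𝕜 := 𝕜) G 3, evalSum 𝕜 V ζ - f (evalSum 𝕜 V ζ) = m := by
  obtain ⟨F, hF, hF'⟩ := exists_lift_contraction hf hG h
  have hpow : ∀ n : ℕ, (F ^ n) (delta m) ∈ ellBall G ((1 / 2 : ℝ) ^ n) := by
    intro n
    induction n with
    | zero => simpa using delta_mem hm
    | succ n ih =>
      rw [pow_succ' F, Module.End.mul_apply]
      convert hF' _ (by positivity) _ ih using 2
      ring
  -- The series is summed upstairs, where the unit ball of `ℓ¹(G)` is completant, so `G` itself need
  -- be neither a disc nor completant.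
  let x : ℕ → Ell1 𝕜 V := fun n => ∑ k ∈ Finset.range n, (F ^ k) (delta m)
  have hdiff : ∀ k n, x (n + k) - x n ∈ ellBall G ((2 : ℝ) * (1 / 2) ^ n) := by
    intro k
    induction k with
    | zero =>
      intro n
      simp only [add_zero, sub_self]
      exact ⟨by simp, by simp⟩
    | succ k ih =>
      intro n
      have h1 := add_mem_ellBall (ih (n + 1)) (hpow n)
      have e : x (n + (k + 1)) - x n = x (n + 1 + k) - x (n + 1) + (F ^ n) (delta m) := by
        have : x (n + 1) = x n + (F ^ n) (delta m) := Finset.sum_range_succ _ _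
        rw [this, show n + (k + 1) = n + 1 + k by ring]; abel
      rw [e]
      convert h1 using 2
      ring
  have hd1 := isCompletant_ellBall (𝕜 := 𝕜) hG one_pos
  have hlim : ∀ ε : ℝ, 0 < ε → ∃ N : ℕ, ∀ n ≥ N, (1 / 2 : ℝ) ^ n ≤ ε := by
    intro ε hε
    obtain ⟨N, hN⟩ := exists_pow_lt_of_lt_one hε (by norm_num : (1 / 2 : ℝ) < 1)
    exact ⟨N, fun n hn => (pow_le_pow_of_le_one (by norm_num) (by norm_num) hn).trans hN.le⟩
  obtain ⟨ζ, hζ⟩ := hd1.complete x (by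
    intro ε hε
    obtain ⟨N, hN⟩ := hlim (ε / 4) (by positivity)
    refine ⟨N, fun a ha b hb => ?_⟩
    obtain ⟨a, rfl⟩ := Nat.exists_eq_add_of_le ha
    obtain ⟨b, rfl⟩ := Nat.exists_eq_add_of_le hb
    rw [mem_smul_ellBall hε, mul_one]
    have := sub_mem_ellBall (hdiff a N) (hdiff b N)
    rw [sub_sub_sub_cancel_right] at this
    refine ellBall_mono subset_rfl ?_ this
    have := hN N le_rfl
    linarith)
  -- The radius 3 is 2 for a partial sum plus 1 for its distance to the limit.
  refine ⟨ζ, ?_, ?_⟩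
  · obtain ⟨N, hN⟩ := hζ 1 one_pos
    have h1 := hN N le_rfl
    rw [mem_smul_ellBall one_pos, mul_one] at h1
    have h2 := hdiff N 0
    have h3 := sub_mem_ellBall h2 h1
    have e : x (0 + N) - x 0 - (x N - ζ) = ζ := by
      simp [x]
    rw [e] at h3
    refine ellBall_mono subset_rfl ?_ h3
    norm_num
  · let φ : Ell1 𝕜 V →ₗ[𝕜] V := evalSum 𝕜 V - f ∘ₗ evalSum 𝕜 V
    obtain ⟨E, h1, h2, h3, h4⟩ := exists_disc₂ (𝕜 := 𝕜)
      (isBdd_evalSum _ (isBounded_ellBall (𝕜 := 𝕜) hG 1))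
      ((hf.comp isBdd_evalSum) _ (isBounded_ellBall (𝕜 := 𝕜) hG 1))
    have hsm : ∀ ε : ℝ, 0 < ε → ∀ η ∈ ellBall (𝕜 := 𝕜) G ε,
        evalSum 𝕜 V η ∈ (ε : 𝕜) • E ∧ f (evalSum 𝕜 V η) ∈ (ε : 𝕜) • E := by
      intro ε hε η hη
      rw [← mul_one ε, ← mem_smul_ellBall hε] at hη
      obtain ⟨η, hη, rfl⟩ := hη
      simp only [map_smul]
      exact ⟨smul_mem_smul_set (h1 ⟨η, hη, rfl⟩), smul_mem_smul_set (h2 ⟨η, hη, rfl⟩)⟩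
    -- The telescoping identity. In the limit there remain three errors of size `ε / 3`: two from
    -- replacing `x n` by `ζ` and one from the last power.
    have hφx : ∀ n, φ (x n) = m - evalSum 𝕜 V ((F ^ n) (delta m)) := by
      intro n
      induction n with
      | zero => simp [x]
      | succ n ih =>
        have : x (n + 1) = x n + (F ^ n) (delta m) := Finset.sum_range_succ _ _
        rw [this, map_add, ih, pow_succ' F, Module.End.mul_apply, hF]
        simp [φ]
    rw [← sub_eq_zero]
    refine h4.norming _ fun ε hε => ?_
    obtain ⟨N, hN⟩ := hζ (ε / 3) (by positivity)
    obtain ⟨N', hN'⟩ := hlim (ε / 3) (by positivity)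
    set n := max N N'
    have a1 := hN n (le_max_left _ _)
    rw [mem_smul_ellBall (by positivity), mul_one] at a1
    have a2 := hsm _ (by positivity) _ a1
    have a3 := (hsm _ (by positivity) _ (ellBall_mono subset_rfl (hN' n (le_max_right _ _))
      (hpow n))).1
    have a4 := h4.toIsDisc.sub_smul (by positivity) (by positivity) a2.2 a2.1
    have a5 := h4.toIsDisc.sub_smul (by positivity) (by positivity) a4 a3
    have e : evalSum 𝕜 V ζ - f (evalSum 𝕜 V ζ) - m = f (evalSum 𝕜 V (x n - ζ)) -
        evalSum 𝕜 V (x n - ζ) - evalSum 𝕜 V ((F ^ n) (delta m)) := by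
      have := hφx n
      simp only [φ, LinearMap.sub_apply, LinearMap.comp_apply] at this
      rw [show evalSum 𝕜 V ((F ^ n) (delta m)) = m - (evalSum 𝕜 V (x n) - f (evalSum 𝕜 V (x n))) by
        rw [this]; abel]
      simp only [map_sub]
      abel
    rw [e]
    convert a5 using 2
    push_cast
    ring

/-- A fixed vector is represented by every `(F ^ n) (delta m)`, whose `ℓ¹` norm is at most `2⁻ⁿ`, so
it is arbitrarily small with respect to one bounded set. -/
lemma eq_zero_of_contractive {f : V →ₗ[𝕜] V} (hf : IsBdd f) (h : IsContractive f) {m : V}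
    (hm : f m = m) : m = 0 := by
  obtain ⟨G, h1, hG, h2⟩ := h {m} isBounded_singleton
  obtain ⟨F, hF, hF'⟩ := exists_lift_contraction hf hG h2
  refine eq_zero_of_small 𝕜 (isBdd_evalSum _ (isBounded_ellBall (𝕜 := 𝕜) hG 1)) fun ε hε => ?_
  have hpow : ∀ n : ℕ, (F ^ n) (delta m) ∈ ellBall G ((1 / 2 : ℝ) ^ n) ∧
      evalSum 𝕜 V ((F ^ n) (delta m)) = m := by
    intro n
    induction n with
    | zero => exact ⟨by simpa using delta_mem (h1 rfl), by simp⟩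
    | succ n ih =>
      rw [pow_succ' F, Module.End.mul_apply]
      refine ⟨?_, by rw [hF, ih.2, hm]⟩
      convert hF' _ (by positivity) _ ih.1 using 2
      ring
  obtain ⟨n, hn⟩ := exists_pow_lt_of_lt_one hε (by norm_num : (1 / 2 : ℝ) < 1)
  have h3 := ellBall_mono subset_rfl hn.le (hpow n).1
  rw [← mul_one ε, ← mem_smul_ellBall hε] at h3
  obtain ⟨η, hη, e⟩ := h3
  refine ⟨_, ⟨η, hη, rfl⟩, ?_⟩
  simp only at e ⊢
  rw [← map_smul, e, (hpow n).2]

/-- If `f` is contractive then `1 - f` has a bounded inverse. -/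
theorem exists_inverse_of_contractive {f : V →ₗ[𝕜] V} (hf : IsBdd f) (h : IsContractive f) :
    ∃ w : V →ₗ[𝕜] V, IsBdd w ∧ (∀ m, w m - f (w m) = m) ∧ ∀ m, w (m - f m) = m := by
  have hinj : Function.Injective (LinearMap.id - f : V →ₗ[𝕜] V) := by
    rw [injective_iff_map_eq_zero]
    intro m hm
    exact eq_zero_of_contractive hf h (sub_eq_zero.1 hm).symm
  have hsurj : Function.Surjective (LinearMap.id - f : V →ₗ[𝕜] V) := by
    intro m
    obtain ⟨G, h1, hG, h2⟩ := h {m} isBounded_singleton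
    obtain ⟨ζ, -, hζ⟩ := exists_sub_eq hf hG h2 (h1 rfl)
    exact ⟨_, hζ⟩
  let e := LinearEquiv.ofBijective (LinearMap.id - f : V →ₗ[𝕜] V) ⟨hinj, hsurj⟩
  refine ⟨e.symm, ?_, fun m => e.apply_symm_apply m, fun m => e.symm_apply_apply m⟩
  -- The set `G` and the radius 3 depend on `U` only, so the solutions are bounded uniformly for `m
  -- ∈ U`.
  intro U hU
  obtain ⟨G, h1, hG, h2⟩ := h U hU
  refine (isBdd_evalSum _ (isBounded_ellBall (𝕜 := 𝕜) hG 3)).subset ?_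
  rintro _ ⟨m, hm, rfl⟩
  obtain ⟨ζ, hζ, h3⟩ := exists_sub_eq hf hG h2 (h1 hm)
  refine ⟨ζ, hζ, ?_⟩
  exact (e.symm_apply_eq.2 h3.symm).symm

end Neumann

end Borno

end

noncomputable section

namespace Borno

open CategoryTheory Limits

set_option linter.unusedSectionVars false

/-! ### Complexes over an additive category: moving objects into a class closed under sums and
retracts. -/

section Perfect

variable {C : Type*} [Category C] [Preadditive C]

/-- A class of objects that contains the zero objects and is closed under sums and retracts. -/
structure IsAdditiveClass [HasBinaryBiproducts C] (P : C → Prop) : Prop where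
  zero : ∀ X, IsZero X → P X
  biprod : ∀ X Y, P X → P Y → P (X ⊞ Y)
  retract : ∀ {X Y : C} (i : X ⟶ Y) (r : Y ⟶ X), i ≫ r = 𝟙 X → P Y → P X

/-- Maps that factor through an object of the class `P`. -/
def FactorsThrough (P : C → Prop) {X Y : C} (f : X ⟶ Y) : Prop :=
  ∃ Z, P Z ∧ ∃ (a : X ⟶ Z) (b : Z ⟶ Y), a ≫ b = f

namespace FactorsThrough

variable {P : C → Prop}

lemma of_mem {X Y Z : C} (h : P Z) (a : X ⟶ Z) (b : Z ⟶ Y) : FactorsThrough P (a ≫ b) :=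
  ⟨Z, h, a, b, rfl⟩

lemma comp_left {X Y Z : C} {f : Y ⟶ Z} (hf : FactorsThrough P f) (k : X ⟶ Y) :
    FactorsThrough P (k ≫ f) := by
  obtain ⟨W, h, a, b, rfl⟩ := hf
  exact ⟨W, h, k ≫ a, b, by simp⟩

lemma comp_right {X Y Z : C} {f : X ⟶ Y} (hf : FactorsThrough P f) (k : Y ⟶ Z) :
    FactorsThrough P (f ≫ k) := by
  obtain ⟨W, h, a, b, rfl⟩ := hf
  exact ⟨W, h, a, b ≫ k, by simp⟩

lemma neg {X Y : C} {f : X ⟶ Y} (hf : FactorsThrough P f) : FactorsThrough P (-f) := by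
  obtain ⟨W, h, a, b, rfl⟩ := hf
  exact ⟨W, h, -a, b, by simp⟩

variable [HasBinaryBiproducts C] (hP : IsAdditiveClass P)

include hP

lemma add {X Y : C} {f g : X ⟶ Y} (hf : FactorsThrough P f) (hg : FactorsThrough P g) :
    FactorsThrough P (f + g) := by
  obtain ⟨W, h, a, b, rfl⟩ := hf
  obtain ⟨W', h', a', b', rfl⟩ := hg
  exact ⟨W ⊞ W', hP.biprod _ _ h h', biprod.lift a a', biprod.desc b b', by simp⟩

lemma sub {X Y : C} {f g : X ⟶ Y} (hf : FactorsThrough P f) (hg : FactorsThrough P g) :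
    FactorsThrough P (f - g) := by
  rw [sub_eq_add_neg]
  exact hf.add hP hg.neg

lemma sum [HasZeroObject C] {X Y : C} {ι : Type*} (F : Finset ι) (f : ι → (X ⟶ Y))
    (hf : ∀ i ∈ F, FactorsThrough P (f i)) : FactorsThrough P (∑ i ∈ F, f i) := by
  classical
  induction F using Finset.induction_on with
  | empty => exact ⟨_, hP.zero _ (isZero_zero C), 0, 0, by simp⟩
  | insert i F hi ih =>
    rw [Finset.sum_insert hi]
    exact (hf i (Finset.mem_insert_self _ _)).add hP
      (ih fun j hj => hf j (Finset.mem_insert_of_mem hj))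

lemma mem_of_id {X : C} (h : FactorsThrough P (𝟙 X)) : P X := by
  obtain ⟨Z, hZ, a, b, e⟩ := h
  exact hP.retract a b e hZ

end FactorsThrough

/-- The null homotopic endomorphism given by a single map `σ` from degree `c` to degree `c - 1`. -/
lemma exists_nullHomotopic (N : CochainComplex C ℤ) (b c : ℤ) (hbc : b + 1 = c)
    (σ : N.X c ⟶ N.X b) : ∃ k : N ⟶ N, Nonempty (Homotopy k 0) ∧ k.f c = σ ≫ N.d b c ∧
      k.f b = N.d b c ≫ σ ∧ ∀ i, i ≠ b → i ≠ c → k.f i = 0 := by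
  classical
  -- The family is `σ` at `(c, b)` and zero elsewhere; updating a function of pairs avoids transport
  -- along equalities of degrees.
  let H : ∀ i j, N.X i ⟶ N.X j := fun i j =>
    Function.update (β := fun p : ℤ × ℤ => (N.X p.1 ⟶ N.X p.2)) (fun _ => 0) (c, b) σ (i, j)
  have H1 : H c b = σ := Function.update_self (β := fun p : ℤ × ℤ => (N.X p.1 ⟶ N.X p.2)) _ _ _
  have H2 : ∀ i j, (i ≠ c ∨ j ≠ b) → H i j = 0 := fun i j hij =>
    Function.update_of_ne (β := fun p : ℤ × ℤ => (N.X p.1 ⟶ N.X p.2))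
      (by simp only [ne_eq, Prod.mk.injEq]; tauto) _ _
  let k := Homotopy.nullHomotopicMap H
  have hf : ∀ i, k.f i = N.d i (i + 1) ≫ H (i + 1) i + H i (i - 1) ≫ N.d (i - 1) i := by
    intro i
    change dNext i H + prevD i H = _
    rw [dNext_eq H (show (ComplexShape.up ℤ).Rel i (i + 1) from rfl),
      prevD_eq H (show (ComplexShape.up ℤ).Rel (i - 1) i by simp)]
  refine ⟨k, ⟨Homotopy.nullHomotopy H fun i j hij => H2 i j (by
    simp only [ComplexShape.up_Rel] at hij
    omega)⟩, ?_, ?_, fun i hb hc => ?_⟩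
  · rw [hf, H2 (c + 1) c (by omega)]
    obtain rfl : b = c - 1 := by omega
    simp [H1]
  · subst hbc
    rw [hf, H2 b (b - 1) (by omega)]
    simp [H1]
  · rw [hf, H2 i (i - 1) (by omega), H2 (i + 1) i (by omega)]
    simp

/-- If `σ d σ = σ` for some `σ` from degree `c` to degree `c - 1`, then the contractible summand
`σ d ⟶ d σ` of a complex can be removed. -/
lemma exists_remove_summand [IsIdempotentComplete C] (N : CochainComplex C ℤ) (b c : ℤ)
    (hbc : b + 1 = c) (σ : N.X c ⟶ N.X b) (hσ : σ ≫ N.d b c ≫ σ = σ) :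
    ∃ (N' : CochainComplex C ℤ) (i : N' ⟶ N) (r : N ⟶ N'), i ≫ r = 𝟙 N' ∧
      r.f c ≫ i.f c = 𝟙 (N.X c) - σ ≫ N.d b c ∧ Nonempty (HomotopyEquiv N N') := by
  -- This `k` is a null homotopic idempotent chain map, so the image of `1 - k` is a direct summand
  -- with the same homotopy type.
  obtain ⟨k, ⟨hk⟩, hkc, hkb, hk0⟩ := exists_nullHomotopic N b c hbc σ
  have hkk : k ≫ k = k := by
    ext i
    rw [HomologicalComplex.comp_f]
    by_cases hi : i = c
    · subst hi
      rw [hkc, Category.assoc, ← Category.assoc (N.d b i), ← Category.assoc σ, hσ]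
    by_cases hi' : i = b
    · subst hi'
      rw [hkb, Category.assoc, hσ]
    · rw [hk0 i hi' hi, zero_comp]
  obtain ⟨N', i, r, h1, h2⟩ := IsIdempotentComplete.idempotents_split N (𝟙 N - k) (by
    simp [Preadditive.sub_comp, Preadditive.comp_sub, hkk])
  refine ⟨N', i, r, h1, by rw [← HomologicalComplex.comp_f, h2]; simp [hkc],
    ⟨⟨r, i, ?_, Homotopy.ofEq h1⟩⟩⟩
  refine (Homotopy.ofEq h2).trans ?_
  have := (Homotopy.refl (𝟙 N)).add (hk.compRight (-𝟙 N))
  refine (Homotopy.ofEq ?_).trans (this.trans (Homotopy.ofEq ?_))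
  · simp [sub_eq_add_neg]
  · simp

variable [HasZeroObject C] [HasBinaryBiproducts C] {P : C → Prop}

/-- A complex is homotopy equivalent to its sum with the contractible complex `F ⟶ F`. -/
lemma exists_add_disk (hP : IsAdditiveClass P) (M : CochainComplex C ℤ) (b c : ℤ)
    (hbc : b + 1 = c) (F : C) (hF : P F) :
    ∃ (N : CochainComplex C ℤ) (p : N ⟶ M) (i : M ⟶ N) (u : F ⟶ N.X b) (v : N.X c ⟶ F),
      i ≫ p = 𝟙 M ∧ u ≫ N.d b c ≫ p.f c = 0 ∧ u ≫ N.d b c ≫ v = 𝟙 F ∧ i.f c ≫ v = 0 ∧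
      𝟙 (N.X c) = p.f c ≫ i.f c + v ≫ u ≫ N.d b c ∧
      (∀ j, P (M.X j) → P (N.X j)) ∧
      (∀ j, j ≠ b → j ≠ c → IsZero (M.X j) → IsZero (N.X j)) ∧
      Nonempty (HomotopyEquiv M N) := by
  have hne : b ≠ c := by omega
  have hrel : (ComplexShape.up ℤ).Rel b c := hbc
  let D := HomologicalComplex.double (𝟙 F) hrel
  let x := HomologicalComplex.doubleXIso₀ (𝟙 F) hrel
  let y := HomologicalComplex.doubleXIso₁ (𝟙 F) hrel hne
  have hd : D.d b c = x.hom ≫ y.inv := by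
    simpa using HomologicalComplex.double_d (𝟙 F) hrel hne
  -- For the inverse of the differential as `σ`, the null homotopic map is the identity: the disk is
  -- contractible.
  obtain ⟨k, ⟨hk⟩, hkc, hkb, -⟩ := exists_nullHomotopic D b c hbc (y.hom ≫ x.inv)
  have hk1 : k = 𝟙 D := HomologicalComplex.to_double_hom_ext
    (by rw [hkb, hd]; simp) (by rw [hkc, hd]; simp)
  have htot : ∀ j, 𝟙 ((M ⊞ D).X j) = (biprod.fst : M ⊞ D ⟶ M).f j ≫ (biprod.inl : M ⟶ M ⊞ D).f j +
      (biprod.snd : M ⊞ D ⟶ D).f j ≫ (biprod.inr : D ⟶ M ⊞ D).f j := fun j => by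
    rw [← HomologicalComplex.comp_f, ← HomologicalComplex.comp_f, ← HomologicalComplex.add_f_apply,
      biprod.total, HomologicalComplex.id_f]
  have hDP : ∀ j, P (D.X j) := by
    intro j
    by_cases hb : j = b
    · subst hb
      exact hP.retract x.hom x.inv x.hom_inv_id hF
    by_cases hc : j = c
    · subst hc
      exact hP.retract y.hom y.inv y.hom_inv_id hF
    · exact hP.zero _ (HomologicalComplex.isZero_double_X _ _ _ hb hc)
  have hc1 : ∀ {X Y Z : CochainComplex C ℤ} (f : X ⟶ Y) (g : Y ⟶ Z) (h : X ⟶ Z) (j : ℤ),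
      f ≫ g = h → f.f j ≫ g.f j = h.f j := fun f g h j e => by
    rw [← HomologicalComplex.comp_f, e]
  have hur : x.inv ≫ (biprod.inr : D ⟶ M ⊞ D).f b ≫ (M ⊞ D).d b c =
      y.inv ≫ (biprod.inr : D ⟶ M ⊞ D).f c := by
    rw [HomologicalComplex.Hom.comm, hd]
    simp
  refine ⟨M ⊞ D, biprod.fst, biprod.inl, x.inv ≫ (biprod.inr : D ⟶ M ⊞ D).f b,
    (biprod.snd : M ⊞ D ⟶ D).f c ≫ y.hom, biprod.inl_fst, ?_, ?_, ?_, ?_, fun j hj => ?_,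
    fun j hb hc hj => ?_, ?_⟩
  · simp only [Category.assoc]
    rw [reassoc_of% hur, hc1 _ _ _ c biprod.inr_fst]
    simp
  · simp only [Category.assoc]
    rw [reassoc_of% hur, ← Category.assoc ((biprod.inr : D ⟶ M ⊞ D).f c),
      hc1 _ _ _ c biprod.inr_snd]
    simp
  · rw [← Category.assoc, hc1 _ _ _ c biprod.inl_snd]
    simp
  · simp only [Category.assoc]
    rw [hur, htot]
    simp
  -- The biproduct is taken in the category of complexes; its object in degree `j` is compared with
  -- the biproduct of the objects by a retraction.
  · refine hP.retract (biprod.lift ((biprod.fst : M ⊞ D ⟶ M).f j) ((biprod.snd : M ⊞ D ⟶ D).f j))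
      (biprod.desc ((biprod.inl : M ⟶ M ⊞ D).f j) ((biprod.inr : D ⟶ M ⊞ D).f j)) ?_
      (hP.biprod _ _ hj (hDP j))
    rw [biprod.lift_desc, ← htot]
  · have hD := HomologicalComplex.isZero_double_X (𝟙 F) hrel j hb hc
    rw [IsZero.iff_id_eq_zero, htot, hj.eq_of_tgt ((biprod.fst : M ⊞ D ⟶ M).f j) 0,
      hD.eq_of_tgt ((biprod.snd : M ⊞ D ⟶ D).f j) 0]
    simp
  · subst hk1
    refine ⟨⟨biprod.inl, biprod.fst, Homotopy.ofEq biprod.inl_fst, ?_⟩⟩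
    have h1 := ((hk.symm.compRight (biprod.inr : D ⟶ M ⊞ D)).compLeft (biprod.snd : M ⊞ D ⟶ D))
    have h2 := (Homotopy.refl ((biprod.fst : M ⊞ D ⟶ M) ≫ biprod.inl)).add h1
    refine (Homotopy.ofEq ?_).trans (h2.trans (Homotopy.ofEq ?_))
    · simp
    · simp [biprod.total]

/-- An object of a complex can be moved into the class `P` if its identity is homotopic to a map
that factors through `P`. -/
lemma exists_improve [IsIdempotentComplete C] (hP : IsAdditiveClass P) (M : CochainComplex C ℤ)
    (b c : ℤ) (hbc : b + 1 = c) (h : M.X c ⟶ M.X b)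
    (hh : FactorsThrough P (𝟙 (M.X c) - h ≫ M.d b c)) :
    ∃ N : CochainComplex C ℤ, P (N.X c) ∧ (∀ j, P (M.X j) → P (N.X j)) ∧
      (∀ j, j ≠ b → j ≠ c → IsZero (M.X j) → IsZero (N.X j)) ∧ Nonempty (HomotopyEquiv M N) := by
  obtain ⟨F, hF, α, β, hαβ⟩ := hh
  obtain ⟨N, p, i, u, v, e1, e2, e3, e4, e5, hN1, hN2, ⟨hN3⟩⟩ :=
    exists_add_disk hP M b c hbc F hF
  have e1' : i.f c ≫ p.f c = 𝟙 _ := by rw [← HomologicalComplex.comp_f, e1]; simp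
  -- The maps `q` and `s` use the added copy of `F` to absorb the defect `𝟙 - h d = α β`: the
  -- composite `s d q` is `h d + α β = 𝟙`. Hence `σ = q s` satisfies `σ d σ = σ`.
  let q : N.X c ⟶ M.X c := p.f c + v ≫ β
  let s : M.X c ⟶ N.X b := h ≫ i.f b + α ≫ u
  have hsd : s ≫ N.d b c = h ≫ M.d b c ≫ i.f c + α ≫ u ≫ N.d b c := by
    simp [s, Preadditive.add_comp]
  have hsq : s ≫ N.d b c ≫ q = 𝟙 _ := by
    rw [← Category.assoc, hsd]
    simp only [q, Preadditive.add_comp, Preadditive.comp_add, Category.assoc, e1', e2,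
      reassoc_of% e3, reassoc_of% e4, hαβ]
    simp
  obtain ⟨N', i', r', f1, f2, ⟨f3⟩⟩ := exists_remove_summand N b c hbc (q ≫ s) (by
    simp only [Category.assoc]
    rw [reassoc_of% hsq])
  have f1' : ∀ j, i'.f j ≫ r'.f j = 𝟙 _ := fun j => by
    rw [← HomologicalComplex.comp_f, f1]; simp
  refine ⟨N', ?_, fun j hj => hP.retract _ _ (f1' j) (hN1 j hj), fun j hb hc hj => ?_,
    ⟨hN3.trans f3⟩⟩
  · refine FactorsThrough.mem_of_id hP ?_
    -- What is left in degree `c` is the image of `𝟙 - q s d`, so it suffices that this idempotent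
    -- factors through the class; in `e'` below every term passes through `F`.
    have e : 𝟙 (N'.X c) = i'.f c ≫ (r'.f c ≫ i'.f c) ≫ r'.f c := by
      rw [Category.assoc, f1', Category.comp_id, f1']
    rw [e, f2]
    refine (FactorsThrough.comp_right ?_ _).comp_left _
    have e' : 𝟙 (N.X c) - (q ≫ s) ≫ N.d b c = p.f c ≫ (𝟙 (M.X c) - h ≫ M.d b c) ≫ i.f c +
        v ≫ (u ≫ N.d b c - β ≫ s ≫ N.d b c) - (p.f c ≫ α) ≫ u ≫ N.d b c := by
      rw [Category.assoc, hsd, e5]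
      simp only [q, Preadditive.add_comp, Preadditive.comp_add, Preadditive.sub_comp,
        Preadditive.comp_sub, Category.assoc, Category.id_comp]
      abel
    rw [e']
    refine ((((FactorsThrough.comp_right ⟨F, hF, α, β, hαβ⟩ _).comp_left _).add hP
      (.of_mem hF _ _)).sub hP (.of_mem hF _ _))
  · have := hN2 j hb hc hj
    rw [IsZero.iff_id_eq_zero, ← f1' j, this.eq_of_tgt (i'.f j) 0, zero_comp]

/-- Let `J` be an ideal of maps such that `1 - g` is left invertible modulo maps that factor
through `P`, for each endomorphism `g` in `J`. A bounded complex whose identity is homotopic to a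
map in `J` is homotopy equivalent to a bounded complex of objects of `P`. -/
theorem exists_homotopyEquiv_of_homotopic [IsIdempotentComplete C] (hP : IsAdditiveClass P)
    (J : ∀ {X Y : C}, (X ⟶ Y) → Prop)
    (hJl : ∀ {X Y Z : C} (f : X ⟶ Y) (g : Y ⟶ Z), J f → J (f ≫ g))
    (hJr : ∀ {X Y Z : C} (f : X ⟶ Y) (g : Y ⟶ Z), J g → J (f ≫ g))
    (hJ : ∀ {X : C} (g : X ⟶ X), J g → ∃ w : X ⟶ X, FactorsThrough P (𝟙 X - w ≫ (𝟙 X - g)))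
    (T : Finset ℤ) (M : CochainComplex C ℤ) (hT : ∀ i, i ∉ T → P (M.X i)) (n : ℕ)
    (hM : ∀ i : ℤ, (n : ℤ) < |i| → IsZero (M.X i)) (g : M ⟶ M) (hg : ∀ i, J (g.f i))
    (h : Homotopy (𝟙 M) g) :
    ∃ (Q : CochainComplex C ℤ) (m : ℕ), (∀ i : ℤ, (m : ℤ) < |i| → IsZero (Q.X i)) ∧
      (∀ i, P (Q.X i)) ∧ Nonempty (HomotopyEquiv M Q) := by
  -- `T` contains the degrees not yet known to lie in the class. Treating the largest one first
  -- makes the object one degree above it already good.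
  induction T using Finset.strongInduction generalizing M n with
  | H T ih =>
    rcases T.eq_empty_or_nonempty with rfl | hne
    · exact ⟨M, n, hM, fun i => hT i (by simp), ⟨HomotopyEquiv.refl M⟩⟩
    set c := T.max' hne with hc
    have hc1 : P (M.X (c + 1)) := hT _ fun hmem => by
      have := T.le_max' _ hmem
      omega
    obtain ⟨w, hw⟩ := hJ _ (hg c)
    obtain ⟨N, hN1, hN2, hN3, ⟨e⟩⟩ := exists_improve hP M (c - 1) c (by omega)
      (w ≫ h.hom c (c - 1)) (by
        have h1 : 𝟙 (M.X c) - g.f c = M.d c (c + 1) ≫ h.hom (c + 1) c +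
            h.hom c (c - 1) ≫ M.d (c - 1) c := by
          have := h.comm c
          rw [dNext_eq h.hom (show (ComplexShape.up ℤ).Rel c (c + 1) from rfl),
            prevD_eq h.hom (show (ComplexShape.up ℤ).Rel (c - 1) c by simp)] at this
          rw [sub_eq_iff_eq_add, ← this, HomologicalComplex.id_f]
        -- Of the two terms of `𝟙 - g = d h + h d`, the first passes through the good object in
        -- degree `c + 1`, so only the second matters modulo the class.
        have h2 : 𝟙 (M.X c) - (w ≫ h.hom c (c - 1)) ≫ M.d (c - 1) c =
            (𝟙 (M.X c) - w ≫ (𝟙 (M.X c) - g.f c)) +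
              (w ≫ M.d c (c + 1)) ≫ h.hom (c + 1) c := by
          rw [h1]
          simp only [Preadditive.comp_add, Category.assoc]
          abel
        rw [h2]
        exact hw.add hP (.of_mem hc1 _ _))
    obtain ⟨Q, m, hQ1, hQ2, ⟨e'⟩⟩ := ih (T.erase c) (Finset.erase_ssubset (T.max'_mem hne)) N
      (fun i hi => by
        by_cases hic : i = c
        · rw [hic]; exact hN1
        · exact hN2 i (hT i fun hmem => hi (Finset.mem_erase.2 ⟨hic, hmem⟩)))
      -- The added disk can make the complex nonzero in degrees `c - 1` and `c`; the new bound
      -- covers both.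
      (n + (c.natAbs + 1))
      (fun i hi => by
        push_cast at hi
        have h3 := abs_nonneg c
        refine hN3 i ?_ ?_ (hM i (by omega))
        · rintro rfl
          have := abs_sub c 1
          have : |(1 : ℤ)| = 1 := abs_one
          omega
        · rintro rfl
          omega)
      -- Since `J` is an ideal, the hypothesis on `g` passes along the homotopy equivalence to the
      -- new complex.
      (e.inv ≫ g ≫ e.hom) (fun i => by
        rw [HomologicalComplex.comp_f, HomologicalComplex.comp_f]
        exact hJr _ _ (hJl _ _ (hg i)))
      (e.homotopyInvHomId.symm.trans ((Homotopy.ofEq (by simp)).trans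
        ((h.compRight e.hom).compLeft e.inv)))
    exact ⟨Q, m, hQ1, hQ2, ⟨e.trans e'⟩⟩

end Perfect

end Borno

end

noncomputable section

namespace Borno

open Set Bornology CategoryTheory Limits
open scoped Pointwise

universe u

set_option linter.unusedSectionVars false

/-! ### Calculus of bounded maps, and completeness of closed subspaces. -/

section Bounded

variable {V W X : Type*} [Bornology V] [Bornology W] [Bornology X]

lemma isBdd_const (w : W) : IsBdd fun _ : V => w := fun S _ =>
  isBounded_singleton.subset (by rintro _ ⟨x, -, rfl⟩; exact mem_singleton w)

lemma IsBdd₂.comp {I : Type*} [Bornology I] {b : V → W → X} (hb : IsBdd₂ b)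
    {f : I → V} {g : I → W} (hf : IsBdd f) (hg : IsBdd g) :
    IsBdd fun i => b (f i) (g i) := fun S hS =>
  (hb _ _ (hf S hS) (hg S hS)).subset
    (by rintro _ ⟨x, hx, rfl⟩; exact ⟨_, ⟨x, hx, rfl⟩, _, ⟨x, hx, rfl⟩, rfl⟩)

lemma isBdd₂_of_isBdd {b : V → W → X}
    (h : IsBdd fun q : V × W => b q.1 q.2) : IsBdd₂ b := fun S T hS hT =>
  (h _ (hS.prod hT)).subset (by
    rintro _ ⟨v, hv, w, hw, rfl⟩
    exact ⟨(v, w), ⟨hv, hw⟩, rfl⟩)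

lemma isBdd_fst : IsBdd (Prod.fst : V × W → V) :=
  fun _ hS => IsBounded.image_fst hS

lemma isBdd_snd : IsBdd (Prod.snd : V × W → W) :=
  fun _ hS => IsBounded.image_snd hS

lemma isBdd_prodMk {f : V → W} {g : V → X} (hf : IsBdd f) (hg : IsBdd g) :
    IsBdd fun x => (f x, g x) := fun S hS =>
  ((hf S hS).prod (hg S hS)).subset
    (by rintro _ ⟨x, hx, rfl⟩; exact ⟨⟨x, hx, rfl⟩, ⟨x, hx, rfl⟩⟩)

lemma isBdd_pi {ι : Type*} {f : V → ι → W} (hf : ∀ i, IsBdd fun x => f x i) : IsBdd f := by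
  intro S hS
  rw [← forall_isBounded_image_eval_iff]
  intro i
  rw [image_image]
  exact hf i S hS

lemma isBdd_eval {ι : Type*} (i : ι) : IsBdd fun x : ι → W => x i := fun _ hS =>
  forall_isBounded_image_eval_iff.2 hS i

end Bounded

section BoundedLinear

variable {𝕜 : Type} [RCLike 𝕜] {V W : Type*} [Bornology V] [AddCommGroup W] [Module 𝕜 W]
  [Bornology W]

lemma isBdd_add' [CompleteBVS 𝕜 W] {f g : V → W} (hf : IsBdd f) (hg : IsBdd g) :
    IsBdd fun x => f x + g x := fun S hS =>
  (CompleteBVS.add (𝕜 := 𝕜) _ _ (hf S hS) (hg S hS)).subset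
    (by rintro _ ⟨x, hx, rfl⟩; exact ⟨_, ⟨x, hx, rfl⟩, _, ⟨x, hx, rfl⟩, rfl⟩)

lemma isBdd_sum [CompleteBVS 𝕜 W] {ι : Type*} (F : Finset ι) {f : ι → V → W}
    (hf : ∀ i ∈ F, IsBdd (f i)) : IsBdd fun x => ∑ i ∈ F, f i x := by
  classical
  induction F using Finset.induction_on with
  | empty => simpa using isBdd_const (V := V) (0 : W)
  | insert i F hi ih =>
    simp only [Finset.sum_insert hi]
    exact isBdd_add' (𝕜 := 𝕜) (hf i (Finset.mem_insert_self _ _))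
      (ih fun j hj => hf j (Finset.mem_insert_of_mem hj))

/-- Closed subspaces of complete spaces are complete. -/
lemma completeBVS_of_isBClosed {V : Type u} [AddCommGroup V] [Module 𝕜 V] [Bornology V]
    [CompleteBVS 𝕜 V] (p : Submodule 𝕜 V) (hp : IsBClosed p) : CompleteBVS 𝕜 p where
  add S T hS hT := by
    rw [← isBounded_image_subtype_val] at *
    refine (CompleteBVS.add (𝕜 := 𝕜) _ _ hS hT).subset ?_
    rintro _ ⟨_, ⟨x, hx, y, hy, rfl⟩, rfl⟩
    exact ⟨_, ⟨x, hx, rfl⟩, _, ⟨y, hy, rfl⟩, rfl⟩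
  smul c S hS := by
    rw [← isBounded_image_subtype_val] at *
    refine (CompleteBVS.smul c _ hS).subset ?_
    rintro _ ⟨_, ⟨x, hx, rfl⟩, rfl⟩
    exact ⟨_, ⟨x, hx, rfl⟩, rfl⟩
  complete S hS := by
    rw [← isBounded_image_subtype_val] at hS
    obtain ⟨D, h1, h2, h3⟩ := CompleteBVS.complete (𝕜 := 𝕜) _ hS
    have hmem : ∀ ε : ℝ, 0 < ε → ∀ x : p, x ∈ (ε : 𝕜) • ((fun x : p => (x : V)) ⁻¹' D) ↔
        (x : V) ∈ (ε : 𝕜) • D := by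
      intro ε hε x
      rw [mem_smul_iff hε, mem_smul_iff hε]; rfl
    refine ⟨(fun x : p => (x : V)) ⁻¹' D, fun x hx => h1 ⟨x, hx, rfl⟩, ?_,
      ⟨⟨0, h3.toIsDisc.zero_mem⟩, fun x hx y hy a b hab => h3.combo _ hx _ hy a b hab⟩, ?_, ?_⟩
    · rw [← isBounded_image_subtype_val]
      exact h2.subset (by rintro _ ⟨x, hx, rfl⟩; exact hx)
    · exact fun x hx => Subtype.ext (h3.norming _ fun ε hε => (hmem ε hε x).1 (hx ε hε))
    · intro x hx
      obtain ⟨l, hl⟩ := h3.complete (fun n => (x n : V)) fun ε hε =>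
        (hx ε hε).imp fun N hN m hm n hn => (hmem ε hε _).1 (hN m hm n hn)
      refine ⟨⟨l, hp D h2 h3.toIsDisc _ (fun n => (x n).2) l hl⟩, fun ε hε => ?_⟩
      exact (hl ε hε).imp fun N hN n hn => (hmem ε hε _).2 (hN n hn)

end BoundedLinear

/-! ### Modules as an idempotent complete additive category, and dual bases. -/

section Modules

variable {𝕜 : Type} [RCLike 𝕜] {A : Type u} [NonUnitalRing A] [Module 𝕜 A] [IsScalarTower 𝕜 A A]
  [SMulCommClass 𝕜 A A] [Bornology A] [CompleteBVS 𝕜 A] [BoundedMul A]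

namespace BornMod

/-- A bounded `A`-linear map as a morphism of modules. -/
def ofLin {M N : BornMod 𝕜 A} (f : M →ₗ[𝕜] N) (hf : IsBdd f)
    (h : ∀ m a, f (M.act m a) = N.act (f m) a) : M ⟶ N := (⟨f, hf, h⟩ : LA M N)

@[simp]
lemma toLin_ofLin {M N : BornMod 𝕜 A} (f : M →ₗ[𝕜] N) (hf : IsBdd f)
    (h : ∀ m a, f (M.act m a) = N.act (f m) a) : toLin (ofLin f hf h) = f := rfl

@[simp]
lemma toLin_comp {M N L : BornMod 𝕜 A} (f : M ⟶ N) (g : N ⟶ L) (m : M) :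
    toLin (f ≫ g) m = toLin g (toLin f m) := rfl

@[simp]
lemma toLin_id (M : BornMod 𝕜 A) (m : M) : toLin (𝟙 M) m = m := rfl

@[simp]
lemma toLin_add {M N : BornMod 𝕜 A} (f g : M ⟶ N) (m : M) :
    toLin (f + g) m = toLin f m + toLin g m := rfl

@[simp]
lemma toLin_sub {M N : BornMod 𝕜 A} (f g : M ⟶ N) (m : M) :
    toLin (f - g) m = toLin f m - toLin g m := rfl

@[simp]
lemma toLin_zero {M N : BornMod 𝕜 A} (m : M) : toLin (0 : M ⟶ N) m = 0 := rfl

@[simp]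
lemma toLin_sum {M N : BornMod 𝕜 A} {ι : Type*} (F : Finset ι) (f : ι → (M ⟶ N)) (m : M) :
    toLin (∑ i ∈ F, f i) m = ∑ i ∈ F, toLin (f i) m := by
  classical
  induction F using Finset.induction_on with
  | empty => simp
  | insert i F hi ih => rw [Finset.sum_insert hi, Finset.sum_insert hi, toLin_add, ih]

lemma isZero_iff (M : BornMod 𝕜 A) : IsZero M ↔ Subsingleton M := by
  rw [IsZero.iff_id_eq_zero]
  constructor
  · intro h
    refine ⟨fun x y => ?_⟩
    rw [← toLin_id M x, ← toLin_id M y, h, toLin_zero, toLin_zero]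
  · intro h
    exact hom_ext fun m => Subsingleton.elim _ _

/-- The direct sum of two modules. -/
def prod (M N : BornMod 𝕜 A) : BornMod 𝕜 A where
  carrier := M × N
  act := LinearMap.mk₂ 𝕜 (fun x a => (M.act x.1 a, N.act x.2 a))
    (fun x y a => by simp) (fun c x a => by simp) (fun x a b => by simp) (fun c x a => by simp)
  isBdd₂_act S T hS hT := by
    refine ((M.isBdd₂_act _ T hS.image_fst hT).prod (N.isBdd₂_act _ T hS.image_snd hT)).subset ?_
    rintro _ ⟨x, hx, a, ha, rfl⟩
    exact ⟨⟨_, ⟨x, hx, rfl⟩, a, ha, rfl⟩, ⟨_, ⟨x, hx, rfl⟩, a, ha, rfl⟩⟩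
  act_act x a b := by simp [M.act_act, N.act_act]
  act_unit e he x := by simp [M.act_unit e he, N.act_unit e he]

instance : HasZeroObject (BornMod 𝕜 A) :=
  ⟨(self 𝕜 A).pow 0, (isZero_iff _).2 (inferInstanceAs (Subsingleton (Fin 0 → A)))⟩

/-- The direct sum as a bicone. -/
def prodBicone (M N : BornMod 𝕜 A) : BinaryBicone M N where
  pt := prod M N
  fst := ofLin (LinearMap.fst 𝕜 M N) isBdd_fst fun _ _ => rfl
  snd := ofLin (LinearMap.snd 𝕜 M N) isBdd_snd fun _ _ => rfl
  inl := ofLin (LinearMap.inl 𝕜 M N) (isBdd_prodMk isBdd_id (isBdd_const 0))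
    fun _ a => Prod.ext rfl (LinearMap.map_zero₂ N.act a).symm
  inr := ofLin (LinearMap.inr 𝕜 M N) (isBdd_prodMk (isBdd_const 0) isBdd_id)
    fun _ a => Prod.ext (LinearMap.map_zero₂ M.act a).symm rfl
  inl_fst := rfl
  inl_snd := rfl
  inr_fst := rfl
  inr_snd := rfl

instance : HasBinaryBiproducts (BornMod 𝕜 A) where
  has_binary_biproduct M N := hasBinaryBiproduct_of_total (prodBicone M N)
    (hom_ext fun x => by
      obtain ⟨x, y⟩ := x
      exact Prod.ext (add_zero x) (zero_add y))

/-- The kernel of a morphism of modules. -/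
def ker {M N : BornMod 𝕜 A} (f : M ⟶ N) : BornMod 𝕜 A where
  carrier := LinearMap.ker (toLin f)
  complete := completeBVS_of_isBClosed _ (isBClosed_ker _ (isBdd_toLin f))
  act := LinearMap.mk₂ 𝕜
    (fun x a => ⟨M.act x a, by rw [LinearMap.mem_ker, toLin_act, x.2]; simp⟩)
    (fun x y a => by ext; simp) (fun c x a => by ext; simp) (fun x a b => by ext; simp)
    (fun c x a => by ext; simp)
  isBdd₂_act S T hS hT := by
    rw [← isBounded_image_subtype_val] at *
    refine (M.isBdd₂_act _ T hS hT).subset ?_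
    rintro _ ⟨_, ⟨x, hx, a, ha, rfl⟩, rfl⟩
    exact ⟨_, ⟨x, hx, rfl⟩, a, ha, rfl⟩
  act_act x a b := Subtype.ext (M.act_act x a b)
  act_unit e he x := Subtype.ext (M.act_unit e he x)

lemma isBdd_subtype_val {V : Type*} [Bornology V] {p : V → Prop} :
    IsBdd (Subtype.val : Subtype p → V) := fun _ hS => isBounded_image_subtype_val.2 hS

lemma isBdd_subtype_mk {V W : Type*} [Bornology V] [Bornology W] {p : V → Prop} {f : W → V}
    (hf : IsBdd f) (h : ∀ w, p (f w)) : IsBdd fun w => (⟨f w, h w⟩ : Subtype p) := fun S hS => by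
  rw [← isBounded_image_subtype_val, image_image]
  exact hf S hS

/-- The inclusion of the kernel. -/
def kerι {M N : BornMod 𝕜 A} (f : M ⟶ N) : ker f ⟶ M :=
  ofLin (M := ker f) (LinearMap.ker (toLin f)).subtype isBdd_subtype_val fun _ _ => rfl

/-- The image of an idempotent `p` is the kernel of `1 - p`, and kernels of bounded maps are closed,
hence complete. -/
instance : IsIdempotentComplete (BornMod 𝕜 A) where
  idempotents_split M p hp := by
    have hpp : ∀ m, toLin p (toLin p m) = toLin p m := fun m => by rw [← toLin_comp, hp]
    let q : M ⟶ M := 𝟙 M - p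
    have hq : ∀ m, toLin p m ∈ LinearMap.ker (toLin q) := fun m => by
      rw [LinearMap.mem_ker, toLin_sub, toLin_id, hpp, sub_self]
    refine ⟨ker q, kerι q, ofLin (N := ker q) (LinearMap.codRestrict _ (toLin p) hq)
      (isBdd_subtype_mk (isBdd_toLin p) hq) fun m a => Subtype.ext (toLin_act p m a),
      hom_ext fun m => Subtype.ext ?_, hom_ext fun m => rfl⟩
    have h : toLin q m.1 = 0 := m.2
    rw [toLin_sub, toLin_id, sub_eq_zero] at h
    exact h.symm

lemma isBdd₂_LA_apply {M N : BornMod 𝕜 A} : IsBdd₂ fun (φ : LA M N) (m : M) => φ.1 m :=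
  fun _ T hF hT => LA.isBounded_iff.1 hF T hT

lemma isBdd_LA_of_isBdd₂ {V : Type*} [Bornology V] {M N : BornMod 𝕜 A} {S : V → LA M N}
    (h : IsBdd₂ fun v m => (S v).1 m) : IsBdd S := fun F hF => LA.isBounded_iff.2 fun U hU =>
  (h F U hF hU).subset (by
    rintro _ ⟨_, ⟨v, hv, rfl⟩, m, hm, rfl⟩
    exact ⟨v, hv, m, hm, rfl⟩)

/-! ### Dual bases -/

/-- A finite dual basis of a module `P`: elements `e j` and coordinates `(a j, c j)` in `A⁺` such
that `x = ∑ (e j (a j x) + c j x • e j)`. -/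
structure DualBasis (P : BornMod 𝕜 A) (ι : Type*) [Fintype ι] where
  /-- The elements of the basis. -/
  e : ι → P
  /-- The components in `A` of the coordinates. -/
  a : ι → P →ₗ[𝕜] A
  /-- The scalar components of the coordinates. -/
  c : ι → P →ₗ[𝕜] 𝕜
  isBdd_a : ∀ j, IsBdd (a j)
  isBdd_c : ∀ j, IsBdd (c j)
  a_act : ∀ j x b, a j (P.act x b) = a j x * b + c j x • b
  c_act : ∀ j x b, c j (P.act x b) = 0
  sum_eq : ∀ x, ∑ j, (P.act (e j) (a j x) + c j x • e j) = x

/-- Apply `k` to the expansion of `x`: a morphism is recovered from its values at the `e j`. In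
contrast, the morphism `B.hom n` below need not take the value `n j` at `e j`, since the basis may
satisfy relations. -/
lemma DualBasis.hom_apply {P N : BornMod 𝕜 A} {ι : Type*} [Fintype ι] (B : DualBasis P ι)
    (k : P ⟶ N) (x : P) :
    toLin k x = ∑ j, (N.act (toLin k (B.e j)) (B.a j x) + B.c j x • toLin k (B.e j)) := by
  conv_lhs => rw [← B.sum_eq x]
  simp [toLin_act]

/-- The morphism from a module with a dual basis with prescribed values at the basis of the
ambient free module. -/
def DualBasis.hom {P N : BornMod 𝕜 A} {ι : Type*} [Fintype ι] (B : DualBasis P ι) (n : ι → N) :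
    P ⟶ N :=
  ofLin (∑ j, (N.act (n j) ∘ₗ B.a j + (B.c j).smulRight (n j)))
    (by
      have : IsBdd fun x => ∑ j, (N.act (n j) (B.a j x) + B.c j x • n j) :=
        isBdd_sum (𝕜 := 𝕜) _ fun j _ => isBdd_add' (𝕜 := 𝕜)
          (N.isBdd₂_act.comp (isBdd_const (n j)) (B.isBdd_a j))
          ((isBdd₂_smul (𝕜 := 𝕜) (V := N)).comp (B.isBdd_c j) (isBdd_const (n j)))
      convert this using 2 with x
      simp)
    fun x b => by simp [B.a_act, B.c_act, N.act_act]

@[simp]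
lemma DualBasis.toLin_hom {P N : BornMod 𝕜 A} {ι : Type*} [Fintype ι] (B : DualBasis P ι)
    (n : ι → N) (x : P) :
    toLin (B.hom n) x = ∑ j, (N.act (n j) (B.a j x) + B.c j x • n j) := by
  simp [DualBasis.hom]

/-- Modules with a finite dual basis. -/
def HasDualBasis (P : BornMod 𝕜 A) : Prop := ∃ n : ℕ, Nonempty (DualBasis P (Fin n))

lemma DualBasis.hasDualBasis {P : BornMod 𝕜 A} {ι : Type*} [Fintype ι] (B : DualBasis P ι) :
    HasDualBasis P := by
  let f := (Fintype.equivFin ι).symm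
  refine ⟨Fintype.card ι, ⟨⟨fun j => B.e (f j), fun j => B.a (f j), fun j => B.c (f j),
    fun j => B.isBdd_a _, fun j => B.isBdd_c _, fun j => B.a_act _, fun j => B.c_act _,
    fun x => ?_⟩⟩⟩
  conv_rhs => rw [← B.sum_eq x]
  exact f.sum_comp fun j => P.act (B.e j) (B.a j x) + B.c j x • B.e j

/-- A retract of a module with a dual basis has a dual basis. -/
def DualBasis.retract {P Q : BornMod 𝕜 A} {ι : Type*} [Fintype ι] (B : DualBasis Q ι)
    (i : P ⟶ Q) (r : Q ⟶ P) (h : i ≫ r = 𝟙 P) : DualBasis P ι where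
  e j := toLin r (B.e j)
  a j := B.a j ∘ₗ toLin i
  c j := B.c j ∘ₗ toLin i
  isBdd_a j := (B.isBdd_a j).comp (isBdd_toLin i)
  isBdd_c j := (B.isBdd_c j).comp (isBdd_toLin i)
  a_act j x b := by simp [toLin_act, B.a_act]
  c_act j x b := by simp [toLin_act, B.c_act]
  sum_eq x := by
    simp only [LinearMap.comp_apply]
    rw [← B.hom_apply r, ← toLin_comp, h, toLin_id]

/-- Dual bases of two summands are put side by side, by means of the inclusions and projections of
the biproduct. -/
lemma isAdditiveClass_hasDualBasis : IsAdditiveClass (HasDualBasis (𝕜 := 𝕜) (A := A)) where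
  zero X hX := ⟨0, ⟨⟨fun _ => 0, fun _ => 0, fun _ => 0, fun _ => isBdd_const 0,
    fun _ => isBdd_const 0, fun _ => by simp, fun _ => by simp,
    fun x => (isZero_iff X).1 hX |>.elim _ _⟩⟩⟩
  biprod X Y hX hY := by
    obtain ⟨n, ⟨B⟩⟩ := hX
    obtain ⟨m, ⟨B'⟩⟩ := hY
    let i₁ : X ⟶ X ⊞ Y := biprod.inl
    let i₂ : Y ⟶ X ⊞ Y := biprod.inr
    let p₁ : X ⊞ Y ⟶ X := biprod.fst
    let p₂ : X ⊞ Y ⟶ Y := biprod.snd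
    refine DualBasis.hasDualBasis (ι := Fin n ⊕ Fin m)
      { e := Sum.elim (fun j => toLin i₁ (B.e j)) (fun j => toLin i₂ (B'.e j))
        a := Sum.elim (fun j => B.a j ∘ₗ toLin p₁) (fun j => B'.a j ∘ₗ toLin p₂)
        c := Sum.elim (fun j => B.c j ∘ₗ toLin p₁) (fun j => B'.c j ∘ₗ toLin p₂)
        isBdd_a := ?_
        isBdd_c := ?_
        a_act := ?_
        c_act := ?_
        sum_eq := fun x => ?_ }
    · rintro (j | j)
      exacts [(B.isBdd_a j).comp (isBdd_toLin p₁), (B'.isBdd_a j).comp (isBdd_toLin p₂)]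
    · rintro (j | j)
      exacts [(B.isBdd_c j).comp (isBdd_toLin p₁), (B'.isBdd_c j).comp (isBdd_toLin p₂)]
    · rintro (j | j) x b
      · simp [toLin_act, B.a_act]
      · simp [toLin_act, B'.a_act]
    · rintro (j | j) x b
      · simp [toLin_act, B.c_act]
      · simp [toLin_act, B'.c_act]
    · rw [Fintype.sum_sum_type]
      simp only [Sum.elim_inl, Sum.elim_inr, LinearMap.comp_apply]
      rw [← B.hom_apply i₁, ← B'.hom_apply i₂, ← toLin_comp, ← toLin_comp, ← toLin_add,
        biprod.total, toLin_id]
  retract i r h := fun ⟨_, ⟨B⟩⟩ => (B.retract i r h).hasDualBasis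

/-- `A⁺` is free with one generator. -/
lemma exists_dualBasis_plus : ∃ B : DualBasis (plus 𝕜 A) Unit,
    ∀ (N : BornMod 𝕜 A) (n : N), toLin (B.hom fun _ => n) (B.e ()) = n := by
  by_cases h : IsUnital A
  · rw [show plus 𝕜 A = self 𝕜 A from dif_pos h]
    obtain ⟨e, he⟩ := h
    -- Coordinates are pairs in `A ⊕ 𝕜` even when `A` is unital; in that case the scalar component
    -- is taken to be zero and the generator is the unit.
    let B : DualBasis (self 𝕜 A) Unit :=
      { e := fun _ => e
        a := fun _ => (LinearMap.id : A →ₗ[𝕜] A)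
        c := fun _ => 0
        isBdd_a := fun _ => isBdd_id
        isBdd_c := fun _ => isBdd_const 0
        a_act := fun _ x b => by simp; rfl
        c_act := fun _ x b => rfl
        sum_eq := fun x => by
          refine (Fintype.sum_unique _).trans ?_
          change e * (show A from x) + (0 : 𝕜) • e = x
          rw [zero_smul, add_zero]
          exact (he x).1 }
    refine ⟨B, fun N n => ?_⟩
    rw [B.toLin_hom, Fintype.sum_unique]
    refine (congrArg₂ (· + ·) (N.act_unit e he n) (zero_smul 𝕜 n)).trans (add_zero n)
  · rw [show plus 𝕜 A = unitalization 𝕜 h from dif_neg h]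
    let B : DualBasis (unitalization 𝕜 h) Unit :=
      { e := fun _ => ((0, 1) : A × 𝕜)
        a := fun _ => LinearMap.fst 𝕜 A 𝕜
        c := fun _ => LinearMap.snd 𝕜 A 𝕜
        isBdd_a := fun _ => isBdd_fst (V := A) (W := 𝕜)
        isBdd_c := fun _ => isBdd_snd (V := A) (W := 𝕜)
        a_act := fun _ x b => rfl
        c_act := fun _ x b => rfl
        sum_eq := fun x => by
          rw [Fintype.sum_unique]
          obtain ⟨a, c⟩ := (show A × 𝕜 from x)
          refine Prod.ext ?_ ?_
          · change (0 * a + (1 : 𝕜) • a) + c • 0 = a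
            simp
          · change 0 + c • (1 : 𝕜) = c
            simp }
    refine ⟨B, fun N n => ?_⟩
    rw [B.toLin_hom, Fintype.sum_unique]
    change N.act n (0 : A) + (1 : 𝕜) • n = n
    simp

/-- The standard dual basis of `Mⁿ`, if `M` is free with one generator. -/
def DualBasis.pow {M : BornMod 𝕜 A} (B : DualBasis M Unit) (n : ℕ) :
    DualBasis (M.pow n) (Fin n) where
  e j := Pi.single j (B.e ())
  a j := B.a () ∘ₗ LinearMap.proj j
  c j := B.c () ∘ₗ LinearMap.proj j
  isBdd_a j := (B.isBdd_a ()).comp (isBdd_eval (W := M) j)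
  isBdd_c j := (B.isBdd_c ()).comp (isBdd_eval (W := M) j)
  a_act j x b := B.a_act () (x j) b
  c_act j x b := B.c_act () (x j) b
  sum_eq x := by
    have h : ∀ m, M.act (B.e ()) (B.a () m) + B.c () m • B.e () = m := fun m => by
      simpa using B.sum_eq m
    refine funext fun i => (Finset.sum_apply i _ _).trans ?_
    refine (Finset.sum_eq_single i (fun j _ hj => ?_) (fun hi => ?_)).trans ?_
    · change M.act ((Pi.single j (B.e ()) : Fin n → M) i) (B.a () (x j)) +
        B.c () (x j) • (Pi.single j (B.e ()) : Fin n → M) i = 0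
      rw [Pi.single_eq_of_ne hj.symm]
      simp
    · exact absurd (Finset.mem_univ i) hi
    · change M.act ((Pi.single i (B.e ()) : Fin n → M) i) (B.a () (x i)) +
        B.c () (x i) • (Pi.single i (B.e ()) : Fin n → M) i = _
      rw [Pi.single_eq_same, h]

/-- The free module maps to `P` by sending its generators to the `e j`, and the coordinates provide
the section. -/
lemma HasDualBasis.isFG {P : BornMod 𝕜 A} (hP : HasDualBasis P) : P.IsFG := by
  obtain ⟨n, ⟨B⟩⟩ := hP
  obtain ⟨B₀, hB₀⟩ := exists_dualBasis_plus (𝕜 := 𝕜) (A := A)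
  let s : P →ₗ[𝕜] (Fin n → plus 𝕜 A) := LinearMap.pi fun j =>
    (plus 𝕜 A).act (B₀.e ()) ∘ₗ B.a j + (B.c j).smulRight (B₀.e ())
  have hs : ∀ x j, s x j = (plus 𝕜 A).act (B₀.e ()) (B.a j x) + B.c j x • B₀.e () :=
    fun x j => rfl
  refine ⟨n, (B₀.pow n).hom B.e, s, isBdd_pi fun j => ?_, fun x => ?_⟩
  · exact isBdd_add' (𝕜 := 𝕜) ((plus 𝕜 A).isBdd₂_act.comp (isBdd_const (B₀.e ())) (B.isBdd_a j))
      ((isBdd₂_smul (𝕜 := 𝕜) (V := plus 𝕜 A)).comp (B.isBdd_c j) (isBdd_const (B₀.e ())))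
  · rw [DualBasis.toLin_hom]
    conv_rhs => rw [← B.sum_eq x]
    refine Finset.sum_congr rfl fun j _ => ?_
    have h : toLin (B₀.hom fun _ => B.e j) (s x j) =
        P.act (B.e j) (B.a j x) + B.c j x • B.e j := by
      rw [hs, map_add, toLin_act, map_smul, hB₀]
    rw [← h, DualBasis.toLin_hom, Fintype.sum_unique]
    rfl

/-- A map `φ` to the quotient lifts to `x ↦ ∑ s(φ(e j)) x_j`, where `s` is the linear section. This
is a morphism because the coordinates carry the `A`-linearity, and it depends on `φ` linearly and
boundedly. -/
lemma HasDualBasis.isProjective {P : BornMod 𝕜 A} (hP : HasDualBasis P) : P.IsProjective := by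
  obtain ⟨n, ⟨B⟩⟩ := hP
  intro L M N i p ⟨hi, hip, hp, t, s, ht, hs, hti, hps, hsum⟩
  have hpi : ∀ x, toLin p (toLin i x) = 0 := fun x => by
    have : toLin i x ∈ LinearMap.ker (toLin p) := hip ▸ LinearMap.mem_range_self _ x
    exact this
  let S : LA P N →ₗ[𝕜] LA P M :=
    { toFun := fun φ => B.hom fun j => s (φ.1 (B.e j))
      map_add' := fun φ ψ => hom_ext fun x => by
        change _ = toLin (B.hom fun j => s (φ.1 (B.e j))) x +
          toLin (B.hom fun j => s (ψ.1 (B.e j))) x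
        simp only [DualBasis.toLin_hom, ← Finset.sum_add_distrib]
        refine Finset.sum_congr rfl fun j _ => ?_
        simp only [Submodule.coe_add, LinearMap.add_apply, map_add, smul_add]
        abel
      map_smul' := fun c φ => hom_ext fun x => by
        change _ = c • toLin (B.hom fun j => s (φ.1 (B.e j))) x
        simp only [DualBasis.toLin_hom, Finset.smul_sum]
        refine Finset.sum_congr rfl fun j _ => ?_
        simp [smul_comm c] }
  have hS : ∀ (φ : LA P N) x, (S φ).1 x =
      ∑ j, (M.act (s (φ.1 (B.e j))) (B.a j x) + B.c j x • s (φ.1 (B.e j))) :=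
    fun φ x => B.toLin_hom _ x
  have hpS : ∀ φ x, toLin p ((S φ).1 x) = φ.1 x := fun φ x => by
    rw [hS, map_sum]
    refine Eq.trans ?_ (B.hom_apply (show P ⟶ N from φ) x).symm
    refine Finset.sum_congr rfl fun j _ => ?_
    rw [map_add, toLin_act, map_smul, hps]
    rfl
  have hit : ∀ y, toLin p y = 0 → toLin i (t y) = y := fun y hy => by
    have := hsum y
    rwa [hy, map_zero, add_zero] at this
  -- `D φ` takes values in the kernel of `p`. There `t` inverts the injective morphism `i`, so `t ∘
  -- D φ` is `A`-linear although `t` need not be.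
  let D : LA P M →ₗ[𝕜] LA P M := LinearMap.id - S ∘ₗ postcomp P p
  have hD : ∀ φ x, (D φ).1 x = φ.1 x - (S (postcomp P p φ)).1 x := fun φ x => rfl
  have hpD : ∀ φ x, toLin p ((D φ).1 x) = 0 := fun φ x => by
    rw [hD, map_sub, hpS]
    exact sub_self _
  let T : LA P M →ₗ[𝕜] LA P L :=
    { toFun := fun φ => ⟨t ∘ₗ (D φ).1, ht.comp (D φ).2.1, fun x b => by
        apply hi
        simp only [LinearMap.comp_apply]
        rw [hit _ (hpD _ _), toLin_act, hit _ (hpD _ _), (D φ).2.2]⟩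
      map_add' := fun φ ψ => Subtype.ext (by
        simp only [map_add, Submodule.coe_add, LinearMap.comp_add])
      map_smul' := fun c φ => Subtype.ext (by
        simp only [map_smul, Submodule.coe_smul, LinearMap.comp_smul, RingHom.id_apply]) }
  have hT : ∀ φ x, (T φ).1 x = t ((D φ).1 x) := fun φ x => rfl
  have hSb : IsBdd S := by
    refine isBdd_LA_of_isBdd₂ (isBdd₂_of_isBdd ?_)
    have h1 : ∀ j, IsBdd fun q : LA P N × P => s (q.1.1 (B.e j)) := fun j =>
      hs.comp (isBdd₂_LA_apply.comp isBdd_fst (isBdd_const (B.e j)))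
    have h2 : IsBdd fun q : LA P N × P =>
        ∑ j, (M.act (s (q.1.1 (B.e j))) (B.a j q.2) + B.c j q.2 • s (q.1.1 (B.e j))) :=
      isBdd_sum (𝕜 := 𝕜) _ fun j _ => isBdd_add' (𝕜 := 𝕜)
        (M.isBdd₂_act.comp (h1 j) ((B.isBdd_a j).comp isBdd_snd))
        ((isBdd₂_smul (𝕜 := 𝕜) (V := M)).comp ((B.isBdd_c j).comp isBdd_snd) (h1 j))
    simpa only [hS] using h2
  have hpb : IsBdd (postcomp P p) := isBdd_LA_of_isBdd₂ (isBdd₂_of_isBdd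
    ((isBdd_toLin p).comp (isBdd₂_LA_apply.comp isBdd_fst isBdd_snd)))
  have hTb : IsBdd T := by
    refine isBdd_LA_of_isBdd₂ (isBdd₂_of_isBdd (ht.comp ?_))
    have h1 : IsBdd fun q : LA P M × P => q.1.1 q.2 := isBdd₂_LA_apply.comp isBdd_fst isBdd_snd
    have h2 : IsBdd fun q : LA P M × P => (S (postcomp P p q.1)).1 q.2 :=
      isBdd₂_LA_apply.comp (hSb.comp (hpb.comp isBdd_fst)) isBdd_snd
    have h3 := isBdd_add' (𝕜 := 𝕜) h1
      ((isBdd₂_smul (𝕜 := 𝕜) (V := M)).comp (isBdd_const (-1 : 𝕜)) h2)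
    simpa only [hD, neg_one_smul, ← sub_eq_add_neg] using h3
  have hTS : ∀ ψ, T (postcomp P i ψ) = ψ := fun ψ => Subtype.ext (LinearMap.ext fun x => by
    rw [hT, hD]
    have : postcomp P p (postcomp P i ψ) = 0 := Subtype.ext (LinearMap.ext fun x => hpi _)
    rw [this, map_zero]
    exact (congrArg t (sub_zero _)).trans (hti _))
  have hPS : ∀ φ, postcomp P p (S φ) = φ := fun φ => Subtype.ext (LinearMap.ext fun x => hpS φ x)
  have hsum' : ∀ φ, postcomp P i (T φ) + S (postcomp P p φ) = φ := fun φ =>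
    Subtype.ext (LinearMap.ext fun x => by
      change toLin i (t ((D φ).1 x)) + (S (postcomp P p φ)).1 x = φ.1 x
      rw [hit _ (hpD _ _), hD]
      exact sub_add_cancel _ _)
  refine ⟨fun φ ψ h => by rw [← hTS φ, h, hTS], ?_, fun φ => ⟨S φ, hPS φ⟩, T, S, hTb, hSb, hTS,
    hPS, hsum'⟩
  · ext φ
    rw [LinearMap.mem_range, LinearMap.mem_ker]
    constructor
    · rintro ⟨ψ, rfl⟩
      exact Subtype.ext (LinearMap.ext fun x => hpi _)
    · intro h
      have := hsum' φ
      rw [h, map_zero, add_zero] at this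
      exact ⟨_, this⟩

/-- The kernel of a presentation `(A⁺)ⁿ ⟶ P` with a linear section gives a split extension.
Projectivity lifts the identity of `P` along it, so `P` is a retract of `(A⁺)ⁿ`. -/
lemma hasDualBasis_of_isFG_of_isProjective {P : BornMod 𝕜 A} (h : P.IsFG) (h' : P.IsProjective) :
    HasDualBasis P := by
  obtain ⟨n, π, s, hs, hπ⟩ := h
  obtain ⟨B₀, -⟩ := exists_dualBasis_plus (𝕜 := 𝕜) (A := A)
  have hker : ∀ v, (LinearMap.id - s ∘ₗ toLin π : _ →ₗ[𝕜] _) v ∈ LinearMap.ker (toLin π) :=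
    fun v => by simp [LinearMap.mem_ker, hπ]
  have hex : SplitExact (toLin (kerι π)) (toLin π) := by
    refine ⟨Subtype.val_injective, Submodule.range_subtype _, fun x => ⟨s x, hπ x⟩,
      LinearMap.codRestrict (LinearMap.ker (toLin π)) (LinearMap.id - s ∘ₗ toLin π) hker, s,
      isBdd_subtype_mk ?_ hker, hs, fun u => Subtype.ext ?_, hπ, fun v => ?_⟩
    · have h3 := isBdd_add' (𝕜 := 𝕜) (isBdd_id (X := (plus 𝕜 A).pow n))
        ((isBdd₂_smul (𝕜 := 𝕜) (V := (plus 𝕜 A).pow n)).comp (isBdd_const (-1 : 𝕜))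
          (hs.comp (isBdd_toLin π)))
      simp only [neg_one_smul, ← sub_eq_add_neg] at h3
      exact h3
    · have : toLin π u.1 = 0 := u.2
      change u.1 - s (toLin π u.1) = u.1
      rw [this, map_zero, sub_zero]
    · exact sub_add_cancel v _
  obtain ⟨φ, hφ⟩ := (h' (kerι π) π hex).2.2.1 (𝟙 P)
  exact ((B₀.pow n).retract (show P ⟶ _ from φ) π hφ).hasDualBasis

end BornMod

end Modules

end Borno

end

noncomputable section

namespace Borno

open Set Bornology CategoryTheory Limits
open scoped Pointwise

universe u

set_option linter.unusedSectionVars false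

/-! ### Absolutely convergent sums of bounded families of linear maps. -/

section Families

variable {𝕜 : Type} [RCLike 𝕜] {ι κ : Type u} [Bornology ι] [Bornology κ]
  {W X Y : Type*} [AddCommGroup W] [Module 𝕜 W] [Bornology W]
  [AddCommGroup X] [Module 𝕜 X] [Bornology X] [CompleteBVS 𝕜 X]
  [AddCommGroup Y] [Module 𝕜 Y] [Bornology Y] [CompleteBVS 𝕜 Y]

lemma isBdd_delta : IsBdd (delta (𝕜 := 𝕜) : ι → Ell1 𝕜 ι) := fun S hS =>
  (isBounded_ellBall (𝕜 := 𝕜) hS 1).subset (by rintro _ ⟨i, hi, rfl⟩; exact delta_mem hi)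

/-- Both sides are bounded and linear in `ξ` and agree on the `delta i`. Together with
`Ell1.lift_congr`, this reduces identities between infinite sums to identities between their terms.
-/
lemma Ell1.map_lift {b : ι → X} (hb : IsBdd b) {k : X →ₗ[𝕜] Y} (hk : IsBdd k) (ξ : Ell1 𝕜 ι) :
    k (Ell1.lift b hb ξ) = Ell1.lift (fun i => k (b i)) (hk.comp hb) ξ :=
  LinearMap.congr_fun (Ell1.hom_ext (k ∘ₗ Ell1.lift b hb) _
    (hk.comp (Ell1.isBdd_lift _ _)) (Ell1.isBdd_lift _ _) fun i => by
      simp [Ell1.lift_delta]) ξ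

lemma Ell1.lift_congr {b b' : ι → X} (hb : IsBdd b) (hb' : IsBdd b') (h : ∀ i, b i = b' i)
    (ξ : Ell1 𝕜 ι) : Ell1.lift b hb ξ = Ell1.lift b' hb' ξ := by
  obtain rfl : b = b' := funext h
  rfl

lemma Ell1.lift_add_fun {b b' : ι → X} (hb : IsBdd b) (hb' : IsBdd b')
    (h : IsBdd fun i => b i + b' i) (ξ : Ell1 𝕜 ι) :
    Ell1.lift (fun i => b i + b' i) h ξ = Ell1.lift b hb ξ + Ell1.lift b' hb' ξ := by
  have := Ell1.hom_ext (Ell1.lift (𝕜 := 𝕜) _ h) (Ell1.lift b hb + Ell1.lift b' hb')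
    (Ell1.isBdd_lift _ _) (BornMod.isBdd_add (Ell1.isBdd_lift _ _) (Ell1.isBdd_lift _ _))
    fun i => by rw [LinearMap.add_apply, Ell1.lift_delta, Ell1.lift_delta, Ell1.lift_delta]
  rw [this, LinearMap.add_apply]

lemma Ell1.lift_smul_fun {b : ι → X} (hb : IsBdd b) (c : 𝕜) (h : IsBdd fun i => c • b i)
    (ξ : Ell1 𝕜 ι) : Ell1.lift (fun i => c • b i) h ξ = c • Ell1.lift b hb ξ := by
  have := Ell1.hom_ext (Ell1.lift (𝕜 := 𝕜) _ h) (c • Ell1.lift b hb)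
    (Ell1.isBdd_lift _ _) (BornMod.isBdd_smul c (Ell1.isBdd_lift _ _))
    fun i => by rw [LinearMap.smul_apply, Ell1.lift_delta, Ell1.lift_delta]
  rw [this, LinearMap.smul_apply]

/-- The linear map `∑ ξ i • b i` for a bounded family of linear maps `b i`. -/
def Ell1.liftHom (b : ι → W →ₗ[𝕜] X) (hb : IsBdd₂ fun i w => b i w) :
    Ell1 𝕜 ι →ₗ[𝕜] W →ₗ[𝕜] X :=
  have h : ∀ w, IsBdd fun i => b i w := fun w => hb.comp isBdd_id (isBdd_const w)
  LinearMap.mk₂ 𝕜 (fun ξ w => Ell1.lift (fun i => b i w) (h w) ξ)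
    (fun ξ η w => (Ell1.lift (fun i => b i w) (h w)).map_add ξ η)
    (fun c ξ w => (Ell1.lift (fun i => b i w) (h w)).map_smul c ξ)
    (fun ξ w w' => (Ell1.lift_congr _ (isBdd_add' (𝕜 := 𝕜) (h w) (h w'))
      (fun i => (b i).map_add w w') ξ).trans (Ell1.lift_add_fun (h w) (h w') _ ξ))
    (fun c ξ w => (Ell1.lift_congr _ ((isBdd₂_smul (𝕜 := 𝕜) (V := X)).comp (isBdd_const c) (h w))
      (fun i => (b i).map_smul c w) ξ).trans (Ell1.lift_smul_fun (h w) c _ ξ))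

lemma Ell1.liftHom_apply (b : ι → W →ₗ[𝕜] X) (hb : IsBdd₂ fun i w => b i w) (ξ : Ell1 𝕜 ι)
    (w : W) : Ell1.liftHom b hb ξ w =
      Ell1.lift (fun i => b i w) (hb.comp isBdd_id (isBdd_const w)) ξ := rfl

lemma Ell1.liftHom_delta (b : ι → W →ₗ[𝕜] X) (hb : IsBdd₂ fun i w => b i w) (i : ι) :
    Ell1.liftHom b hb (delta i) = b i := LinearMap.ext fun w =>
    Ell1.lift_delta _ (hb.comp isBdd_id (isBdd_const w)) i

lemma Ell1.isBdd_liftHom (b : ι → W →ₗ[𝕜] X) (hb : IsBdd₂ fun i w => b i w) (ξ : Ell1 𝕜 ι) :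
    IsBdd (Ell1.liftHom b hb ξ) := by
  intro S hS
  obtain ⟨D, h1, h2, h3⟩ := CompleteBVS.complete (𝕜 := 𝕜) _ (hb _ S ξ.2.2 hS)
  obtain ⟨C, hC, hξ⟩ : ∃ C : ℝ, 0 < C ∧ ξ ∈ ellBall (Function.support ξ.1) C :=
    ⟨max (∑' i, ‖ξ.1 i‖) 1, by positivity, subset_rfl, le_max_left _ _⟩
  refine (CompleteBVS.smul (𝕜 := 𝕜) ((C + C : ℝ) : 𝕜) D h2).subset ?_
  rintro _ ⟨w, hw, rfl⟩
  exact Ell1.lift_mem h2 h3 _ (hb.comp isBdd_id (isBdd_const w)) hC hξ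
    fun i hi => h1 ⟨i, hi, w, hw, rfl⟩

end Families

/-! ### Nuclear maps: the ideal property, lifts to the essentialization, invertibility of `1 - g`.
-/

section Modules

variable {𝕜 : Type} [RCLike 𝕜] {A : Type u} [NonUnitalRing A] [Module 𝕜 A] [IsScalarTower 𝕜 A A]
  [SMulCommClass 𝕜 A A] [Bornology A] [CompleteBVS 𝕜 A] [BoundedMul A]

/-- The balanced tensor product is a quotient of a quotient of the space of formal sums, so no
closure is needed to reach all its elements by absolutely convergent sums of pure tensors. -/
lemma BTensor.exists_eq_lift {V W : Type u} [AddCommGroup V] [Module 𝕜 V] [Bornology V]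
    [AddCommGroup W] [Module 𝕜 W] [Bornology W] {r : V → A → V} {l : A → W → W}
    (t : BTensor 𝕜 r l) : ∃ ξ : Ell1 𝕜 (V × W),
      t = Ell1.lift (fun p : V × W => BTensor.tmul p.1 p.2) (isBdd_pair BTensor.isBdd_tmul) ξ := by
  obtain ⟨t, rfl⟩ := BTensor.mk_surjective r l t
  obtain ⟨ξ, rfl⟩ := CTensor.mk_surjective t
  exact ⟨ξ, LinearMap.congr_fun (Ell1.hom_ext (BTensor.mk r l ∘ₗ CTensor.mk 𝕜 V W) _
    ((BTensor.isBdd_mk r l).comp CTensor.isBdd_mk) (Ell1.isBdd_lift _ _) fun p => by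
      rw [Ell1.lift_delta]; rfl) ξ⟩

namespace BornMod

variable {M N L : BornMod 𝕜 A}

/-- The linear map that underlies a functional. -/
def dualLin (φ : LA M (self 𝕜 A)) : M →ₗ[𝕜] A := φ.1

lemma dualLin_act (φ : LA M (self 𝕜 A)) (m : M) (a : A) :
    dualLin φ (M.act m a) = dualLin φ m * a := φ.2.2 m a

/-- The map `m ↦ n φ(m)`. -/
def rankOne (p : N × LA M (self 𝕜 A)) : M →ₗ[𝕜] N := N.act p.1 ∘ₗ dualLin p.2

lemma rankOne_apply (p : N × LA M (self 𝕜 A)) (m : M) :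
    rankOne p m = N.act p.1 (dualLin p.2 m) := rfl

lemma isBdd₂_dualLin : IsBdd₂ fun (φ : LA M (self 𝕜 A)) (m : M) => dualLin φ m :=
  isBdd₂_LA_apply (N := self 𝕜 A)

lemma isBdd_dualLin_snd : IsBdd fun q : (N × LA M (self 𝕜 A)) × M => dualLin q.1.2 q.2 :=
  isBdd₂_dualLin.comp (isBdd_snd.comp isBdd_fst) isBdd_snd

lemma isBdd₂_rankOne : IsBdd₂ fun (p : N × LA M (self 𝕜 A)) (m : M) => rankOne p m :=
  isBdd₂_of_isBdd (N.isBdd₂_act.comp (isBdd_fst.comp isBdd_fst) isBdd_dualLin_snd)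

lemma rankOne_act (p : N × LA M (self 𝕜 A)) (m : M) (a : A) :
    rankOne p (M.act m a) = N.act (rankOne p m) a := by
  rw [rankOne_apply, rankOne_apply, dualLin_act, N.act_act]

/-- The map given by a formal sum of pairs `(n, φ)`. -/
abbrev sumRankOne (ξ : Ell1 𝕜 (N × LA M (self 𝕜 A))) : M →ₗ[𝕜] N :=
  Ell1.liftHom rankOne isBdd₂_rankOne ξ

lemma isBdd_nuclearEval (m : M) : IsBdd (nuclearEval M N m) := BTensor.isBdd_lift _ _ _

lemma nuclearEval_lift {ι : Type u} [Bornology ι] {e : ι → N × LA M (self 𝕜 A)} (he : IsBdd e)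
    (ξ : Ell1 𝕜 ι) (m : M) :
    nuclearEval M N m (Ell1.lift (fun i => BTensor.tmul (e i).1 (e i).2)
      ((isBdd_pair BTensor.isBdd_tmul).comp he) ξ) =
      Ell1.lift (fun i => rankOne (e i) m) (isBdd₂_rankOne.comp he (isBdd_const m)) ξ := by
  rw [Ell1.map_lift _ (isBdd_nuclearEval m)]
  refine Ell1.lift_congr _ _ (fun i => ?_) ξ
  exact nuclearEval_tmul _ _ _ _ _

lemma IsNuclear.exists_eq {f : M ⟶ N} (hf : IsNuclear f) :
    ∃ ξ : Ell1 𝕜 (N × LA M (self 𝕜 A)), toLin f = sumRankOne ξ := by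
  obtain ⟨t, ht⟩ := hf
  obtain ⟨ξ, rfl⟩ := BTensor.exists_eq_lift t
  exact ⟨ξ, LinearMap.ext fun m => (ht m).trans (nuclearEval_lift isBdd_id ξ m)⟩

/-- The sum of the tensors `n ⊗ φ` over the family `e` represents `f`. An arbitrary index type
allows the pairs of a given sum to be modified term by term, with the coefficients kept. -/
lemma isNuclear_of_eq_lift {f : M ⟶ N} {ι : Type u} [Bornology ι]
    {e : ι → N × LA M (self 𝕜 A)} (he : IsBdd e) (ξ : Ell1 𝕜 ι)
    (h : ∀ m, toLin f m =
      Ell1.lift (fun i => rankOne (e i) m) (isBdd₂_rankOne.comp he (isBdd_const m)) ξ) :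
    IsNuclear f :=
  ⟨_, fun m => (h m).trans (nuclearEval_lift he ξ m).symm⟩

lemma IsNuclear.comp_right {f : M ⟶ N} (hf : IsNuclear f) (k : N ⟶ L) : IsNuclear (f ≫ k) := by
  obtain ⟨ξ, hξ⟩ := hf.exists_eq
  have he : IsBdd fun p : N × LA M (self 𝕜 A) => (toLin k p.1, p.2) :=
    isBdd_prodMk ((isBdd_toLin k).comp isBdd_fst) isBdd_snd
  refine isNuclear_of_eq_lift he ξ fun m => ?_
  rw [toLin_comp, hξ, Ell1.liftHom_apply, Ell1.map_lift _ (isBdd_toLin k)]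
  refine Ell1.lift_congr _ _ (fun p => ?_) ξ
  exact toLin_act k p.1 _

/-- The functional `φ ∘ k`. -/
def precomp (k : M ⟶ N) (φ : LA N (self 𝕜 A)) : LA M (self 𝕜 A) :=
  (k ≫ (show N ⟶ self 𝕜 A from φ) : M ⟶ self 𝕜 A)

lemma dualLin_precomp (k : M ⟶ N) (φ : LA N (self 𝕜 A)) (m : M) :
    dualLin (precomp k φ) m = dualLin φ (toLin k m) := rfl

lemma isBdd_LA_self {V : Type*} [Bornology V] {S : V → LA M (self 𝕜 A)}
    (h : IsBdd fun q : V × M => dualLin (S q.1) q.2) : IsBdd S :=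
  isBdd_LA_of_isBdd₂ (isBdd₂_of_isBdd h)

lemma isBdd_precomp (k : M ⟶ N) : IsBdd (precomp k : LA N (self 𝕜 A) → LA M (self 𝕜 A)) := by
  refine isBdd_LA_self ?_
  simp only [dualLin_precomp]
  exact isBdd₂_dualLin.comp isBdd_fst (IsBdd.comp (f := Prod.snd) (isBdd_toLin k) isBdd_snd)

lemma IsNuclear.comp_left {f : N ⟶ L} (hf : IsNuclear f) (k : M ⟶ N) : IsNuclear (k ≫ f) := by
  obtain ⟨ξ, hξ⟩ := hf.exists_eq
  have he : IsBdd fun p : L × LA N (self 𝕜 A) => (p.1, precomp k p.2) :=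
    isBdd_prodMk isBdd_fst ((isBdd_precomp k).comp isBdd_snd)
  refine isNuclear_of_eq_lift he ξ fun m => ?_
  rw [toLin_comp, hξ, Ell1.liftHom_apply]
  rfl

/-- A nuclear map lifts to `N ⊗_A A`. -/
lemma IsNuclear.exists_lift {f : M ⟶ N} (hf : IsNuclear f) :
    ∃ g : M ⟶ (essFunctor 𝕜 A).obj N, g ≫ essMul N = f ∧ essMul M ≫ g = (essFunctor 𝕜 A).map f := by
  obtain ⟨ξ, hξ⟩ := hf.exists_eq
  -- The lift replaces each term `n φ(m)` by `n ⊗ φ(m)`.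
  let b : N × LA M (self 𝕜 A) → M →ₗ[𝕜] EssSpace N := fun p =>
    BTensor.tmul p.1 ∘ₗ dualLin p.2
  have hb : IsBdd₂ fun p m => b p m := isBdd₂_of_isBdd
    (BTensor.isBdd_tmul.comp (isBdd_fst.comp isBdd_fst) isBdd_dualLin_snd)
  have hact : ∀ m a, Ell1.liftHom b hb ξ (M.act m a) = essAct N a (Ell1.liftHom b hb ξ m) := by
    intro m a
    rw [Ell1.liftHom_apply, Ell1.liftHom_apply, Ell1.map_lift _ (isBdd_essAct N a)]
    refine Ell1.lift_congr _ _ (fun p => ?_) ξ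
    refine Eq.trans ?_ (essAct_tmul N a p.1 (dualLin p.2 m)).symm
    exact congrArg (BTensor.tmul p.1) (dualLin_act p.2 m a)
  let g : M ⟶ (essFunctor 𝕜 A).obj N :=
    ofLin (N := ess N) (Ell1.liftHom b hb ξ) (Ell1.isBdd_liftHom b hb ξ) hact
  -- Termwise, `n ⊗ φ(m a) = n ⊗ φ(m) a = n φ(m) ⊗ a`, by linearity of `φ` and balancedness.
  have key : Ell1.liftHom b hb ξ ∘ₗ essMulLin M = essMapLin f := by
    refine BTensor.hom_ext _ _ ((Ell1.isBdd_liftHom b hb ξ).comp (isBdd_essMulLin M))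
      (isBdd_essMapLin f) fun m a => ?_
    rw [LinearMap.comp_apply, essMulLin_tmul, essMapLin_tmul, hact, hξ, Ell1.liftHom_apply,
      Ell1.liftHom_apply, Ell1.map_lift _ (isBdd_essAct N a)]
    let k : N →ₗ[𝕜] EssSpace N := BTensor.tmul.flip a
    have hk : IsBdd k := fun S hS =>
      (BTensor.isBdd_tmul S {a} hS isBounded_singleton).subset (by
        rintro _ ⟨n, hn, rfl⟩
        exact ⟨n, hn, a, rfl, rfl⟩)
    refine Eq.trans ?_ (Ell1.map_lift _ hk ξ).symm
    refine Ell1.lift_congr _ _ (fun p => ?_) ξ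
    exact (essAct_tmul N a p.1 (dualLin p.2 m)).trans (BTensor.tmul_balanced _ _ _).symm
  refine ⟨g, hom_ext fun m => ?_, hom_ext fun t => LinearMap.congr_fun key t⟩
  change essMulLin N (Ell1.liftHom b hb ξ m) = _
  rw [hξ, Ell1.liftHom_apply, Ell1.liftHom_apply, Ell1.map_lift _ (isBdd_essMulLin N)]
  refine Ell1.lift_congr _ _ (fun p => ?_) ξ
  exact essMulLin_tmul N p.1 _

/-- Maps from a finitely generated projective module that factor through an essentialization are
nuclear. -/
lemma HasDualBasis.isNuclear_comp_essMul {P : BornMod 𝕜 A} (hP : HasDualBasis P)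
    (k : P ⟶ (essFunctor 𝕜 A).obj M) : IsNuclear (k ≫ essMul M) := by
  obtain ⟨n, ⟨B⟩⟩ := hP
  -- For `τ = k(e_j)` the right-hand side is the `j`-th term of the expansion of the composite in
  -- the dual basis.
  have key : ∀ (τ : EssSpace M) (j : Fin n),
      ∃ t : BTensor 𝕜 (fun (m : M) (a : A) => M.act m a) (dualAct P), ∀ x,
        nuclearEval P M x t = essMulLin M (essAct M (B.a j x) τ) + B.c j x • essMulLin M τ := by
    intro τ j
    obtain ⟨ξ, rfl⟩ := BTensor.exists_eq_lift τ
    -- Multiplying the coordinate in `A⁺` by `b` on the left gives a functional with values in `A`.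
    -- The factor `b` is supplied by the tensors `m ⊗ b` that make up `τ`.
    let l : A → (P →ₗ[𝕜] A) := fun b => LinearMap.mul 𝕜 A b ∘ₗ B.a j + (B.c j).smulRight b
    have hl : ∀ b x, l b x = b * B.a j x + B.c j x • b := fun b x => rfl
    have h1 : IsBdd fun q : A × P => B.a j q.2 :=
      IsBdd.comp (f := Prod.snd) (B.isBdd_a j) isBdd_snd
    have h2 : IsBdd fun q : A × P => B.c j q.2 :=
      IsBdd.comp (f := Prod.snd) (B.isBdd_c j) isBdd_snd
    have h3 : IsBdd fun q : A × P => q.1 * B.a j q.2 :=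
      (isBdd₂_mul (𝕜 := 𝕜) (A := A)).comp isBdd_fst h1
    have h4 : IsBdd fun q : A × P => B.c j q.2 • q.1 :=
      (isBdd₂_smul (𝕜 := 𝕜) (V := A)).comp h2 isBdd_fst
    have hl2 : IsBdd fun q : A × P => l q.1 q.2 := by
      simp only [hl]
      exact isBdd_add' (𝕜 := 𝕜) h3 h4
    have hlb : ∀ b, IsBdd (l b) := fun b =>
      hl2.comp (f := fun x => (b, x)) (isBdd_prodMk (isBdd_const b) isBdd_id)
    have hla : ∀ b x a, l b (P.act x a) = l b x * a := fun b x a => by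
      rw [hl, hl, B.a_act, B.c_act, mul_add, add_mul, mul_smul_comm, smul_mul_assoc, mul_assoc,
        zero_smul, add_zero]
    let φ : A → LA P (self 𝕜 A) := fun b => ⟨l b, hlb b, hla b⟩
    have hφ : IsBdd φ := isBdd_LA_self hl2
    have he : IsBdd fun p : M × A => (p.1, φ p.2) := isBdd_prodMk isBdd_fst (hφ.comp isBdd_snd)
    refine ⟨_, fun x => (nuclearEval_lift he ξ x).trans ?_⟩
    let k : EssSpace M →ₗ[𝕜] M := essMulLin M ∘ₗ essAct M (B.a j x) + B.c j x • essMulLin M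
    have hk : IsBdd k := isBdd_add ((isBdd_essMulLin M).comp (isBdd_essAct M _))
      (isBdd_smul _ (isBdd_essMulLin M))
    refine Eq.trans ?_ (Ell1.map_lift (isBdd_pair BTensor.isBdd_tmul) hk ξ).symm
    refine Ell1.lift_congr _ _ (fun p => ?_) ξ
    change M.act p.1 (l p.2 x) = essMulLin M (essAct M (B.a j x) (BTensor.tmul p.1 p.2)) +
      B.c j x • essMulLin M (BTensor.tmul p.1 p.2)
    rw [essAct_tmul, essMulLin_tmul, essMulLin_tmul, hl, map_add, map_smul]
  choose t ht using fun j => key (toLin k (B.e j)) j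
  refine ⟨∑ j, t j, fun x => ?_⟩
  rw [map_sum, toLin_comp, B.hom_apply k, map_sum]
  refine Finset.sum_congr rfl fun j _ => ?_
  rw [ht, map_add, map_smul]
  rfl

/-- The map `m ↦ n φ(m)` is `φ`, followed by `A ⟶ A⁺` and by the morphism that takes the generator
of `A⁺` to `n`. -/
lemma factorsThrough_rankOne {f : M ⟶ N} (p : N × LA M (self 𝕜 A))
    (hf : ∀ m, toLin f m = rankOne p m) : FactorsThrough HasDualBasis f := by
  obtain ⟨B, hB⟩ := exists_dualBasis_plus (𝕜 := 𝕜) (A := A)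
  let j : self 𝕜 A ⟶ plus 𝕜 A := ofLin (M := self 𝕜 A) ((plus 𝕜 A).act (B.e ()))
    ((plus 𝕜 A).isBdd₂_act.comp (isBdd_const _) isBdd_id) fun a b =>
      ((plus 𝕜 A).act_act (B.e ()) a b).symm
  refine ⟨plus 𝕜 A, B.hasDualBasis, (show M ⟶ self 𝕜 A from p.2) ≫ j, B.hom fun _ => p.1,
    hom_ext fun m => ?_⟩
  rw [hf, rankOne_apply]
  change toLin (B.hom fun _ => p.1) ((plus 𝕜 A).act (B.e ()) (dualLin p.2 m)) = _
  rw [toLin_act, hB]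

/-- Small nuclear endomorphisms are contractive. -/
lemma exists_isContractive (hmc : IsMultConvex 𝕜 A) (S : Set (M × LA M (self 𝕜 A)))
    (hS : IsBounded S) : ∃ ε : ℝ, 0 < ε ∧
      ∀ ξ ∈ ellBall (𝕜 := 𝕜) S ε, IsContractive (sumRankOne ξ) := by
  have h1 : IsBounded (Prod.fst '' S) := isBdd_fst S hS
  have h2 : IsBounded (Prod.snd '' S) := isBdd_snd S hS
  -- Iterating a sum of rank-one maps produces products of the elements `φ(n)` with both entries
  -- taken from `S`. After division by `t` these products stay in `D`.
  obtain ⟨D, hD, -, hDD, t, ht, hB⟩ := hmc _ (isBdd₂_dualLin _ _ h2 h1)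
  have htn : (t : 𝕜) ≠ 0 := by simpa using ht.ne'
  -- `ellBall_ball` doubles the radius, and the rescaling of the rank-one maps costs a factor `t`:
  -- `2 * t / (8 * t) = 1 / 4`. The choice depends on `S` alone and not on `U`.
  refine ⟨1 / (8 * t), by positivity, fun ξ hξ U hU => ?_⟩
  set V : Set A := (t : 𝕜)⁻¹ • image2 (fun (φ : LA M (self 𝕜 A)) (m : M) => dualLin φ m)
    (Prod.snd '' S) U with hV
  have hVb : IsBounded V := CompleteBVS.smul _ _ (isBdd₂_dualLin _ _ h2 hU)
  set W : Set A := V ∪ D * V with hW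
  have hWb : IsBounded W := hVb.union (BoundedMul.isBounded_mul hD hVb)
  have hDW : ∀ d ∈ D, ∀ w ∈ W, d * w ∈ W := by
    rintro d hd w (hw | ⟨d', hd', v, hv, rfl⟩)
    · exact Or.inr ⟨d, hd, w, hw, rfl⟩
    · exact Or.inr ⟨d * d', hDD ⟨d, hd, d', hd', rfl⟩, v, hv, mul_assoc _ _ _⟩
  -- `W` contains the scaled values of the functionals on `U` and is stable under left
  -- multiplication by `D`. Hence `g ↦ t⁻¹ φ(g)` maps `G` to `W`, and `g ↦ t⁻¹ n φ(g)` maps `G` to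
  -- itself.
  set G : Set M := U ∪ image2 (fun m a => M.act m a) (Prod.fst '' S) W with hG
  have hGb : IsBounded G := hU.union (M.isBdd₂_act _ _ h1 hWb)
  have hφ : ∀ p ∈ S, ∀ g ∈ G, (t : 𝕜)⁻¹ • dualLin p.2 g ∈ W := by
    rintro p hp g (hg | ⟨_, ⟨q, hq, rfl⟩, w, hw, rfl⟩)
    · exact Or.inl (smul_mem_smul_set ⟨p.2, ⟨p, hp, rfl⟩, g, hg, rfl⟩)
    · simp only
      rw [dualLin_act, ← smul_mul_assoc]
      refine hDW _ ?_ w hw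
      rw [← mem_smul_iff ht]
      exact hB ⟨p.2, ⟨p, hp, rfl⟩, q.1, ⟨q, hq, rfl⟩, rfl⟩
  refine ⟨G, subset_union_left, hGb, fun g hg => ?_⟩
  let r : M × LA M (self 𝕜 A) → M := fun p => (t : 𝕜)⁻¹ • rankOne p g
  have hr : IsBdd r := (isBdd₂_smul (𝕜 := 𝕜) (V := M)).comp (isBdd_const _)
    (isBdd₂_rankOne.comp isBdd_id (isBdd_const g))
  let b : M × LA M (self 𝕜 A) → Ell1 𝕜 M := fun p => (t : 𝕜) • delta (r p)
  have hb : IsBdd b := (isBdd₂_smul (𝕜 := 𝕜) (V := Ell1 𝕜 M)).comp (isBdd_const _)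
    (isBdd_delta.comp hr)
  refine ⟨Ell1.lift b hb ξ, ?_, ?_⟩
  · convert ellBall_ball hGb hb (by positivity) ht hξ fun p hp => ?_ using 2
    · field_simp; norm_num
    · have hm : r p ∈ G := by
        refine Or.inr ⟨p.1, ⟨p, hp, rfl⟩, _, hφ p hp g hg, ?_⟩
        simp only [r, rankOne_apply, map_smul]
      have := smul_mem_ellBall (delta_mem (𝕜 := 𝕜) hm) (t : 𝕜)
      rwa [RCLike.norm_ofReal, abs_of_pos ht, mul_one] at this
  · refine (Ell1.map_lift hb (isBdd_evalSum (𝕜 := 𝕜) (V := M)) ξ).trans ?_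
    rw [Ell1.liftHom_apply]
    refine Ell1.lift_congr _ _ (fun p => ?_) ξ
    rw [map_smul, evalSum_delta, smul_inv_smul₀ htn]

lemma sumRankOne_act (ξ : Ell1 𝕜 (N × LA M (self 𝕜 A))) (m : M) (a : A) :
    sumRankOne ξ (M.act m a) = N.act (sumRankOne ξ m) a := by
  have hk : IsBdd (N.act.flip a) := N.isBdd₂_act.comp isBdd_id (isBdd_const a)
  change _ = N.act.flip a _
  rw [Ell1.liftHom_apply, Ell1.liftHom_apply, Ell1.map_lift _ hk]
  refine Ell1.lift_congr _ _ (fun p => ?_) ξ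
  exact rankOne_act p m a

/-- If `g` is a nuclear endomorphism then `1 - g` is left invertible modulo maps that factor
through finitely generated projective modules. -/
theorem IsNuclear.exists_left_inverse (hmc : IsMultConvex 𝕜 A) {g : M ⟶ M} (hg : IsNuclear g) :
    ∃ w : M ⟶ M, FactorsThrough HasDualBasis (𝟙 M - w ≫ (𝟙 M - g)) := by
  obtain ⟨ξ, hξ⟩ := hg.exists_eq
  obtain ⟨ε, hε, h⟩ := exists_isContractive hmc _ ξ.2.2
  -- The tail keeps its support inside that of `ξ`, the bounded set for which `ε` was chosen, so its
  -- smallness in norm is enough.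
  obtain ⟨F, hF⟩ := exists_sum_delta ξ hε
  have hu := h _ (hF F subset_rfl)
  set η := ξ - ∑ i ∈ F, ξ.1 i • delta i with hη
  obtain ⟨w, hw, hw1, hw2⟩ := exists_inverse_of_contractive (Ell1.isBdd_liftHom _ _ η) hu
  have hwact : ∀ m a, w (M.act m a) = M.act (w m) a := fun m a => by
    rw [← hw2 (M.act (w m) a), sumRankOne_act, ← LinearMap.map_sub₂, hw1]
  let f : M × LA M (self 𝕜 A) → (M ⟶ M) := fun p => ofLin (rankOne p)
    (isBdd₂_rankOne.comp (isBdd_const p) isBdd_id) (rankOne_act p)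
  let W : M ⟶ M := ofLin w hw hwact
  have hsum : ∀ m, toLin g m = sumRankOne η m + ∑ i ∈ F, ξ.1 i • rankOne i m := fun m => by
    have h1 := LinearMap.map_sub (Ell1.liftHom rankOne isBdd₂_rankOne) ξ
      (∑ i ∈ F, ξ.1 i • delta i)
    rw [map_sum] at h1
    simp only [LinearMap.map_smul, Ell1.liftHom_delta] at h1
    have h2 := LinearMap.congr_fun h1 m
    rw [LinearMap.sub_apply, LinearMap.sum_apply] at h2
    rw [hξ, hη, h2]
    exact (sub_add_cancel _ _).symm
  refine ⟨W, ?_⟩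
  -- As `1 - tail` is inverted by `w`, only the finitely many rank-one terms remain; their
  -- coefficients are absorbed into the vectors.
  have e : 𝟙 M - W ≫ (𝟙 M - g) = ∑ i ∈ F, W ≫ f (ξ.1 i • i.1, i.2) := hom_ext fun m => by
    rw [toLin_sub, toLin_comp, toLin_sub, toLin_id, toLin_id, hsum, toLin_sum]
    change m - (w m - (Ell1.liftHom rankOne isBdd₂_rankOne η (w m) + _)) =
      ∑ i ∈ F, rankOne (ξ.1 i • i.1, i.2) (w m)
    rw [← sub_sub, hw1, sub_sub_cancel]
    refine Finset.sum_congr rfl fun i _ => ?_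
    rw [rankOne_apply, rankOne_apply, LinearMap.map_smul₂]
    rfl
  rw [e]
  exact FactorsThrough.sum isAdditiveClass_hasDualBasis F _ fun i _ =>
    (factorsThrough_rankOne _ fun m => rfl).comp_left W

end BornMod

end Modules

end Borno

end

noncomputable section

namespace Borno

open Set Bornology CategoryTheory Limits

universe u

/-! ### Nuclear maps of complexes and h-finiteness. -/

section Modules

variable {𝕜 : Type} [RCLike 𝕜] {A : Type u} [NonUnitalRing A] [Module 𝕜 A] [IsScalarTower 𝕜 A A]
  [SMulCommClass 𝕜 A A] [Bornology A] [CompleteBVS 𝕜 A] [BoundedMul A]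

open BornMod

/-- The identity is deformed to a map that passes first through finitely generated projectives and
then through the essentialization. In each degree the second stretch is nuclear, and so is its
composite with the first. -/
lemma IsHFinite.exists_isNuclearMap {M : CochainComplex (BornMod 𝕜 A) ℤ} (h : IsHFinite M) :
    ∃ g : M ⟶ M, IsNuclearMap g ∧ Nonempty (Homotopy (𝟙 M) g) := by
  obtain ⟨r, hr⟩ := h.essential
  obtain ⟨P, -, hP, ⟨e⟩⟩ := h.perfect
  refine ⟨e.hom ≫ (e.inv ≫ r.inv) ≫ essComplexMul M, fun i => ?_, ⟨?_⟩⟩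
  · exact ((hasDualBasis_of_isFG_of_isProjective (hP i).1 (hP i).2).isNuclear_comp_essMul
      ((e.inv ≫ r.inv).f i)).comp_left (e.hom.f i)
  · have h1 : Homotopy (r.inv ≫ essComplexMul M) (𝟙 M) := hr ▸ r.homotopyInvHomId
    have h2 := (e.homotopyHomInvId.compRight (r.inv ≫ essComplexMul M)).trans
      ((Homotopy.ofEq (Category.id_comp _)).trans h1)
    exact h2.symm.trans (Homotopy.ofEq (by simp only [Category.assoc]))

/-- Lifts `k i` of the components of `g'` commute with the differentials after precomposition with
`essMul`, because there they become the functorial maps induced by `g'`. Since `g` itself factors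
through `essMul` in each degree, `g` followed by `k` is a chain map. -/
lemma IsNuclearMap.exists_lift {M N : CochainComplex (BornMod 𝕜 A) ℤ} {g : M ⟶ N}
    (hg : IsNuclearMap g) {N' : CochainComplex (BornMod 𝕜 A) ℤ} {g' : N ⟶ N'}
    (hg' : IsNuclearMap g') : ∃ φ : M ⟶ essComplex N',
      φ ≫ essComplexMul N' = g ≫ g' ∧
      essComplexMul M ≫ φ =
        ((essFunctor 𝕜 A).mapHomologicalComplex _).map (g ≫ g') := by
  choose k hk1 hk2 using fun i => (hg' i).exists_lift
  choose l hl1 hl2 using fun i => (hg i).exists_lift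
  refine ⟨{ f := fun i => g.f i ≫ k i, comm' := fun i j _ => ?_ }, ?_, ?_⟩
  · change (g.f i ≫ k i) ≫ (essFunctor 𝕜 A).map (N'.d i j) = M.d i j ≫ g.f j ≫ k j
    have h1 : essMul (N.X i) ≫ k i ≫ (essFunctor 𝕜 A).map (N'.d i j) =
        essMul (N.X i) ≫ N.d i j ≫ k j := by
      rw [← Category.assoc, hk2, ← Functor.map_comp, ← Category.assoc, ← essMul_naturality,
        Category.assoc, hk2, ← Functor.map_comp, g'.comm]
    rw [← g.comm_assoc, ← hl1 i]
    simp only [Category.assoc, h1]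
  · ext i : 1
    exact (Category.assoc _ _ _).trans (congrArg (g.f i ≫ ·) (hk1 i))
  · ext i : 1
    change essMul (M.X i) ≫ g.f i ≫ k i = (essFunctor 𝕜 A).map (g.f i ≫ g'.f i)
    rw [← Category.assoc, ← essMul_naturality, Category.assoc, hk2, Functor.map_comp]

lemma isHFinite_of_homotopy (hmc : IsMultConvex 𝕜 A) {M : CochainComplex (BornMod 𝕜 A) ℤ}
    (hM : IsBoundedComplex M) {g : M ⟶ M} (hg : IsNuclearMap g) (h : Homotopy (𝟙 M) g) :
    IsHFinite M := by
  -- A chain map to the essentialization is available for a composite of two nuclear maps, so the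
  -- square of `g` is used in its place.
  have hgg : Homotopy (g ≫ g) (𝟙 M) :=
    ((h.comp h).symm).trans (Homotopy.ofEq (Category.id_comp _))
  constructor
  · obtain ⟨φ, h1, h2⟩ := hg.exists_lift hg
    refine ⟨⟨essComplexMul M, φ, (Homotopy.ofEq h2).trans
      (((essFunctor 𝕜 A).mapHomotopy hgg).trans
        (Homotopy.ofEq (CategoryTheory.Functor.map_id _ _))),
      (Homotopy.ofEq h1).trans hgg⟩, rfl⟩
  · obtain ⟨n, hn⟩ := hM
    obtain ⟨Q, m, hQ, hQ', e⟩ := exists_homotopyEquiv_of_homotopic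
      (isAdditiveClass_hasDualBasis (𝕜 := 𝕜) (A := A)) (fun {X Y} f => IsNuclear f)
      (fun _ g hf => hf.comp_right g) (fun f _ hg => hg.comp_left f)
      -- Outside this interval the complex vanishes, and zero modules have an empty dual basis.
      (fun _ hg => hg.exists_left_inverse hmc) (Finset.Icc (-(n : ℤ)) n) M
      (fun i hi => isAdditiveClass_hasDualBasis.zero _ ((isZero_iff _).2 (hn i
        (not_le.1 fun h => hi (Finset.mem_Icc.2 (abs_le.1 h)))))) n
      (fun i hi => (isZero_iff _).2 (hn i hi)) g hg h
    exact ⟨Q, ⟨m, fun i hi => (isZero_iff _).1 (hQ i hi)⟩,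
      fun i => ⟨(hQ' i).isFG, (hQ' i).isProjective⟩, e⟩

end Modules

end Borno

end

theorem corollaryC {𝕜 : Type} [RCLike 𝕜] {A : Type*} [NonUnitalRing A] [Module 𝕜 A]
    [IsScalarTower 𝕜 A A] [SMulCommClass 𝕜 A A] [Bornology A] [Borno.CompleteBVS 𝕜 A]
    [BoundedMul A] (hqu : Borno.IsQuasiUnital 𝕜 A) (hmc : Borno.IsMultConvex 𝕜 A)
    (M : CochainComplex (Borno.BornMod 𝕜 A) ℤ) (hM : Borno.IsBoundedComplex M) :
    Borno.IsHFinite M ↔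
      ∃ g : M ⟶ M, Borno.IsNuclearMap g ∧
        Nonempty (Homotopy (CategoryTheory.CategoryStruct.id M) g) :=
  ⟨fun h => h.exists_isNuclearMap,
    fun ⟨_, hg, ⟨h⟩⟩ => Borno.isHFinite_of_homotopy hmc hM hg h⟩
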